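/- Fix constants $\gamma,\mu,\eta,M>0$ and $q\in(0,1)$. Consider a linear model $y=X\beta^*+\varepsilon$ with $n\ge 1$ observations in dimension $p$, where $p/n\le\gamma$, $\beta^*\in\mathbb R^p$, the rows $x_1,\dots,x_n$ of $X\in\mathbb R^{n\times p}$ are iid $N(0,\Sigma)$ with $\Sigma$ invertible, and the noise $\varepsilon\in\mathbb R^n$ is independent of $X$ and has iid coordinates with an absolutely continuous law $F$ such that $\mathbb E|\varepsilon_i|^{1+q}\le M$. Assume $\|\Sigma^{1/2}\beta^*\|^2\le M$. Let $(\rho,g)$ and $(\tilde\rho,\tilde g)$ be two loss-penalty pairs, each satisfying the following conditions (stated for $(\rho,g)$): - $\rho:\mathbb R\to\mathbb R$ is convex and continuously differentiable with unique minimizer $0$, and $\psi=\rho'$ is $1$-Lipschitz with $|\psi|\le M$; - $g:\mathbb R^p\to\mathbb R$ is minimized at $0$, and $b\mapsto g(b)-\frac{\mu}{2}b^\top\Sigma b$ is convex. Let $\hat\beta(y,X)=\operatorname{argmin}_{b\in\mathbb R^p}\frac1n\sum_{i=1}^n\rho(y_i-x_i^\top b)+g(b)$ and $r=y-X\hat\beta$,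 and let $\tilde\beta$, $\tilde r$ and $\tilde\psi=\tilde\rho'$ be defined in the same way from $(\tilde\rho,\tilde g)$. Almost surely, $\hat\beta$ is differentiable at $(y,X)$, $\psi$ is differentiable at every $r_i$, and there is a matrix $\hat A=\hat A(y,X)\in\mathbb R^{p\times p}$ with $\|\Sigma^{1/2}\hat A\Sigma^{1/2}\|_{op}\le (n\mu)^{-1}$ such that, for all $i\in\{1,\dots,n\}$ and $j\in\{1,\dots,p\}$, $$\frac{\partial\hat\beta}{\partial y_i}=\hat A X^\top e_i\,\psi'(r_i),\qquad \frac{\partial\hat\beta}{\partial x_{ij}}=\hat A e_j\,\psi(r_i)-\hat A X^\top e_i\,\psi'(r_i)\,\hat\beta_j ;$$ the same holds for $\tilde\beta$ with a matrix $\tilde A$. Let $\hat A,\tilde A$ be any such matrices (chosen as functions of $(y,X)$, arbitrary where no such matrix exists). Put $$\Omega=\{\|X\Sigma^{-1/2}\|_{op}\le 2\sqrt n+\sqrt p\}\cap\{\|\varepsilon\|^2\le n^{2/(1+q)}\}.$$ Then there is a constant $C>0$, depending only on $\gamma,\mu,\eta,q,M$, such that for every such problem $$\mathbb P\Bigl(\|\Sigma^{1/2}(\hat\beta-\beta^*)\|^2-\|\Sigma^{1/2}(\tilde\beta-\beta^*)\|^2>\eta,\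 \ \|r+\operatorname{tr}[\Sigma\hat A]\psi(r)\|^2\le\|\tilde r+\operatorname{tr}[\Sigma\tilde A]\tilde\psi(\tilde r)\|^2\Bigr)\le C\,n^{-q/(1+q)}+\mathbb P(\Omega^c).$$ Moreover, along any sequence of such problems indexed by the sample size $n$, with the constants and the noise law $F$ fixed while $p$, $\beta^*$, $\Sigma$ and the two loss-penalty pairs may depend on $n$, the right-hand side tends to $0$ as $n\to\infty$. -/

import Mathlib

open MeasureTheory ProbabilityTheory Filter Topology
open scoped MatrixOrder

universe u

noncomputable section

namespace MEstimation

/-- Euclidean space of dimension `k`. -/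
abbrev Vec (k : ℕ) : Type := EuclideanSpace ℝ (Fin k)

/-- Design matrices, stored by rows: `X i` is the feature vector `x_i`. -/
abbrev Design (n p : ℕ) : Type := Fin n → Vec p

/-- The design as an `n × p` matrix. -/
def designMatrix {n p : ℕ} (X : Design n p) : Matrix (Fin n) (Fin p) ℝ :=
  Matrix.of fun i j => X i j

/-- Operator norm of a matrix between Euclidean spaces. -/
def opNorm {m k : ℕ} (B : Matrix (Fin m) (Fin k) ℝ) : ℝ :=
  ‖LinearMap.toContinuousLinearMap (Matrix.toEuclideanLin B)‖

/-- `S ^ (1/2)`, the positive semidefinite square root of a positive semidefinite matrix. -/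
def sqrtMat {p : ℕ} (S : Matrix (Fin p) (Fin p) ℝ) : Matrix (Fin p) (Fin p) ℝ :=
  CFC.sqrt S

/-- `‖S ^ (1/2) b‖ ^ 2`. -/
def sqNormCov {p : ℕ} (S : Matrix (Fin p) (Fin p) ℝ) (b : Vec p) : ℝ :=
  ‖Matrix.toEuclideanLin (sqrtMat S) b‖ ^ 2

/-- The vector `X b`. -/
def linearPredictor {n p : ℕ} (X : Design n p) (b : Vec p) : Vec n :=
  WithLp.toLp 2 fun i => inner ℝ (X i) b

/-- Componentwise application of a univariate function. -/
def mapVec {n : ℕ} (f : ℝ → ℝ) (v : Vec n) : Vec n :=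
  WithLp.toLp 2 fun i => f (v i)

/-- The objective `b ↦ (1/n) ∑ i, ρ (y_i - x_iᵀ b) + g b`. -/
def objective {n p : ℕ} (ρ : ℝ → ℝ) (g : Vec p → ℝ) (y : Vec n) (X : Design n p)
    (b : Vec p) : ℝ :=
  (n : ℝ)⁻¹ * ∑ i, ρ (y i - inner ℝ (X i) b) + g b

/-- The regularized M-estimator, a minimizer of the objective
(it exists and is unique for the losses and penalties considered here). -/
def mEstimator {n p : ℕ} (ρ : ℝ → ℝ) (g : Vec p → ℝ) (y : Vec n) (X : Design n p) : Vec p :=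
  Classical.epsilon fun b => ∀ b', objective ρ g y X b ≤ objective ρ g y X b'

/-- The residual vector `r = y - X β̂(y, X)`. -/
def residual {n p : ℕ} (ρ : ℝ → ℝ) (g : Vec p → ℝ) (y : Vec n) (X : Design n p) : Vec n :=
  y - linearPredictor X (mEstimator ρ g y X)

/-- Convex continuously differentiable loss with unique minimizer `0`
and `1`-Lipschitz derivative. -/
structure IsLoss (ρ : ℝ → ℝ) : Prop where
  convex : ConvexOn ℝ Set.univ ρ
  unique_min : ∀ u, u ≠ 0 → ρ 0 < ρ u
  contDiff : ContDiff ℝ 1 ρ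
  lipschitz_deriv : LipschitzWith 1 (deriv ρ)

/-- `g` is `μ`-strongly convex with respect to `S`: the map
`b ↦ g b - (μ / 2) bᵀ S b` is convex. -/
def IsStronglyConvexWrt {p : ℕ} (μ : ℝ) (S : Matrix (Fin p) (Fin p) ℝ) (g : Vec p → ℝ) : Prop :=
  ConvexOn ℝ Set.univ fun b : Vec p => g b - μ / 2 * inner ℝ b (Matrix.toEuclideanLin S b)

/-- `A` is a matrix describing the derivatives of the M-estimator at `(y, X)`: the map
`(y, X) ↦ β̂(y, X)` is differentiable there, `‖S ^ (1/2) A S ^ (1/2)‖ ≤ 1 / (n μ)` and,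
with `ψ = ρ'` and `r` the residual vector,
`∂β̂/∂y_i = ψ'(r_i) A Xᵀ e_i` and `∂β̂/∂x_ij = ψ(r_i) A e_j - ψ'(r_i) β̂_j A Xᵀ e_i`. -/
structure IsDerivMatrix {n p : ℕ} (μ : ℝ) (S : Matrix (Fin p) (Fin p) ℝ) (ρ : ℝ → ℝ)
    (g : Vec p → ℝ) (y : Vec n) (X : Design n p) (A : Matrix (Fin p) (Fin p) ℝ) : Prop where
  differentiableAt :
    DifferentiableAt ℝ (fun z : Vec n × Design n p => mEstimator ρ g z.1 z.2) (y, X)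
  differentiableAt_psi : ∀ i, DifferentiableAt ℝ (deriv ρ) (residual ρ g y X i)
  opNorm_le : opNorm (sqrtMat S * A * sqrtMat S) ≤ ((n : ℝ) * μ)⁻¹
  deriv_y : ∀ i : Fin n,
    fderiv ℝ (fun z : Vec n × Design n p => mEstimator ρ g z.1 z.2) (y, X)
        (EuclideanSpace.single i 1, 0) =
      deriv (deriv ρ) (residual ρ g y X i) • Matrix.toEuclideanLin A (X i)
  deriv_x : ∀ (i : Fin n) (j : Fin p),
    fderiv ℝ (fun z : Vec n × Design n p => mEstimator ρ g z.1 z.2) (y, X)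
        (0, Pi.single i (EuclideanSpace.single j 1)) =
      deriv ρ (residual ρ g y X i) • Matrix.toEuclideanLin A (EuclideanSpace.single j 1)
        - (deriv (deriv ρ) (residual ρ g y X i) * mEstimator ρ g y X j) •
            Matrix.toEuclideanLin A (X i)

/-- A choice, for every `(y, X)` where this is possible, of a matrix describing the derivatives
of the M-estimator (arbitrary elsewhere). -/
def IsDerivMatrixChoice {n p : ℕ} (μ : ℝ) (S : Matrix (Fin p) (Fin p) ℝ) (ρ : ℝ → ℝ)
    (g : Vec p → ℝ) (A : Vec n → Design n p → Matrix (Fin p) (Fin p) ℝ) : Prop :=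
  ∀ y X, (∃ B, IsDerivMatrix μ S ρ g y X B) → IsDerivMatrix μ S ρ g y X (A y X)

/-- The criterion `‖r + tr[S A] ψ(r)‖ ^ 2` with `ψ = ρ'`. -/
def criterion {n p : ℕ} (S : Matrix (Fin p) (Fin p) ℝ) (ρ : ℝ → ℝ) (g : Vec p → ℝ)
    (A : Vec n → Design n p → Matrix (Fin p) (Fin p) ℝ) (y : Vec n) (X : Design n p) : ℝ :=
  ‖residual ρ g y X + (S * A y X).trace • mapVec (deriv ρ) (residual ρ g y X)‖ ^ 2

/-- The data of a linear regression problem with `n` observations together with two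
loss-penalty pairs `(ρ₁, g₁)` and `(ρ₂, g₂)`. -/
structure SelectionProblem (n : ℕ) where
  /-- dimension -/
  p : ℕ
  /-- sample space -/
  Ω : Type u
  [mΩ : MeasurableSpace Ω]
  /-- probability measure -/
  P : Measure Ω
  /-- design -/
  X : Ω → Design n p
  /-- noise -/
  ε : Ω → Vec n
  /-- covariance of the rows of the design -/
  S : Matrix (Fin p) (Fin p) ℝ
  /-- regression vector -/
  βstar : Vec p
  /-- first loss -/
  ρ₁ : ℝ → ℝ
  /-- first penalty -/
  g₁ : Vec p → ℝ
  /-- second loss -/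
  ρ₂ : ℝ → ℝ
  /-- second penalty -/
  g₂ : Vec p → ℝ

attribute [instance] SelectionProblem.mΩ

namespace SelectionProblem

variable {n : ℕ}

/-- The response `y = X β* + ε`. -/
def y (D : SelectionProblem.{u} n) (ω : D.Ω) : Vec n :=
  linearPredictor (D.X ω) D.βstar + D.ε ω

/-- The working assumptions, `F` being the common law of the noise variables. -/
structure Assumptions (D : SelectionProblem.{u} n) (γ μ q M : ℝ) (F : Measure ℝ) : Prop where
  isProbabilityMeasure : IsProbabilityMeasure D.P
  dim_le : (D.p : ℝ) / n ≤ γ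
  cov_posDef : D.S.PosDef
  measurable_X : Measurable D.X
  measurable_ε : Measurable D.ε
  indep_rows : iIndepFun (fun (i : Fin n) ω => D.X ω i) D.P
  law_rows : ∀ i, D.P.map (fun ω => D.X ω i) = multivariateGaussian 0 D.S
  indep_X_ε : IndepFun D.X D.ε D.P
  indep_noise : iIndepFun (fun (i : Fin n) ω => D.ε ω i) D.P
  law_noise : ∀ i, D.P.map (fun ω => D.ε ω i) = F
  noise_continuous : F ≪ volume
  noise_moment : ∫⁻ x, ENNReal.ofReal (|x| ^ (1 + q)) ∂F ≤ ENNReal.ofReal M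
  loss₁ : IsLoss D.ρ₁
  loss₂ : IsLoss D.ρ₂
  penalty₁ : IsStronglyConvexWrt μ D.S D.g₁
  penalty₂ : IsStronglyConvexWrt μ D.S D.g₂
  penalty_min₁ : ∀ b, D.g₁ 0 ≤ D.g₁ b
  penalty_min₂ : ∀ b, D.g₂ 0 ≤ D.g₂ b
  psi_bound₁ : ∀ u, |deriv D.ρ₁ u| ≤ M
  psi_bound₂ : ∀ u, |deriv D.ρ₂ u| ≤ M
  signal_bound : sqNormCov D.S D.βstar ≤ M

/-- The event `‖X S ^ (-1/2)‖ ≤ 2 √n + √p` and `‖ε‖ ^ 2 ≤ n ^ (2 / (1 + q))`. -/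
def goodEvent (D : SelectionProblem.{u} n) (q : ℝ) : Set D.Ω :=
  {ω | opNorm (designMatrix (D.X ω) * (sqrtMat D.S)⁻¹) ≤ 2 * √(n : ℝ) + √(D.p : ℝ)} ∩
    {ω | ‖D.ε ω‖ ^ 2 ≤ (n : ℝ) ^ (2 / (1 + q))}

/-- The event that the first estimator has an out-of-sample error larger by more than `η`
although its criterion is not larger. -/
def wrongSelection (D : SelectionProblem.{u} n) (η : ℝ)
    (A₁ A₂ : Vec n → Design n D.p → Matrix (Fin D.p) (Fin D.p) ℝ) : Set D.Ω :=
  {ω | sqNormCov D.S (mEstimator D.ρ₁ D.g₁ (D.y ω) (D.X ω) - D.βstar)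
        - sqNormCov D.S (mEstimator D.ρ₂ D.g₂ (D.y ω) (D.X ω) - D.βstar) > η ∧
      criterion D.S D.ρ₁ D.g₁ A₁ (D.y ω) (D.X ω)
        ≤ criterion D.S D.ρ₂ D.g₂ A₂ (D.y ω) (D.X ω)}

end SelectionProblem

end MEstimation

end

/-! Write `z_i = S^(-1/2) x_i` for the whitened rows and `h = S^(1/2) (β̂ - β*)`, so that `r_i = ε_i
- ⟨z_i, h⟩` and the out-of-sample error is `‖h‖²`. The derivative formulas give `∑_j ∂h_j/∂z_ij = t
ψ(r_i) - e_i` with `t = tr[S A]` and `e_i = ψ'(r_i) ⟨h, S^(1/2) A S^(1/2) z_i⟩`, where `∑ e_i²` is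
bounded. Hence `r_i + t ψ(r_i) = ε_i - ξ_i + e_i`, where `ξ_i = ⟨z_i, h⟩ - ∑_j ∂h_j/∂z_ij` is the
Gaussian divergence of `h` in row `i`.

The heart of the proof is that the criterion equals `‖ε‖² + n ‖h‖²` up to `N (1 + W)` times a
constant, where `N = n^(1/(1+q))` and `W ≥ 0` has bounded mean over the design for each fixed noise
with `‖ε‖ ≤ N` (`exists_error_variable`). The term `‖ε‖²` is common to both estimators. A wrong
selection on the good event therefore forces `η n ≤ C N (2 + W₁ + W₂)`, that is `η n^(q/(1+q)) ≤ C
(2 + W₁ + W₂)`, and Markov's inequality gives the rate.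

The expansion compares `ξ_i` with `b_i = ⟨z_i, h^(-i)⟩`, where `h^(-i)` is computed with row `i`
replaced by zero. The three quantities `∑ ε_i ξ_i`, `ξ_i - b_i` and `∑ (b_i² - ‖h^(-i)‖²)` are all
divergences of explicit vector fields of the design. The second-order Stein inequality `E (div F)² ≤
E ‖F‖² + E ‖∇F‖²` bounds their second moments by `O(‖ε‖²)`, `O(1)` after summation over `i`, and
`O(n)`. The field energies come from one deterministic estimate, the contraction inequality
`IsLossPenalty.contraction`: strong convexity of the penalty together with cocoercivity of `ψ`
controls gradients of `h` and leave-one-out differences alike. These bounds hold where the operator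
norm of the design is `O(√n)`, so every field is multiplied by a Lipschitz cutoff; since `h` is only
locally Lipschitz, the Stein inequality is proved for Lipschitz fields with compact support.

The derivative matrix exists almost everywhere: `β̂` is locally Lipschitz (Rademacher), the
residuals almost surely avoid the null set where `ψ` is not differentiable, and the derivative of
`β̂` factors through the derivative of the score.

For the limit, the operator norm is handled by a Chevet-type Gaussian comparison
(`slepian_measure_le`) with Chebyshev bounds for sums of squares, and `‖ε‖² ≤ N²` by truncating the
noise at `δ N`, letting `n → ∞` for fixed small `δ`. -/

noncomputable section

namespace MEstimation

/-! ### Second-order Stein inequality for Lipschitz fields under a Gaussian weight. -/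

section Stein

open Metric Set
open scoped NNReal

variable {E : Type*} [NormedAddCommGroup E] [NormedSpace ℝ E]

/-- Lipschitz functions with compact support. -/
structure LipCompact (f : E → ℝ) : Prop where
  lip : ∃ C, LipschitzWith C f
  supp : HasCompactSupport f

/-- Compactness gives a uniform constant on the ball of radius `r + 1`. The margin 1 serves the
mixed pairs: a point with nonzero value and a point outside that ball are at distance at least 1, so
a bound for `|f|` is a Lipschitz constant for them. -/
theorem LocallyLipschitz.lipschitzWith_of_hasCompactSupport [FiniteDimensional ℝ E] {f : E → ℝ}
    (hf : LocallyLipschitz f) (hs : HasCompactSupport f) : ∃ C, LipschitzWith C f := by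
  have : ProperSpace E := FiniteDimensional.proper ℝ E
  obtain ⟨r, hr⟩ := hs.isCompact.isBounded.subset_closedBall (0 : E)
  obtain ⟨K, hK⟩ := (hf.locallyLipschitzOn (s := closedBall (0 : E) (r + 1))
    ).exists_lipschitzOnWith_of_compact (isCompact_closedBall _ _)
  obtain ⟨B, hB⟩ := hs.exists_bound_of_continuous hf.continuous
  have hB0 : 0 ≤ B := (norm_nonneg _).trans (hB 0)
  have key : ∀ x y, x ∈ closedBall (0 : E) (r + 1) → y ∉ closedBall (0 : E) (r + 1) →
      dist (f x) (f y) ≤ B * dist x y := by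
    intro x y _ hy
    have hy0 : f y = 0 := by
      by_contra h
      exact hy (closedBall_subset_closedBall (by linarith) (hr (subset_tsupport f h)))
    by_cases hx0 : f x = 0
    · rw [hx0, hy0, dist_self]; positivity
    have hxr : dist x 0 ≤ r := hr (subset_tsupport f hx0)
    have hyr : r + 1 < dist y 0 := by simpa using hy
    have h1 : 1 ≤ dist x y := by
      have := dist_triangle y x 0
      rw [dist_comm y x] at this; linarith
    calc dist (f x) (f y) = ‖f x‖ := by rw [hy0, dist_zero_right]
      _ ≤ B * 1 := by rw [mul_one]; exact hB x
      _ ≤ _ := by gcongr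
  refine ⟨K + B.toNNReal, LipschitzWith.of_dist_le_mul fun x y => ?_⟩
  have hd : 0 ≤ dist x y := dist_nonneg
  have hcoe : ((K + B.toNNReal : ℝ≥0) : ℝ) = K + B := by simp [hB0]
  rw [hcoe, add_mul]
  have hKd : 0 ≤ K * dist x y := by positivity
  have hBd : 0 ≤ B * dist x y := by positivity
  by_cases hx : x ∈ closedBall (0 : E) (r + 1) <;> by_cases hy : y ∈ closedBall (0 : E) (r + 1)
  · linarith [hK.dist_le_mul x hx y hy]
  · linarith [key x y hx hy]
  · have := key y x hy hx
    rw [dist_comm, dist_comm y x] at this; linarith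
  · have hz : ∀ z, z ∉ closedBall (0 : E) (r + 1) → f z = 0 := fun z hz => by
      by_contra h
      exact hz (closedBall_subset_closedBall (by linarith) (hr (subset_tsupport f h)))
    rw [hz x hx, hz y hy, dist_self]; linarith

theorem LocallyLipschitz.real_mul {X : Type*} [PseudoEMetricSpace X] {f g : X → ℝ}
    (hf : LocallyLipschitz f) (hg : LocallyLipschitz g) :
    LocallyLipschitz fun x => f x * g x := by
  have h : LocallyLipschitz fun z : ℝ × ℝ => z.1 * z.2 :=
    ContDiff.locallyLipschitz (𝕂 := ℝ) (contDiff_fst.mul contDiff_snd)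
  exact h.comp (hf.prodMk hg)

theorem LocallyLipschitz.real_add {X : Type*} [PseudoEMetricSpace X] {f g : X → ℝ}
    (hf : LocallyLipschitz f) (hg : LocallyLipschitz g) :
    LocallyLipschitz fun x => f x + g x := by
  have h : LocallyLipschitz fun z : ℝ × ℝ => z.1 + z.2 :=
    ContDiff.locallyLipschitz (𝕂 := ℝ) (contDiff_fst.add contDiff_snd)
  exact h.comp (hf.prodMk hg)

theorem LocallyLipschitz.real_sub {X : Type*} [PseudoEMetricSpace X] {f g : X → ℝ}
    (hf : LocallyLipschitz f) (hg : LocallyLipschitz g) :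
    LocallyLipschitz fun x => f x - g x := by
  have h : LocallyLipschitz fun z : ℝ × ℝ => z.1 - z.2 :=
    ContDiff.locallyLipschitz (𝕂 := ℝ) (contDiff_fst.sub contDiff_snd)
  exact h.comp (hf.prodMk hg)

theorem LocallyLipschitz.real_sum {X ι : Type*} [PseudoEMetricSpace X] (s : Finset ι)
    {f : ι → X → ℝ} (hf : ∀ i, LocallyLipschitz (f i)) :
    LocallyLipschitz fun x => ∑ i ∈ s, f i x := by
  classical
  induction s using Finset.induction_on with
  | empty => simpa using LocallyLipschitz.const (0 : ℝ)
  | insert i s hi ih =>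
    simp_rw [Finset.sum_insert hi]
    exact LocallyLipschitz.real_add (hf i) ih

namespace LipCompact

variable {f g : E → ℝ}

theorem continuous (hf : LipCompact f) : Continuous f := hf.lip.choose_spec.continuous

theorem of_locallyLipschitz [FiniteDimensional ℝ E] (hf : LocallyLipschitz f)
    (hs : HasCompactSupport f) : LipCompact f :=
  ⟨LocallyLipschitz.lipschitzWith_of_hasCompactSupport hf hs, hs⟩

theorem locallyLipschitz (hf : LipCompact f) : LocallyLipschitz f :=
  hf.lip.choose_spec.locallyLipschitz

theorem mul_right [FiniteDimensional ℝ E] (hf : LipCompact f) (hg : LocallyLipschitz g) :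
    LipCompact fun x => f x * g x :=
  of_locallyLipschitz (LocallyLipschitz.real_mul hf.locallyLipschitz hg) hf.supp.mul_right

theorem comp_add_right (hf : LipCompact f) (v : E) : LipCompact fun x => f (x + v) := by
  obtain ⟨C, hC⟩ := hf.lip
  refine ⟨⟨C, ?_⟩, hf.supp.comp_homeomorph (Homeomorph.addRight v)⟩
  have := hC.comp (isometry_add_right v).lipschitz
  rwa [mul_one] at this

theorem sub [FiniteDimensional ℝ E] (hf : LipCompact f) (hg : LipCompact g) :
    LipCompact fun x => f x - g x :=
  of_locallyLipschitz (LocallyLipschitz.real_sub hf.locallyLipschitz hg.locallyLipschitz)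
    (hf.supp.sub hg.supp)

theorem const_mul [FiniteDimensional ℝ E] (hf : LipCompact f) (t : ℝ) :
    LipCompact fun x => t * f x :=
  of_locallyLipschitz (LocallyLipschitz.real_mul (LocallyLipschitz.const t) hf.locallyLipschitz)
    hf.supp.mul_left

theorem lineDeriv_eq_zero (_hf : LipCompact f) {x : E} (hx : x ∉ tsupport f) (v : E) :
    lineDeriv ℝ f x v = 0 := by
  have h : f =ᶠ[𝓝 x] fun _ => 0 := by
    filter_upwards [(isClosed_tsupport f).isOpen_compl.mem_nhds hx] with y hy
    exact image_eq_zero_of_notMem_tsupport hy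
  rw [h.lineDeriv_eq]
  simp [lineDeriv]

theorem norm_lineDeriv_le (hf : LipCompact f) (v : E) : ∃ B, ∀ x, ‖lineDeriv ℝ f x v‖ ≤ B := by
  obtain ⟨C, hC⟩ := hf.lip
  exact ⟨_, fun x => norm_lineDeriv_le_of_lipschitz ℝ hC⟩

variable [FiniteDimensional ℝ E] [MeasurableSpace E] [BorelSpace E]
  {μ : Measure E} [μ.IsAddHaarMeasure]

theorem integrable (hf : LipCompact f) : Integrable f μ :=
  hf.continuous.integrable_of_hasCompactSupport hf.supp

theorem integrable_lineDeriv_mul (hf : LipCompact f) (v : E) {k : E → ℝ} (hk : Continuous k) :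
    Integrable (fun x => lineDeriv ℝ f x v * k x) μ := by
  obtain ⟨B, hB⟩ := hf.norm_lineDeriv_le v
  have h1 : Integrable (fun x => (tsupport f).indicator k x) μ := by
    rw [integrable_indicator_iff (isClosed_tsupport f).measurableSet]
    exact hk.continuousOn.integrableOn_compact hf.supp
  refine (h1.bdd_mul (c := B) (aestronglyMeasurable_lineDeriv hf.continuous μ)
    (.of_forall hB)).congr (.of_forall fun x => ?_)
  by_cases hx : x ∈ tsupport f
  · simp [indicator_of_mem hx]
  · simp [hf.lineDeriv_eq_zero hx]

theorem integrable_lineDeriv_mul_lineDeriv_mul (hf : LipCompact f) (hg : LipCompact g) (v v' : E)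
    {k : E → ℝ} (hk : Continuous k) :
    Integrable (fun x => lineDeriv ℝ f x v * lineDeriv ℝ g x v' * k x) μ := by
  obtain ⟨B, hB⟩ := hf.norm_lineDeriv_le v
  refine ((hg.integrable_lineDeriv_mul v' hk).bdd_mul (c := B)
    (aestronglyMeasurable_lineDeriv hf.continuous μ) (.of_forall hB)).congr
    (.of_forall fun x => by simp [mul_assoc])

theorem ae_lineDifferentiableAt (hf : LipCompact f) (v : E) :
    ∀ᵐ x ∂μ, LineDifferentiableAt ℝ f x v :=
  hf.lip.choose_spec.ae_lineDifferentiableAt v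

theorem ae_differentiableAt (hf : LipCompact f) : ∀ᵐ x ∂μ, DifferentiableAt ℝ f x :=
  hf.lip.choose_spec.ae_differentiableAt

end LipCompact

/-- A Gaussian-type weight `w` with respect to coordinates `c` dual to a family of vectors `e`:
`∂_b w = - c_b w`. -/
structure IsGaussWeight {α : Type*} [DecidableEq α] (e : α → E) (c : α → E →L[ℝ] ℝ)
    (w : E → ℝ) : Prop where
  dual : ∀ a b, c a (e b) = if a = b then 1 else 0
  contDiff : ContDiff ℝ 1 w
  hasLineDerivAt : ∀ b x, HasLineDerivAt ℝ w (-(c b x * w x)) x (e b)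

section

variable [FiniteDimensional ℝ E] [MeasurableSpace E] [BorelSpace E]
  {μ : Measure E} [μ.IsAddHaarMeasure] {α : Type*} [DecidableEq α]
  {e : α → E} {c : α → E →L[ℝ] ℝ} {w : E → ℝ} {f g : E → ℝ}

/-- The adjoint of the partial derivative with respect to a Gaussian weight. -/
def adjDeriv (e : α → E) (c : α → E →L[ℝ] ℝ) (a : α) (f : E → ℝ) (x : E) : ℝ :=
  c a x * f x - lineDeriv ℝ f x (e a)

omit [FiniteDimensional ℝ E] [MeasurableSpace E] [BorelSpace E] in
theorem HasLineDerivAt.real_mul {f g : E → ℝ} {f' g' : ℝ} {x v : E} (hf : HasLineDerivAt ℝ f f' x v)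
    (hg : HasLineDerivAt ℝ g g' x v) :
    HasLineDerivAt ℝ (fun x => f x * g x) (f' * g x + f x * g') x v := by
  have h : HasDerivAt (fun t : ℝ => f (x + t • v) * g (x + t • v)) _ 0 := HasDerivAt.mul hf hg
  simpa [HasLineDerivAt] using h

/-- Integration by parts of `f` against `g w`; differentiating the weight produces the factor `c_b`.
-/
theorem integral_adjDeriv_mul (hw : IsGaussWeight e c w) (hf : LipCompact f) (hg : LipCompact g)
    (b : α) :
    ∫ x, adjDeriv e c b f x * g x * w x ∂μ = ∫ x, f x * lineDeriv ℝ g x (e b) * w x ∂μ := by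
  have hwl : LocallyLipschitz w := ContDiff.locallyLipschitz (𝕂 := ℝ) hw.contDiff
  have hgw := hg.mul_right hwl
  obtain ⟨Cf, hCf⟩ := hf.lip
  obtain ⟨Cg, hCg⟩ := hgw.lip
  have key := hCf.integral_lineDeriv_mul_eq (μ := μ) hCg hgw.supp (e b)
  have hcw := hw.contDiff.continuous
  have i1 : Integrable (fun x => c b x * f x * g x * w x) μ := by
    refine Continuous.integrable_of_hasCompactSupport ?_ ?_
    · exact ((((c b).continuous.mul hf.continuous).mul hg.continuous).mul hcw)
    · exact ((hf.supp.mul_left (f := fun x => c b x)).mul_right).mul_right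
  have i2 : Integrable (fun x => lineDeriv ℝ f x (e b) * (g x * w x)) μ :=
    hf.integrable_lineDeriv_mul _ (hg.continuous.mul hcw)
  have i3 : Integrable (fun x => lineDeriv ℝ g x (e b) * (f x * w x)) μ :=
    hg.integrable_lineDeriv_mul _ (hf.continuous.mul hcw)
  have e1 : ∀ᵐ x ∂μ, lineDeriv ℝ (fun x => g x * w x) x (-(e b)) * f x
      = c b x * f x * g x * w x - lineDeriv ℝ g x (e b) * (f x * w x) := by
    filter_upwards [hg.ae_lineDifferentiableAt (μ := μ) (e b)] with x hx
    have h := HasLineDerivAt.real_mul hx.hasLineDerivAt (hw.hasLineDerivAt b x)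
    rw [lineDeriv_neg, h.lineDeriv]; ring
  rw [integral_congr_ae e1, integral_sub i1 i3] at key
  have e2 : ∫ x, adjDeriv e c b f x * g x * w x ∂μ
      = ∫ x, c b x * f x * g x * w x ∂μ - ∫ x, lineDeriv ℝ f x (e b) * (g x * w x) ∂μ := by
    rw [← integral_sub i1 i2]
    congr 1; ext x; unfold adjDeriv; ring
  rw [e2, key]
  simp only [sub_sub_cancel]
  congr 1; ext x; ring

/-- The commutation relation `[∂_b, δ_a] = 1_{a = b}` in integrated form, `δ_a` denoting `adjDeriv`.
For smooth functions two integrations by parts suffice, but the first derivatives of a Lipschitz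
function cannot be differentiated again. The second derivative is therefore replaced by a difference
quotient, which is moved by translation invariance, and the limit is taken at the end. -/
theorem integral_adjDeriv_mul_adjDeriv (hw : IsGaussWeight e c w) (hf : LipCompact f)
    (hg : LipCompact g) (a b : α) :
    ∫ x, adjDeriv e c a f x * adjDeriv e c b g x * w x ∂μ
      = ∫ x, lineDeriv ℝ f x (e b) * lineDeriv ℝ g x (e a) * w x ∂μ
        + if a = b then ∫ x, f x * g x * w x ∂μ else 0 := by
  have hwl : LocallyLipschitz w := ContDiff.locallyLipschitz (𝕂 := ℝ) hw.contDiff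
  have hcw := hw.contDiff.continuous
  have hG := hg.mul_right hwl
  set G : E → ℝ := fun x => g x * w x with hGdef
  have hu : Integrable (adjDeriv e c a f) μ := by
    have h1 : Integrable (fun x => c a x * f x) μ :=
      ((c a).continuous.mul hf.continuous).integrable_of_hasCompactSupport
        (hf.supp.mul_left (f := fun x => c a x))
    have h2 := hf.integrable_lineDeriv_mul (μ := μ) (e a) (k := fun _ => 1) continuous_const
    simp only [mul_one] at h2
    exact h1.sub h2
  obtain ⟨CG, hCG⟩ := hG.lip
  obtain ⟨Cf, hCf⟩ := hf.lip
  -- Since `δ_b g · w = -∂_b (g w)`, the left side of the claim is minus the limit of these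
  -- difference quotients of `G = g w`.
  have lim1 := hCG.integral_inv_smul_sub_mul_tendsto_integral_lineDeriv_mul hu (e b)
  have ig : Integrable (fun x => lineDeriv ℝ g x (e a) * w x) μ :=
    hg.integrable_lineDeriv_mul _ hcw
  have lim2 := hCf.integral_inv_smul_sub_mul_tendsto_integral_lineDeriv_mul ig (-(e b))
  have iG : Integrable G μ := hG.integrable
  have lim3 := hCf.integral_inv_smul_sub_mul_tendsto_integral_lineDeriv_mul iG (-(e b))
  have lim3' : Tendsto (fun t : ℝ => ∫ x, f (x + t • (-(e b))) * G x ∂μ) (𝓝[>] 0)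
      (𝓝 (∫ x, f x * G x ∂μ)) := by
    have ht : Tendsto (fun t : ℝ => t) (𝓝[>] 0) (𝓝 0) := tendsto_nhdsWithin_of_tendsto_nhds tendsto_id
    have h := (ht.mul lim3).add_const (∫ x, f x * G x ∂μ)
    rw [zero_mul, zero_add] at h
    refine h.congr' ?_
    filter_upwards [self_mem_nhdsWithin] with t (ht0 : 0 < t)
    have i1 : Integrable (fun x => f (x + t • (-(e b))) * G x) μ :=
      ((hf.comp_add_right _).mul_right hG.locallyLipschitz).integrable
    have i2 : Integrable (fun x => f x * G x) μ := (hf.mul_right hG.locallyLipschitz).integrable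
    have : ∀ x, t⁻¹ • (f (x + t • (-(e b))) - f x) * G x
        = t⁻¹ * (f (x + t • (-(e b))) * G x - f x * G x) := fun x => by
      rw [smul_eq_mul]; ring
    simp_rw [this]
    rw [integral_const_mul, integral_sub i1 i2]
    field_simp
    ring
  have heq : ∀ t : ℝ, 0 < t → ∫ x, (t⁻¹ • (G (x + t • e b) - G x)) * adjDeriv e c a f x ∂μ
      = ∫ x, (t⁻¹ • (f (x + t • (-(e b))) - f x)) * (lineDeriv ℝ g x (e a) * w x) ∂μ
        - (if a = b then 1 else 0) * ∫ x, f (x + t • (-(e b))) * G x ∂μ := by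
    intro t ht
    set v := t • (-(e b)) with hv
    have hvv : t • e b = -v := by rw [hv, smul_neg, neg_neg]
    have hft : LipCompact fun x => f (x + v) := hf.comp_add_right v
    have hD : LipCompact fun x => t⁻¹ * (f (x + v) - f x) := (hft.sub hf).const_mul _
    have hm : AEStronglyMeasurable (adjDeriv e c a f) μ := hu.aestronglyMeasurable
    obtain ⟨BG, hBG⟩ := hG.supp.exists_bound_of_continuous hG.continuous
    have j1 : Integrable (fun x => G (x + t • e b) * adjDeriv e c a f x) μ :=
      hu.bdd_mul (c := BG) (hG.comp_add_right _).continuous.aestronglyMeasurable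
        (.of_forall fun x => hBG _)
    have j2 : Integrable (fun x => G x * adjDeriv e c a f x) μ :=
      hu.bdd_mul (c := BG) hG.continuous.aestronglyMeasurable (.of_forall fun x => hBG _)
    have j3 : Integrable (fun x => G x * adjDeriv e c a f (x + v)) μ :=
      (hu.comp_add_right v).bdd_mul (c := BG) hG.continuous.aestronglyMeasurable
        (.of_forall fun x => hBG _)
    have s1 : ∫ x, G (x + t • e b) * adjDeriv e c a f x ∂μ
        = ∫ x, G x * adjDeriv e c a f (x + v) ∂μ := by
      rw [← integral_add_right_eq_self (μ := μ)
        (fun x => G (x + t • e b) * adjDeriv e c a f x) v]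
      congr 1; ext x; rw [hvv]; simp
    have s2 : ∫ x, (t⁻¹ • (G (x + t • e b) - G x)) * adjDeriv e c a f x ∂μ
        = ∫ x, t⁻¹ * (adjDeriv e c a f (x + v) - adjDeriv e c a f x) * G x ∂μ := by
      have r1 : ∀ x, t⁻¹ • (G (x + t • e b) - G x) * adjDeriv e c a f x
        = t⁻¹ * (G (x + t • e b) * adjDeriv e c a f x - G x * adjDeriv e c a f x) := fun x => by
        rw [smul_eq_mul]; ring
      have r2 : ∀ x, t⁻¹ * (adjDeriv e c a f (x + v) - adjDeriv e c a f x) * G x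
        = t⁻¹ * (G x * adjDeriv e c a f (x + v) - G x * adjDeriv e c a f x) := fun x => by ring
      simp_rw [r1, r2]
      rw [integral_const_mul, integral_const_mul, integral_sub j1 j2, integral_sub j3 j2, s1]
    -- Discrete commutator: translating `δ_a f` by `v = -t e_b` differs from `δ_a` of the translate
    -- only by `c_a(v) f(x + v)`, and duality makes `c_a(v) / t` equal to `-1` or `0`.
    have s3 : ∀ᵐ x ∂μ, t⁻¹ * (adjDeriv e c a f (x + v) - adjDeriv e c a f x) * G x
        = adjDeriv e c a (fun x => t⁻¹ * (f (x + v) - f x)) x * g x * w x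
          - (if a = b then 1 else 0) * (f (x + v) * G x) := by
      filter_upwards [hf.ae_lineDifferentiableAt (μ := μ) (e a),
        hft.ae_lineDifferentiableAt (μ := μ) (e a)] with x hx hx'
      have l1 : lineDeriv ℝ (fun x => t⁻¹ * (f (x + v) - f x)) x (e a)
          = t⁻¹ * (lineDeriv ℝ (fun x => f (x + v)) x (e a) - lineDeriv ℝ f x (e a)) := by
        have := (hx'.hasLineDerivAt.sub hx.hasLineDerivAt)
        have h2 : HasLineDerivAt ℝ (fun x => t⁻¹ * (f (x + v) - f x))
          (t⁻¹ * (lineDeriv ℝ (fun x => f (x + v)) x (e a) - lineDeriv ℝ f x (e a))) x (e a) :=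
          HasDerivAt.const_mul t⁻¹ this
        exact h2.lineDeriv
      have l2 : lineDeriv ℝ (fun x => f (x + v)) x (e a) = lineDeriv ℝ f (x + v) (e a) := by
        simp only [lineDeriv]
        congr 1; ext s; congr 1; abel
      have l3 : c a v = -(t * if a = b then 1 else 0) := by
        rw [hv, map_smul, map_neg, hw.dual, smul_eq_mul]; ring
      unfold adjDeriv
      rw [l1, l2, map_add, l3, hGdef]
      split_ifs <;> field_simp <;> ring
    rw [s2, integral_congr_ae s3, integral_sub, integral_const_mul, integral_adjDeriv_mul hw hD hg]
    · congr 1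
      congr 1; ext x; rw [smul_eq_mul]; ring
    · have k1 : Integrable (fun x => t⁻¹ * (f (x + v) - f x) * (c a x * (g x * w x))) μ := by
        refine Continuous.integrable_of_hasCompactSupport ?_ hD.supp.mul_right
        exact hD.continuous.mul ((c a).continuous.mul (hg.continuous.mul hcw))
      have k2 := hD.integrable_lineDeriv_mul (μ := μ) (e a) (hg.continuous.mul hcw)
      refine (k1.sub k2).congr (.of_forall fun x => ?_)
      simp only [Pi.sub_apply, Pi.mul_apply]; unfold adjDeriv; ring
    · exact ((hft.mul_right hG.locallyLipschitz).integrable).const_mul _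
  have lim4 : Tendsto (fun t : ℝ => ∫ x, (t⁻¹ • (G (x + t • e b) - G x)) * adjDeriv e c a f x ∂μ)
      (𝓝[>] 0) (𝓝 (∫ x, lineDeriv ℝ f x (-(e b)) * (lineDeriv ℝ g x (e a) * w x) ∂μ
        - (if a = b then 1 else 0) * ∫ x, f x * G x ∂μ)) := by
    refine (lim2.sub (lim3'.const_mul _)).congr' ?_
    filter_upwards [self_mem_nhdsWithin] with t ht
    exact (heq t ht).symm
  have huniq := tendsto_nhds_unique lim1 lim4
  have e1 : ∀ᵐ x ∂μ, adjDeriv e c a f x * adjDeriv e c b g x * w x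
      = -(lineDeriv ℝ G x (e b) * adjDeriv e c a f x) := by
    filter_upwards [hg.ae_lineDifferentiableAt (μ := μ) (e b)] with x hx
    have h := HasLineDerivAt.real_mul hx.hasLineDerivAt (hw.hasLineDerivAt b x)
    rw [hGdef, h.lineDeriv]; simp only [adjDeriv]; ring
  rw [integral_congr_ae e1, integral_neg, huniq]
  have e2 : ∫ x, lineDeriv ℝ f x (-(e b)) * (lineDeriv ℝ g x (e a) * w x) ∂μ
      = -∫ x, lineDeriv ℝ f x (e b) * lineDeriv ℝ g x (e a) * w x ∂μ := by
    rw [← integral_neg]; congr 1; ext x; rw [lineDeriv_neg]; ring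
  rw [e2]
  have e3 : ∫ x, f x * G x ∂μ = ∫ x, f x * g x * w x ∂μ := by
    congr 1; ext x; rw [hGdef]; ring
  rw [e3]
  split_ifs <;> ring

theorem integrable_adjDeriv_mul_adjDeriv (hw : IsGaussWeight e c w) (hf : LipCompact f)
    (hg : LipCompact g) (a b : α) :
    Integrable (fun x => adjDeriv e c a f x * adjDeriv e c b g x * w x) μ := by
  have hcw := hw.contDiff.continuous
  have i1 : Integrable (fun x => f x * (c a x * (c b x * (g x * w x)))) μ :=
    (hf.continuous.mul ((c a).continuous.mul ((c b).continuous.mul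
      (hg.continuous.mul hcw)))).integrable_of_hasCompactSupport hf.supp.mul_right
  have i2 := hf.integrable_lineDeriv_mul (μ := μ) (e a)
    ((c b).continuous.mul (hg.continuous.mul hcw))
  have i3 := hg.integrable_lineDeriv_mul (μ := μ) (e b)
    ((c a).continuous.mul (hf.continuous.mul hcw))
  have i4 := hf.integrable_lineDeriv_mul_lineDeriv_mul (μ := μ) hg (e a) (e b) hcw
  refine (((i1.sub i2).sub i3).add i4).congr (.of_forall fun x => ?_)
  simp only [Pi.sub_apply, Pi.add_apply, Pi.mul_apply, adjDeriv]; ring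

variable [Fintype α]

/-- Second order Stein inequality for compactly supported Lipschitz vector fields. -/
theorem integral_sum_adjDeriv_sq_le (hw : IsGaussWeight e c w) (hw0 : ∀ x, 0 ≤ w x)
    {F : α → E → ℝ} (hF : ∀ a, LipCompact (F a)) :
    ∫ x, (∑ a, adjDeriv e c a (F a) x) ^ 2 * w x ∂μ
      ≤ ∫ x, (∑ a, F a x ^ 2 + ∑ a, ∑ b, lineDeriv ℝ (F a) x (e b) ^ 2) * w x ∂μ := by
  have hcw := hw.contDiff.continuous
  have e1 : ∀ x, (∑ a, adjDeriv e c a (F a) x) ^ 2 * w x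
      = ∑ a, ∑ b, adjDeriv e c a (F a) x * adjDeriv e c b (F b) x * w x := fun x => by
    rw [sq, Finset.sum_mul_sum, Finset.sum_mul]
    simp_rw [Finset.sum_mul]
  have iA : ∀ a b, Integrable (fun x => adjDeriv e c a (F a) x * adjDeriv e c b (F b) x * w x) μ :=
    fun a b => integrable_adjDeriv_mul_adjDeriv hw (hF a) (hF b) a b
  have iB : ∀ a b, Integrable
      (fun x => lineDeriv ℝ (F a) x (e b) * lineDeriv ℝ (F b) x (e a) * w x) μ :=
    fun a b => (hF a).integrable_lineDeriv_mul_lineDeriv_mul (hF b) _ _ hcw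
  have iC : ∀ a b, Integrable (fun x => lineDeriv ℝ (F a) x (e b) ^ 2 * w x) μ := fun a b => by
    simp_rw [sq]
    exact (hF a).integrable_lineDeriv_mul_lineDeriv_mul (hF a) _ _ hcw
  have iD : ∀ a, Integrable (fun x => F a x ^ 2 * w x) μ := fun a => by
    simp_rw [sq, mul_assoc]
    exact ((hF a).continuous.mul ((hF a).continuous.mul hcw)).integrable_of_hasCompactSupport
      (hF a).supp.mul_right
  have iC' : ∀ a b, Integrable (fun x => lineDeriv ℝ (F b) x (e a) ^ 2 * w x) μ :=
    fun a b => iC b a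
  calc ∫ x, (∑ a, adjDeriv e c a (F a) x) ^ 2 * w x ∂μ
      = ∑ a, ∑ b, ∫ x, adjDeriv e c a (F a) x * adjDeriv e c b (F b) x * w x ∂μ := by
        simp_rw [e1]
        rw [integral_finsetSum _ fun a _ => integrable_finsetSum _ fun b _ => iA a b]
        exact Finset.sum_congr rfl fun a _ => integral_finsetSum _ fun b _ => iA a b
    _ = ∑ a, ∑ b, (∫ x, lineDeriv ℝ (F a) x (e b) * lineDeriv ℝ (F b) x (e a) * w x ∂μ
          + if a = b then ∫ x, F a x * F b x * w x ∂μ else 0) := by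
        refine Finset.sum_congr rfl fun a _ => Finset.sum_congr rfl fun b _ => ?_
        exact integral_adjDeriv_mul_adjDeriv hw (hF a) (hF b) a b
    _ = ∑ a, ∑ b, ∫ x, lineDeriv ℝ (F a) x (e b) * lineDeriv ℝ (F b) x (e a) * w x ∂μ
          + ∑ a, ∫ x, F a x ^ 2 * w x ∂μ := by
        simp_rw [Finset.sum_add_distrib, Finset.sum_ite_eq, Finset.mem_univ, if_true, sq]
    -- `2 x y ≤ x² + y²` replaces the trace of the squared Jacobian by its Frobenius norm; the two
    -- halves agree after exchanging `a` and `b`.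
    _ ≤ ∑ a, ∑ b, (2⁻¹ * ∫ x, lineDeriv ℝ (F a) x (e b) ^ 2 * w x ∂μ
          + 2⁻¹ * ∫ x, lineDeriv ℝ (F b) x (e a) ^ 2 * w x ∂μ)
          + ∑ a, ∫ x, F a x ^ 2 * w x ∂μ := by
        gcongr with a _ b _
        rw [← integral_const_mul, ← integral_const_mul,
          ← integral_add ((iC a b).const_mul _) ((iC' a b).const_mul _)]
        refine integral_mono (iB a b) (((iC a b).const_mul _).add ((iC' a b).const_mul _))
          fun x => ?_
        have := hw0 x
        nlinarith [mul_nonneg (sq_nonneg (lineDeriv ℝ (F a) x (e b) - lineDeriv ℝ (F b) x (e a)))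
          this]
    _ = ∑ a, ∑ b, ∫ x, lineDeriv ℝ (F a) x (e b) ^ 2 * w x ∂μ
          + ∑ a, ∫ x, F a x ^ 2 * w x ∂μ := by
        congr 1
        simp_rw [Finset.sum_add_distrib, ← Finset.mul_sum]
        rw [Finset.sum_comm (f := fun a b => ∫ x, lineDeriv ℝ (F b) x (e a) ^ 2 * w x ∂μ)]
        ring
    _ = _ := by
        have : ∀ x, (∑ a, F a x ^ 2 + ∑ a, ∑ b, lineDeriv ℝ (F a) x (e b) ^ 2) * w x
            = ∑ a, F a x ^ 2 * w x + ∑ a, ∑ b, lineDeriv ℝ (F a) x (e b) ^ 2 * w x := fun x => by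
          rw [add_mul, Finset.sum_mul, Finset.sum_mul]
          simp_rw [Finset.sum_mul]
        simp_rw [this]
        rw [integral_add (integrable_finsetSum _ fun a _ => iD a)
          (integrable_finsetSum _ fun a _ => integrable_finsetSum _ fun b _ => iC a b),
          integral_finsetSum _ fun a _ => iD a,
          integral_finsetSum _ fun a _ => integrable_finsetSum _ fun b _ => iC a b, add_comm]
        congr 1
        exact Finset.sum_congr rfl fun a _ => (integral_finsetSum _ fun b _ => iC a b).symm

end

end Stein

/-! ### Gaussian designs: densities, coordinates and the Stein inequality in probabilistic form. -/

section Measures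

open scoped ENNReal

theorem pi_withDensity_ofReal {ι : Type*} [Fintype ι] {X : ι → Type*}
    [∀ i, MeasurableSpace (X i)] (μ : ∀ i, Measure (X i)) [∀ i, SigmaFinite (μ i)]
    {f : ∀ i, X i → ℝ} (h0 : ∀ i x, 0 ≤ f i x)
    (hi : ∀ i, Integrable (f i) (μ i)) :
    Measure.pi (fun i => (μ i).withDensity fun x => ENNReal.ofReal (f i x))
      = (Measure.pi μ).withDensity fun x => ENNReal.ofReal (∏ i, f i (x i)) := by
  have : ∀ i, IsFiniteMeasure ((μ i).withDensity fun x => ENNReal.ofReal (f i x)) := fun i =>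
    isFiniteMeasure_withDensity_ofReal (hi i).2
  refine Measure.pi_eq fun s hs => ?_
  rw [withDensity_apply _ (MeasurableSet.univ_pi hs), Measure.restrict_pi_pi]
  have hi' : ∀ i, Integrable (f i) ((μ i).restrict (s i)) := fun i => (hi i).restrict
  rw [← ofReal_integral_eq_lintegral_ofReal (Integrable.fintype_prod_dep hi')
    (.of_forall fun x => Finset.prod_nonneg fun i _ => h0 i _),
    integral_fintype_prod_eq_prod (f := f),
    ENNReal.ofReal_prod_of_nonneg fun i _ => integral_nonneg (h0 i)]
  refine Finset.prod_congr rfl fun i _ => ?_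
  rw [withDensity_apply _ (hs i), ofReal_integral_eq_lintegral_ofReal (hi' i)
    (.of_forall (h0 i))]

theorem pi_absolutelyContinuous {n : ℕ} {X : Type*} [MeasurableSpace X] {μ ν : Fin n → Measure X}
    [∀ i, SigmaFinite (μ i)] [∀ i, SigmaFinite (ν i)] (h : ∀ i, μ i ≪ ν i) :
    Measure.pi μ ≪ Measure.pi ν := by
  induction n with
  | zero => rw [Measure.pi_of_empty μ, Measure.pi_of_empty ν]
  | succ n ih =>
    have h1 := (measurePreserving_piFinSuccAbove μ 0).symm
    have h2 := (measurePreserving_piFinSuccAbove ν 0).symm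
    rw [← h1.map_eq, ← h2.map_eq]
    exact ((h 0).prod (ih fun j => h _)).map (MeasurableEquiv.measurable _)

/-- The law of a design with independent standard Gaussian entries. -/
def designGaussian (n p : ℕ) : Measure (Design n p) := Measure.pi fun _ => stdGaussian (Vec p)

instance (n p : ℕ) : IsProbabilityMeasure (designGaussian n p) := by
  unfold designGaussian; infer_instance

/-- The unnormalized standard Gaussian density on designs. -/
def gaussWeight (n p : ℕ) (Z : Design n p) : ℝ := Real.exp (-(∑ i, ‖Z i‖ ^ 2) / 2)

/-- The normalizing constant may stay unspecified: it multiplies both sides of the Stein inequality.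
-/
theorem stdGaussian_eq_withDensity (κ : Type*) [Fintype κ] : ∃ K : ℝ, 0 < K ∧
    stdGaussian (EuclideanSpace ℝ κ)
      = (volume : Measure (EuclideanSpace ℝ κ)).withDensity
        (fun x => ENNReal.ofReal (K * Real.exp (-‖x‖ ^ 2 / 2)))
      ∧ Integrable (fun x : EuclideanSpace ℝ κ => K * Real.exp (-‖x‖ ^ 2 / 2)) := by
  have h1 : Measure.pi (fun _ : κ => gaussianReal 0 1)
      = (volume : Measure (κ → ℝ)).withDensity fun x =>
        ENNReal.ofReal (∏ i, gaussianPDFReal 0 1 (x i)) := by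
    rw [volume_pi, ← pi_withDensity_ofReal (fun _ => volume)
      (fun _ => gaussianPDFReal_nonneg 0 1)
      (fun _ => integrable_gaussianPDFReal 0 1)]
    congr 1; ext1 i
    rw [gaussianReal_of_var_ne_zero 0 one_ne_zero]; rfl
  have h2 : ∀ x : κ → ℝ, ∏ i, gaussianPDFReal 0 1 (x i)
      = (√(2 * Real.pi))⁻¹ ^ Fintype.card κ * Real.exp (-‖(WithLp.toLp 2 x : EuclideanSpace ℝ κ)‖ ^ 2 / 2) := fun x => by
    simp only [gaussianPDFReal, NNReal.coe_one, mul_one, sub_zero]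
    rw [Finset.prod_mul_distrib, Finset.prod_const, ← Real.exp_sum, Finset.card_univ,
      EuclideanSpace.real_norm_sq_eq]
    congr 2
    simp [Finset.sum_div, neg_div]
  have hmap : ∀ f : EuclideanSpace ℝ κ → ℝ≥0∞, Measurable f →
      (((volume : Measure (κ → ℝ)).withDensity fun x => f (WithLp.toLp 2 x)).map
        (WithLp.toLp 2)) = (volume : Measure (EuclideanSpace ℝ κ)).withDensity f := fun f hf => by
    ext s hs
    have hs' : MeasurableSet ((WithLp.toLp 2 : (κ → ℝ) → EuclideanSpace ℝ κ) ⁻¹' s) :=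
      (WithLp.measurable_toLp 2 _) hs
    rw [Measure.map_apply (WithLp.measurable_toLp 2 _) hs, withDensity_apply _ hs',
      withDensity_apply _ hs]
    exact (PiLp.volume_preserving_toLp (κ)).setLIntegral_comp_preimage hs hf
  refine ⟨(√(2 * Real.pi))⁻¹ ^ Fintype.card κ, by positivity, ?_, ?_⟩
  · rw [← map_pi_eq_stdGaussian, h1]
    simp_rw [h2]
    exact hmap (fun x => ENNReal.ofReal ((√(2 * Real.pi))⁻¹ ^ Fintype.card κ * Real.exp (-‖x‖ ^ 2 / 2)))
      (by fun_prop)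
  · have : Integrable (fun x : κ → ℝ => ∏ i, gaussianPDFReal 0 1 (x i)) :=
      Integrable.fintype_prod fun _ => integrable_gaussianPDFReal 0 1
    simp_rw [h2] at this
    exact ((PiLp.volume_preserving_toLp (κ)).integrable_comp
      (Continuous.aestronglyMeasurable (by fun_prop))).1 this

theorem designGaussian_eq_withDensity (n p : ℕ) : ∃ K : ℝ, 0 < K ∧
    designGaussian n p = (volume : Measure (Design n p)).withDensity
        (fun Z => ENNReal.ofReal (K * gaussWeight n p Z))
      ∧ Integrable (gaussWeight n p) := by
  obtain ⟨K, hK, h1, h2⟩ := stdGaussian_eq_withDensity (Fin p)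
  have h3 : ∀ Z : Design n p, ∏ i, (K * Real.exp (-‖Z i‖ ^ 2 / 2))
      = K ^ n * gaussWeight n p Z := fun Z => by
    rw [Finset.prod_mul_distrib, Finset.prod_const, ← Real.exp_sum, Finset.card_fin, gaussWeight]
    congr 2
    simp [Finset.sum_div, neg_div]
  refine ⟨K ^ n, by positivity, ?_, ?_⟩
  · unfold designGaussian
    rw [h1, pi_withDensity_ofReal (f := fun _ x => K * Real.exp (-‖x‖ ^ 2 / 2)) _
      (fun _ _ => by positivity) (fun _ => h2)]
    simp_rw [h3]; rfl
  · have : Integrable (fun Z : Design n p => ∏ i, (K * Real.exp (-‖Z i‖ ^ 2 / 2))) :=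
      Integrable.fintype_prod fun _ => h2
    simp_rw [h3] at this
    exact (integrable_const_mul_iff (c := K ^ n) (by simp [hK.ne']) _).1 this

theorem designGaussian_absolutelyContinuous (n p : ℕ) :
    designGaussian n p ≪ (volume : Measure (Design n p)) := by
  obtain ⟨K, -, h, -⟩ := designGaussian_eq_withDensity n p
  rw [h]; exact withDensity_absolutelyContinuous _ _

/-- The coordinate vectors of the space of designs. -/
def designBasis {n p : ℕ} (a : Fin n × Fin p) : Design n p :=
  Pi.single a.1 (EuclideanSpace.single a.2 1)

/-- The coordinate functionals of the space of designs. -/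
def designCoord {n p : ℕ} (a : Fin n × Fin p) : Design n p →L[ℝ] ℝ :=
  (EuclideanSpace.proj a.2).comp (ContinuousLinearMap.proj a.1)

@[simp]
theorem designCoord_apply {n p : ℕ} (a : Fin n × Fin p) (Z : Design n p) :
    designCoord a Z = Z a.1 a.2 := rfl

theorem gaussWeight_eq {n p : ℕ} :
    gaussWeight n p = fun Z => Real.exp (-(∑ a, designCoord a Z ^ 2) / 2) := by
  ext Z
  unfold gaussWeight
  congr 3
  rw [Fintype.sum_prod_type]
  exact Finset.sum_congr rfl fun i _ => by simp [EuclideanSpace.real_norm_sq_eq]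

theorem isGaussWeight_design (n p : ℕ) :
    IsGaussWeight (designBasis (n := n) (p := p)) designCoord (gaussWeight n p) := by
  have hd : ∀ a b : Fin n × Fin p, designCoord a (designBasis b) = if a = b then 1 else 0 := by
    rintro ⟨i, j⟩ ⟨k, l⟩
    simp only [designCoord_apply, designBasis, Prod.mk.injEq]
    by_cases h : i = k
    · subst h; simp
    · simp [h]
  refine ⟨hd, ?_, fun b Z => ?_⟩
  · rw [gaussWeight_eq]
    exact (((ContDiff.sum fun a _ => (designCoord a).contDiff.pow 2).neg).div_const 2).exp
  · rw [gaussWeight_eq]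
    have h1 : ∀ a : Fin n × Fin p, HasDerivAt
        (fun t : ℝ => designCoord a (Z + t • designBasis b) ^ 2)
        (2 * designCoord a Z * designCoord a (designBasis b)) 0 := fun a => by
      have h : HasDerivAt (fun t : ℝ => designCoord a Z + t * designCoord a (designBasis b))
        (designCoord a (designBasis b)) 0 := by
          simpa using ((hasDerivAt_id (0 : ℝ)).mul_const (designCoord a (designBasis b))).const_add
            (designCoord a Z)
      have h' := h.pow 2
      simp only [zero_mul, add_zero] at h'
      refine (h'.congr_deriv (by push_cast; ring)).congr_of_eventuallyEq (.of_forall fun t => ?_)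
      simp only [map_add, map_smul, smul_eq_mul, Pi.pow_apply]
    have h2 := ((HasDerivAt.fun_sum fun a (_ : a ∈ Finset.univ) => h1 a).neg.div_const 2).exp
    unfold HasLineDerivAt
    refine h2.congr_deriv ?_
    simp only [hd, zero_smul, add_zero, Pi.neg_apply]
    simp
    ring

/-- Passing to a subfamily of coordinates allows the Stein inequality to be applied to a single row
of the design as well as to the whole design. -/
theorem IsGaussWeight.comp_injective {E α α' : Type*} [NormedAddCommGroup E] [NormedSpace ℝ E]
    [DecidableEq α] [DecidableEq α'] {e : α → E} {c : α → E →L[ℝ] ℝ} {w : E → ℝ}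
    (h : IsGaussWeight e c w) {φ : α' → α} (hφ : Function.Injective φ) :
    IsGaussWeight (fun a => e (φ a)) (fun a => c (φ a)) w :=
  ⟨fun a b => by simp [h.dual, hφ.eq_iff], h.contDiff, fun b x => h.hasLineDerivAt (φ b) x⟩

/-- Second order Stein inequality for the standard Gaussian design. -/
theorem lintegral_sum_adjDeriv_sq_le {n p : ℕ} {α : Type*} [Fintype α] [DecidableEq α]
    {φ : α → Fin n × Fin p} (hφ : Function.Injective φ) {F : α → Design n p → ℝ}
    (hF : ∀ a, LipCompact (F a)) :
    ∫⁻ Z, ENNReal.ofReal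
        ((∑ a, adjDeriv (fun a => designBasis (φ a)) (fun a => designCoord (φ a)) a (F a) Z) ^ 2)
        ∂(designGaussian n p)
      ≤ ∫⁻ Z, ENNReal.ofReal
        (∑ a, F a Z ^ 2 + ∑ a, ∑ b, lineDeriv ℝ (F a) Z (designBasis (φ b)) ^ 2)
        ∂(designGaussian n p) := by
  obtain ⟨K, hK, h, hi⟩ := designGaussian_eq_withDensity n p
  have hw := (isGaussWeight_design n p).comp_injective hφ
  have hw0 : ∀ Z, 0 ≤ gaussWeight n p Z := fun Z => (Real.exp_pos _).le
  have hcw := hw.contDiff.continuous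
  have h1 := integral_sum_adjDeriv_sq_le (μ := (volume : Measure (Design n p))) hw hw0 hF
  set Q : Design n p → ℝ := fun Z =>
    (∑ a, adjDeriv (fun a => designBasis (φ a)) (fun a => designCoord (φ a)) a (F a) Z) ^ 2
  set R : Design n p → ℝ := fun Z =>
    ∑ a, F a Z ^ 2 + ∑ a, ∑ b, lineDeriv ℝ (F a) Z (designBasis (φ b)) ^ 2
  have hQ0 : ∀ Z, 0 ≤ Q Z := fun Z => sq_nonneg _
  have hR0 : ∀ Z, 0 ≤ R Z := fun Z => add_nonneg (Finset.sum_nonneg fun _ _ => sq_nonneg _)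
    (Finset.sum_nonneg fun _ _ => Finset.sum_nonneg fun _ _ => sq_nonneg _)
  have hintQ : Integrable (fun Z => Q Z * gaussWeight n p Z) := by
    have e1 : ∀ Z, Q Z * gaussWeight n p Z
      = ∑ a, ∑ b, adjDeriv (fun a => designBasis (φ a)) (fun a => designCoord (φ a)) a (F a) Z
          * adjDeriv (fun a => designBasis (φ a)) (fun a => designCoord (φ a)) b (F b) Z
          * gaussWeight n p Z := fun x => by
      simp only [Q]
      rw [sq, Finset.sum_mul_sum, Finset.sum_mul]
      simp_rw [Finset.sum_mul]
    simp_rw [e1]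
    exact integrable_finsetSum _ fun a _ => integrable_finsetSum _ fun b _ =>
      integrable_adjDeriv_mul_adjDeriv hw (hF a) (hF b) a b
  have hintR : Integrable (fun Z => R Z * gaussWeight n p Z) := by
    simp only [R, add_mul, Finset.sum_mul]
    refine (integrable_finsetSum _ fun a _ => ?_).add (integrable_finsetSum _ fun a _ =>
      integrable_finsetSum _ fun b _ => ?_)
    · simp_rw [sq, mul_assoc]
      exact ((hF a).continuous.mul ((hF a).continuous.mul hcw)).integrable_of_hasCompactSupport
        (hF a).supp.mul_right
    · simp_rw [sq]
      exact (hF a).integrable_lineDeriv_mul_lineDeriv_mul (hF a) _ _ hcw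
  have hmeas : Measurable fun Z : Design n p => ENNReal.ofReal (K * gaussWeight n p Z) :=
    (measurable_const.mul hcw.measurable).ennreal_ofReal
  have hmQ : Measurable fun Z : Design n p => ENNReal.ofReal (Q Z) := by
    refine ((Finset.measurable_sum _ fun a _ => ?_).pow_const 2).ennreal_ofReal
    exact ((designCoord (φ a)).continuous.measurable.mul (hF a).continuous.measurable).sub
      (measurable_lineDeriv (hF a).continuous)
  have hmR : Measurable fun Z : Design n p => ENNReal.ofReal (R Z) := by
    refine ((Finset.measurable_sum _ fun a _ => ?_).add (Finset.measurable_sum _ fun a _ =>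
      Finset.measurable_sum _ fun b _ => ?_)).ennreal_ofReal
    · exact (hF a).continuous.measurable.pow_const 2
    · exact (measurable_lineDeriv (hF a).continuous).pow_const 2
  have key : ∀ f : Design n p → ℝ, (∀ Z, 0 ≤ f Z) → Measurable (fun Z => ENNReal.ofReal (f Z)) →
      Integrable (fun Z => f Z * gaussWeight n p Z) →
      ∫⁻ Z, ENNReal.ofReal (f Z) ∂(designGaussian n p)
        = ENNReal.ofReal (K * ∫ Z, f Z * gaussWeight n p Z) := by
    intro f hf hmf hif
    rw [h, lintegral_withDensity_eq_lintegral_mul _ hmeas hmf, ← integral_const_mul,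
      ofReal_integral_eq_lintegral_ofReal (hif.const_mul K)
        (.of_forall fun Z => mul_nonneg hK.le (mul_nonneg (hf Z) (hw0 Z)))]
    refine lintegral_congr fun Z => ?_
    rw [Pi.mul_apply, ← ENNReal.ofReal_mul (mul_nonneg hK.le (hw0 Z))]
    congr 1; ring
  rw [key Q hQ0 hmQ hintQ, key R hR0 hmR hintR]
  exact ENNReal.ofReal_le_ofReal (mul_le_mul_of_nonneg_left h1 hK.le)

end Measures

/-! ### The square root of the covariance and its inverse as linear maps. -/

section Sqrt

variable {p : ℕ} {S : Matrix (Fin p) (Fin p) ℝ}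

/-- The linear map `b ↦ S ^ (1/2) b`. -/
abbrev sqrtLin (S : Matrix (Fin p) (Fin p) ℝ) : Vec p →ₗ[ℝ] Vec p :=
  Matrix.toEuclideanLin (sqrtMat S)

theorem sqrtMat_mul_self (hS : S.PosDef) : sqrtMat S * sqrtMat S = S :=
  CFC.sqrt_mul_sqrt_self _ hS.posSemidef.nonneg

theorem isUnit_det_sqrtMat (hS : S.PosDef) : IsUnit (sqrtMat S).det := by
  have h : (sqrtMat S).det * (sqrtMat S).det = S.det := by
    rw [← Matrix.det_mul, sqrtMat_mul_self hS]
  exact isUnit_iff_ne_zero.2 fun h0 => hS.det_pos.ne' (by rw [← h, h0, mul_zero])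

theorem inner_sqrtLin (a b : Vec p) :
    inner ℝ (sqrtLin S a) b = inner ℝ a (sqrtLin S b) := by
  have h : (sqrtMat S).IsHermitian := (CFC.sqrt_nonneg S).isSelfAdjoint
  exact Matrix.isSymmetric_toEuclideanLin_iff.2 h a b

theorem sqrtLin_sqrtLin (hS : S.PosDef) (b : Vec p) :
    sqrtLin S (sqrtLin S b) = Matrix.toEuclideanLin S b := by
  conv_rhs => rw [← sqrtMat_mul_self hS, Matrix.toLpLin_mul_same]
  rfl

theorem inner_toEuclideanLin_self (hS : S.PosDef) (b : Vec p) :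
    inner ℝ b (Matrix.toEuclideanLin S b) = ‖sqrtLin S b‖ ^ 2 := by
  rw [← sqrtLin_sqrtLin hS, ← inner_sqrtLin, real_inner_self_eq_norm_sq]

/-- The linear map `b ↦ S ^ (-1/2) b`. -/
abbrev sqrtInvLin (S : Matrix (Fin p) (Fin p) ℝ) : Vec p →ₗ[ℝ] Vec p :=
  Matrix.toEuclideanLin (sqrtMat S)⁻¹

theorem sqrtLin_sqrtInvLin (hS : S.PosDef) (b : Vec p) : sqrtLin S (sqrtInvLin S b) = b := by
  have h := Matrix.toLpLin_mul_same 2 (sqrtMat S) (sqrtMat S)⁻¹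
  rw [Matrix.mul_nonsing_inv _ (isUnit_det_sqrtMat hS), Matrix.toLpLin_one] at h
  exact (LinearMap.congr_fun h b).symm

theorem sqrtInvLin_sqrtLin (hS : S.PosDef) (b : Vec p) : sqrtInvLin S (sqrtLin S b) = b := by
  have h := Matrix.toLpLin_mul_same 2 (sqrtMat S)⁻¹ (sqrtMat S)
  rw [Matrix.nonsing_inv_mul _ (isUnit_det_sqrtMat hS), Matrix.toLpLin_one] at h
  exact (LinearMap.congr_fun h b).symm

theorem exists_mul_norm_le_sqrtLin (hS : S.PosDef) :
    ∃ κ : ℝ, 0 < κ ∧ ∀ b : Vec p, κ * ‖b‖ ≤ ‖sqrtLin S b‖ := by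
  set L := LinearMap.toContinuousLinearMap (sqrtInvLin S)
  refine ⟨(‖L‖ + 1)⁻¹, by positivity, fun b => ?_⟩
  have h : ‖b‖ ≤ ‖L‖ * ‖sqrtLin S b‖ := by
    calc ‖b‖ = ‖L (sqrtLin S b)‖ := by
          congr 1; exact (sqrtInvLin_sqrtLin hS b).symm
      _ ≤ _ := L.le_opNorm _
  rw [inv_mul_le_iff₀ (by positivity)]
  nlinarith [norm_nonneg (sqrtLin S b)]

end Sqrt

/-- The standing assumptions on a loss-penalty pair. -/
structure IsLossPenalty {p : ℕ} (n : ℕ) (μ M : ℝ) (S : Matrix (Fin p) (Fin p) ℝ) (ρ : ℝ → ℝ)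
    (g : Vec p → ℝ) : Prop where
  n_pos : 0 < n
  μ_pos : 0 < μ
  posDef : S.PosDef
  loss : IsLoss ρ
  penalty : IsStronglyConvexWrt μ S g
  penalty_min : ∀ b, g 0 ≤ g b
  psi_bound : ∀ u, |deriv ρ u| ≤ M

theorem IsLoss.hasDerivAt {ρ : ℝ → ℝ} (h : IsLoss ρ) (x : ℝ) : HasDerivAt ρ (deriv ρ x) x :=
  (h.contDiff.differentiable one_ne_zero x).hasDerivAt

theorem IsLoss.monotone_deriv {ρ : ℝ → ℝ} (h : IsLoss ρ) : Monotone (deriv ρ) :=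
  monotoneOn_univ.1 (h.convex.monotoneOn_deriv fun x _ => (h.hasDerivAt x).differentiableAt)

/-- A monotone 1-Lipschitz function has increments of the same sign as, and no larger than, those of
its argument. -/
theorem IsLoss.cocoercive {ρ : ℝ → ℝ} (h : IsLoss ρ) (a b : ℝ) :
    (deriv ρ a - deriv ρ b) ^ 2 ≤ (deriv ρ a - deriv ρ b) * (a - b) := by
  have h1 := h.lipschitz_deriv.dist_le_mul a b
  rw [NNReal.coe_one, one_mul, Real.dist_eq, Real.dist_eq] at h1
  rcases le_total b a with hab | hab
  · have h2 := h.monotone_deriv hab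
    rw [abs_of_nonneg (by linarith), abs_of_nonneg (by linarith)] at h1
    nlinarith
  · have h2 := h.monotone_deriv hab
    rw [abs_of_nonpos (by linarith), abs_of_nonpos (by linarith)] at h1
    nlinarith

/-- A critical point of a convex function is a global minimizer, and the minimizer is unique. This
serves to show that the score vector `ψ(r)` vanishes only when all residuals do. -/
theorem IsLoss.deriv_eq_zero_iff {ρ : ℝ → ℝ} (h : IsLoss ρ) (x : ℝ) : deriv ρ x = 0 ↔ x = 0 := by
  have hmin : ∀ x, deriv ρ x = 0 → ∀ y, ρ x ≤ ρ y := fun x hx y => by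
    have hl : IsLocalMin ρ x → ∀ y, ρ x ≤ ρ y := fun hl =>
      fun y => IsMinOn.of_isLocalMin_of_convex_univ hl h.convex y
    rcases lt_trichotomy x y with hxy | hxy | hxy
    · have := h.convex.deriv_le_slope (Set.mem_univ x) (Set.mem_univ y) hxy
        (h.hasDerivAt x).differentiableAt
      rw [hx, slope_def_field] at this
      have h2 := (le_div_iff₀ (by linarith : 0 < y - x)).1 this
      linarith
    · rw [hxy]
    · have := h.convex.slope_le_deriv (Set.mem_univ y) (Set.mem_univ x) hxy
        (h.hasDerivAt x).differentiableAt
      rw [hx, slope_def_field] at this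
      have h2 := (div_le_iff₀ (by linarith : 0 < x - y)).1 this
      linarith
  constructor
  · intro hx
    by_contra h0
    exact absurd (hmin x hx 0) (not_le.2 (h.unique_min x h0))
  · rintro rfl
    have : IsLocalMin ρ 0 := .of_forall fun y => by
      by_cases hy : y = 0
      · rw [hy]
      · exact (h.unique_min y hy).le
    exact this.deriv_eq_zero

theorem IsLoss.rho_zero_le {ρ : ℝ → ℝ} (h : IsLoss ρ) (y : ℝ) : ρ 0 ≤ ρ y := by
  by_cases hy : y = 0
  · rw [hy]
  · exact (h.unique_min y hy).le

/-! ### The M-estimator: existence, optimality condition, contraction and local Lipschitz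
continuity. -/

section Estimator

variable {n p : ℕ} {μ M : ℝ} {S : Matrix (Fin p) (Fin p) ℝ} {ρ : ℝ → ℝ} {g : Vec p → ℝ}

theorem residual_apply (y : Vec n) (X : Design n p) (i : Fin n) :
    residual ρ g y X i = y i - inner ℝ (X i) (mEstimator ρ g y X) := rfl

/-- If the conclusion failed, then `D ≤ B² D ≤ s`, so the right side of the hypothesis would be at
most `(b + c) B² D s < a s²`. The point is to extract from a quadratic inequality a bound that is
linear in the perturbation size `D`. -/
theorem le_of_quadratic_le {a b c D B s : ℝ} (ha0 : 0 < a) (hb : 0 ≤ b) (hc : 0 ≤ c) (hD0 : 0 ≤ D)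
    (hB1 : 1 ≤ B) (hs0 : 0 ≤ s) (h1 : a * s ^ 2 ≤ b * D * s + c * (D * B) ^ 2) :
    s ≤ (b + c + a) / a * B ^ 2 * D := by
  by_contra hcon
  push Not at hcon
  have hk' : (b + c + a) * (B ^ 2 * D) < s * a := by
    calc _ = (b + c + a) / a * B ^ 2 * D * a := by field_simp
      _ < _ := mul_lt_mul_of_pos_right hcon ha0
  have hP : 0 ≤ B ^ 2 * D := by positivity
  have hs1 : B ^ 2 * D ≤ s := by
    have h6 : a * (B ^ 2 * D) ≤ s * a := by
      have : 0 ≤ (b + c) * (B ^ 2 * D) := by positivity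
      linarith
    exact le_of_mul_le_mul_left (by linarith) ha0
  have hsp : 0 < s := by
    refine hs0.lt_of_ne fun h0 => ?_
    rw [← h0, zero_mul] at hk'
    have : 0 ≤ (b + c + a) * (B ^ 2 * D) := by positivity
    linarith
  have hD : D ≤ B ^ 2 * D := le_mul_of_one_le_left hD0 (one_le_pow₀ hB1)
  have t1 : b * D * s ≤ b * (B ^ 2 * D) * s := by gcongr
  have t2 : c * (D * B) ^ 2 ≤ c * (B ^ 2 * D) * s := by
    calc c * (D * B) ^ 2 = c * (B ^ 2 * D) * D := by ring
      _ ≤ c * (B ^ 2 * D) * s := by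
        have : D ≤ s := hD.trans hs1
        gcongr
  have t3 : 0 ≤ a * (B ^ 2 * D) * s := by positivity
  have t4 := mul_lt_mul_of_pos_right hk' hsp
  linarith

namespace IsLossPenalty

theorem penalty_le (H : IsLossPenalty n μ M S ρ g) (a d : Vec p) {s : ℝ} (hs0 : 0 ≤ s)
    (hs1 : s ≤ 1) :
    g (a + s • d) ≤ (1 - s) * g a + s * g (a + d) - μ / 2 * (s * (1 - s)) * ‖sqrtLin S d‖ ^ 2 := by
  have h := H.penalty.2 (Set.mem_univ a) (Set.mem_univ (a + d)) (sub_nonneg.2 hs1) hs0 (by ring)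
  simp only [inner_toEuclideanLin_self H.posDef, smul_eq_mul] at h
  have e : (1 - s) • a + s • (a + d) = a + s • d := by
    rw [sub_smul, smul_add, one_smul]; abel
  rw [e, map_add, map_add, map_smul] at h
  have e1 : ‖sqrtLin S a + s • sqrtLin S d‖ ^ 2
      = ‖sqrtLin S a‖ ^ 2 + 2 * s * inner ℝ (sqrtLin S a) (sqrtLin S d)
        + s ^ 2 * ‖sqrtLin S d‖ ^ 2 := by
    rw [norm_add_sq_real, real_inner_smul_right, norm_smul, mul_pow, Real.norm_eq_abs, sq_abs]; ring
  have e2 : ‖sqrtLin S a + sqrtLin S d‖ ^ 2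
      = ‖sqrtLin S a‖ ^ 2 + 2 * inner ℝ (sqrtLin S a) (sqrtLin S d)
        + ‖sqrtLin S d‖ ^ 2 := norm_add_sq_real _ _
  rw [e1, e2] at h
  nlinarith

theorem continuous_penalty (H : IsLossPenalty n μ M S ρ g) : Continuous g := by
  have h1 := continuousOn_univ.1 (H.penalty.continuousOn isOpen_univ)
  have h2 : Continuous fun b : Vec p => μ / 2 * inner ℝ b (Matrix.toEuclideanLin S b) :=
    continuous_const.mul (continuous_id.inner (LinearMap.continuous_of_finiteDimensional _))
  exact (h1.add h2).congr fun b => by simp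

/-- Coercivity: strong convexity at the midpoint of `0` and `b`, with `g(b/2) ≥ g(0)`, gives `g(b) ≥
g(0) + (μ/4) ‖S^(1/2) b‖²`, while the loss is bounded below. Convexity in finite dimension gives
continuity. -/
theorem exists_minimizer (H : IsLossPenalty n μ M S ρ g) (y : Vec n) (X : Design n p) :
    ∃ b, ∀ b', objective ρ g y X b ≤ objective ρ g y X b' := by
  have hρ : Continuous ρ := H.loss.contDiff.continuous
  have hc : Continuous (objective ρ g y X) := by
    unfold objective
    have := H.continuous_penalty
    fun_prop
  refine hc.exists_forall_le_of_isBounded 0 ?_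
  obtain ⟨κ, hκ, hκb⟩ := exists_mul_norm_le_sqrtLin H.posDef
  have hμ := H.μ_pos
  have hn : (0 : ℝ) < n := Nat.cast_pos.2 H.n_pos
  set c := objective ρ g y X 0 - ρ 0 - g 0 with hc
  have key : ∀ b, objective ρ g y X b ≤ objective ρ g y X 0 → μ / 4 * (κ * ‖b‖) ^ 2 ≤ c := by
    intro b hb
    have h1 := H.penalty_le 0 b (s := 1 / 2) (by norm_num) (by norm_num)
    have h2 := H.penalty_min (0 + (1 / 2 : ℝ) • b)
    rw [zero_add] at h1
    have h3 : ρ 0 ≤ (n : ℝ)⁻¹ * ∑ i, ρ (y i - inner ℝ (X i) b) := by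
      rw [le_inv_mul_iff₀ hn]
      calc n * ρ 0 = ∑ _i : Fin n, ρ 0 := by simp
        _ ≤ _ := Finset.sum_le_sum fun i _ => H.loss.rho_zero_le _
    have h4 : (κ * ‖b‖) ^ 2 ≤ ‖sqrtLin S b‖ ^ 2 :=
      pow_le_pow_left₀ (by positivity) (hκb b) 2
    have h5 : objective ρ g y X b = (n : ℝ)⁻¹ * ∑ i, ρ (y i - inner ℝ (X i) b) + g b := rfl
    rw [zero_add] at h1 h2
    nlinarith
  refine (Metric.isBounded_closedBall (x := (0 : Vec p)) (r := √(c / (μ / 4)) / κ)).subset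
    fun b hb => ?_
  have h := key b hb
  rw [mem_closedBall_zero_iff, le_div_iff₀ hκ, mul_comm]
  refine Real.le_sqrt_of_sq_le ?_
  rw [le_div_iff₀ (by positivity)]
  linarith

theorem mEstimator_spec (H : IsLossPenalty n μ M S ρ g) (y : Vec n) (X : Design n p) (b : Vec p) :
    objective ρ g y X (mEstimator ρ g y X) ≤ objective ρ g y X b :=
  Classical.epsilon_spec (p := fun b => ∀ b', objective ρ g y X b ≤ objective ρ g y X b')
    (H.exists_minimizer y X) b

/-- The optimality condition without subdifferentials: `Xᵀ ψ(r) / n` is a subgradient of `g` at the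
estimator, with the quadratic gain from strong convexity. It follows by differentiating the
minimality along the segment towards the competitor. -/
theorem penalty_ge (H : IsLossPenalty n μ M S ρ g) (y : Vec n) (X : Design n p) (d : Vec p) :
    g (mEstimator ρ g y X)
      + (n : ℝ)⁻¹ * ∑ i, deriv ρ (residual ρ g y X i) * inner ℝ (X i) d
      + μ / 2 * ‖sqrtLin S d‖ ^ 2 ≤ g (mEstimator ρ g y X + d) := by
  set β := mEstimator ρ g y X with hβ
  set r := residual ρ g y X with hr
  have hder : ∀ i, HasDerivAt (fun s : ℝ => ρ (r i - s * inner ℝ (X i) d))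
      (-(deriv ρ (r i) * inner ℝ (X i) d)) 0 := fun i => by
    have h1 : HasDerivAt (fun s : ℝ => r i - s * inner ℝ (X i) d) (-inner ℝ (X i) d) 0 := by
      simpa using ((hasDerivAt_id (0 : ℝ)).mul_const (inner ℝ (X i) d)).const_sub (r i)
    have h2 : HasDerivAt ρ (deriv ρ (r i)) (r i - 0 * inner ℝ (X i) d) := by
      simpa using H.loss.hasDerivAt (r i)
    have h3 : HasDerivAt (fun s : ℝ => ρ (r i - s * inner ℝ (X i) d))
      (deriv ρ (r i) * -inner ℝ (X i) d) 0 := h2.comp (0 : ℝ) h1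
    exact h3.congr_deriv (by ring)
  have hsum := (HasDerivAt.fun_sum fun i (_ : i ∈ Finset.univ) => hder i).const_mul (n : ℝ)⁻¹
  have hlin : HasDerivAt (fun s : ℝ => s * (g (β + d) - g β)
      - μ / 2 * (s * (1 - s)) * ‖sqrtLin S d‖ ^ 2)
      (g (β + d) - g β - μ / 2 * ‖sqrtLin S d‖ ^ 2) 0 := by
    have h0 := hasDerivAt_id (0 : ℝ)
    have h1 := h0.mul_const (g (β + d) - g β)
    have h2 := ((h0.mul (h0.const_sub 1)).const_mul (μ / 2)).mul_const (‖sqrtLin S d‖ ^ 2)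
    refine (h1.sub h2).congr_deriv ?_
    simp
  have htot := hlin.add hsum
  -- The penalty is replaced by its chord bound, so that `Φ` is differentiable although `g` need not
  -- be; `Φ` still has its minimum over `[0, 1]` at `0`.
  set Φ : ℝ → ℝ := fun s => s * (g (β + d) - g β) - μ / 2 * (s * (1 - s)) * ‖sqrtLin S d‖ ^ 2
    + (n : ℝ)⁻¹ * ∑ i, ρ (r i - s * inner ℝ (X i) d) with hΦ
  have hge : ∀ s, 0 ≤ s → s ≤ 1 → Φ 0 ≤ Φ s := by
    intro s hs0 hs1
    have h1 := H.penalty_le β d hs0 hs1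
    have h2 := H.mEstimator_spec y X (β + s • d)
    rw [← hβ] at h2
    unfold objective at h2
    have h3 : ∀ i, y i - inner ℝ (X i) (β + s • d) = r i - s * inner ℝ (X i) d := fun i => by
      rw [hr, residual_apply, inner_add_right, real_inner_smul_right, ← hβ]; ring
    have h4 : ∀ i, y i - inner ℝ (X i) β = r i := fun i => rfl
    simp_rw [h3, h4] at h2
    simp only [hΦ, zero_mul, sub_zero, mul_zero, zero_add]
    linarith
  have hnn : 0 ≤ g (β + d) - g β - μ / 2 * ‖sqrtLin S d‖ ^ 2
      + (n : ℝ)⁻¹ * ∑ i, -(deriv ρ (r i) * inner ℝ (X i) d) := by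
    have hs := hasDerivAt_iff_tendsto_slope_zero.1 htot
    refine ge_of_tendsto (hs.mono_left (nhdsGT_le_nhdsNE 0)) ?_
    filter_upwards [Ioo_mem_nhdsGT (zero_lt_one' ℝ)] with t ht
    have := hge t ht.1.le ht.2.le
    have h1 : 0 ≤ Φ (0 + t) - Φ 0 := by rw [zero_add]; linarith
    exact smul_nonneg (inv_nonneg.2 ht.1.le) h1
  rw [Finset.sum_neg_distrib] at hnn
  linarith

/-- The two optimality conditions, each tested at the other estimator, are added; the penalty values
cancel. -/
theorem strong_monotone (H : IsLossPenalty n μ M S ρ g) (y y' : Vec n) (X X' : Design n p) :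
    n * μ * ‖sqrtLin S (mEstimator ρ g y X - mEstimator ρ g y' X')‖ ^ 2
      ≤ ∑ i, (deriv ρ (residual ρ g y X i)
            * inner ℝ (X i) (mEstimator ρ g y X - mEstimator ρ g y' X')
          - deriv ρ (residual ρ g y' X' i)
            * inner ℝ (X' i) (mEstimator ρ g y X - mEstimator ρ g y' X')) := by
  set β := mEstimator ρ g y X
  set β' := mEstimator ρ g y' X'
  have h1 := H.penalty_ge y X (β' - β)
  have h2 := H.penalty_ge y' X' (β - β')
  rw [add_sub_cancel] at h1 h2
  have hn : (0 : ℝ) < n := Nat.cast_pos.2 H.n_pos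
  have e1 : ‖sqrtLin S (β' - β)‖ = ‖sqrtLin S (β - β')‖ := by
    rw [← norm_neg, ← map_neg, neg_sub]
  have e2 : ∑ i, deriv ρ (residual ρ g y X i) * inner ℝ (X i) (β' - β)
      = -∑ i, deriv ρ (residual ρ g y X i) * inner ℝ (X i) (β - β') := by
    rw [← Finset.sum_neg_distrib]
    refine Finset.sum_congr rfl fun i _ => ?_
    rw [← neg_sub β β', inner_neg_right]; ring
  rw [e1, e2] at h1
  rw [Finset.sum_sub_distrib]
  have h3 : μ * ‖sqrtLin S (β - β')‖ ^ 2 ≤ (n : ℝ)⁻¹ *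
      (∑ i, deriv ρ (residual ρ g y X i) * inner ℝ (X i) (β - β')
        - ∑ i, deriv ρ (residual ρ g y' X' i) * inner ℝ (X' i) (β - β')) := by
    change g β + _ + _ ≤ g β' at h1
    change g β' + _ + _ ≤ g β at h2
    linarith
  rw [le_inv_mul_iff₀ hn] at h3
  linarith

/-- The optimality condition tested at `0`, which minimizes the penalty. Only one half of the strong
convexity is available here, hence the factor 2. -/
theorem norm_sq_le (H : IsLossPenalty n μ M S ρ g) (y : Vec n) (X : Design n p) :
    n * μ * ‖sqrtLin S (mEstimator ρ g y X)‖ ^ 2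
      ≤ 2 * ∑ i, deriv ρ (residual ρ g y X i) * inner ℝ (X i) (mEstimator ρ g y X) := by
  set β := mEstimator ρ g y X
  have h1 := H.penalty_ge y X (-β)
  have hn : (0 : ℝ) < n := Nat.cast_pos.2 H.n_pos
  rw [map_neg, norm_neg] at h1
  simp only [inner_neg_right, mul_neg, Finset.sum_neg_distrib] at h1
  have h2 := H.penalty_min β
  have h3 : μ / 2 * ‖sqrtLin S β‖ ^ 2
      ≤ (n : ℝ)⁻¹ * ∑ i, deriv ρ (residual ρ g y X i) * inner ℝ (X i) β := by
    have e : mEstimator ρ g y X + -β = 0 := add_neg_cancel _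
    rw [e] at h1
    change g β + _ + _ ≤ _ at h1
    linarith
  rw [le_inv_mul_iff₀ hn] at h3
  linarith

/-- Strong monotonicity combined with cocoercivity of `ψ` at each residual. The residual increment
splits into the change of the data at a fixed estimator and the change of the estimator; the latter
cancels, and only increments of the data remain on the right. Every later bound on gradients and
leave-one-out differences is an instance of this inequality. -/
theorem contraction (H : IsLossPenalty n μ M S ρ g) (y y' : Vec n) (X X' : Design n p) :
    n * μ * ‖sqrtLin S (mEstimator ρ g y X - mEstimator ρ g y' X')‖ ^ 2
      + ∑ i, (deriv ρ (residual ρ g y X i) - deriv ρ (residual ρ g y' X' i)) ^ 2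
      ≤ ∑ i, (deriv ρ (residual ρ g y X i)
            * inner ℝ (X i - X' i) (mEstimator ρ g y X - mEstimator ρ g y' X')
          + (deriv ρ (residual ρ g y X i) - deriv ρ (residual ρ g y' X' i))
            * (y i - y' i - inner ℝ (X i - X' i) (mEstimator ρ g y X))) := by
  have h := H.strong_monotone y y' X X'
  have h2 : ∑ i, (deriv ρ (residual ρ g y X i)
            * inner ℝ (X i) (mEstimator ρ g y X - mEstimator ρ g y' X')
          - deriv ρ (residual ρ g y' X' i)
            * inner ℝ (X' i) (mEstimator ρ g y X - mEstimator ρ g y' X'))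
      + ∑ i, (deriv ρ (residual ρ g y X i) - deriv ρ (residual ρ g y' X' i)) ^ 2
      ≤ ∑ i, (deriv ρ (residual ρ g y X i)
            * inner ℝ (X i - X' i) (mEstimator ρ g y X - mEstimator ρ g y' X')
          + (deriv ρ (residual ρ g y X i) - deriv ρ (residual ρ g y' X' i))
            * (y i - y' i - inner ℝ (X i - X' i) (mEstimator ρ g y X))) := by
    rw [← Finset.sum_add_distrib]
    refine Finset.sum_le_sum fun i _ => ?_
    have h3 := H.loss.cocoercive (residual ρ g y X i) (residual ρ g y' X' i)
    have h4 : residual ρ g y X i - residual ρ g y' X' i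
        = y i - y' i - inner ℝ (X i - X' i) (mEstimator ρ g y X)
          - inner ℝ (X' i) (mEstimator ρ g y X - mEstimator ρ g y' X') := by
      rw [residual_apply, residual_apply, inner_sub_left, inner_sub_right]; ring
    rw [h4] at h3
    have h5 : inner ℝ (X i) (mEstimator ρ g y X - mEstimator ρ g y' X')
        = inner ℝ (X i - X' i) (mEstimator ρ g y X - mEstimator ρ g y' X')
          + inner ℝ (X' i) (mEstimator ρ g y X - mEstimator ρ g y' X') := by
      rw [inner_sub_left]; ring
    rw [h5]
    linarith
  linarith

/-- Changing `X` changes the residuals proportionally to `‖β̂‖`, so the constant depends on the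
estimator; `norm_mEstimator_le` makes it locally uniform. -/
theorem exists_lipschitz_const (H : IsLossPenalty n μ M S ρ g) : ∃ K : ℝ, 0 < K ∧
    ∀ z z' : Vec n × Design n p,
      dist (mEstimator ρ g z.1 z.2) (mEstimator ρ g z'.1 z'.2)
        ≤ K * (1 + ‖mEstimator ρ g z.1 z.2‖) ^ 2 * dist z z' := by
  obtain ⟨κ, hκ, hκb⟩ := exists_mul_norm_le_sqrtLin H.posDef
  have hn : (0 : ℝ) < n := Nat.cast_pos.2 H.n_pos
  have hμ := H.μ_pos
  have hM : 0 ≤ M := (abs_nonneg _).trans (H.psi_bound 0)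
  set a := n * μ * κ ^ 2 with ha
  have ha0 : 0 < a := by positivity
  refine ⟨(n * M + n + a) / a, by positivity, fun z z' => ?_⟩
  obtain ⟨y, X⟩ := z
  obtain ⟨y', X'⟩ := z'
  simp only
  set β := mEstimator ρ g y X with hβ
  set β' := mEstimator ρ g y' X' with hβ'
  set D := dist ((y, X) : Vec n × Design n p) (y', X') with hD
  have hD0 : 0 ≤ D := dist_nonneg
  have hy : ∀ i, |y i - y' i| ≤ D := fun i => by
    have h1 : ‖(y - y') i‖ ≤ ‖y - y'‖ := PiLp.norm_apply_le _ i
    have h2 : dist y y' ≤ D := le_max_left _ _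
    rw [dist_eq_norm] at h2
    exact h1.trans h2
  have hX : ∀ i, ‖X i - X' i‖ ≤ D := fun i => by
    have h1 : dist (X i) (X' i) ≤ dist X X' := dist_le_pi_dist _ _ i
    have h2 : dist X X' ≤ D := le_max_right _ _
    rw [dist_eq_norm] at h1
    exact h1.trans h2
  have h := H.contraction y y' X X'
  rw [← hβ, ← hβ'] at h
  rw [dist_eq_norm]
  set s := ‖β - β'‖ with hs
  have hs0 : 0 ≤ s := norm_nonneg _
  have hb0 : 0 ≤ ‖β‖ := norm_nonneg _
  have h1 : a * s ^ 2 ≤ n * M * D * s + n * (D * (1 + ‖β‖)) ^ 2 := by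
    have h2 : (κ * s) ^ 2 ≤ ‖sqrtLin S (β - β')‖ ^ 2 :=
      pow_le_pow_left₀ (by positivity) (hκb _) 2
    have h3 : a * s ^ 2 ≤ n * μ * ‖sqrtLin S (β - β')‖ ^ 2 := by
      rw [ha]; nlinarith [mul_pos hn hμ]
    refine h3.trans ?_
    have h4 : ∑ i, (deriv ρ (residual ρ g y X i) * inner ℝ (X i - X' i) (β - β')
          + (deriv ρ (residual ρ g y X i) - deriv ρ (residual ρ g y' X' i))
            * (y i - y' i - inner ℝ (X i - X' i) β))
        - ∑ i, (deriv ρ (residual ρ g y X i) - deriv ρ (residual ρ g y' X' i)) ^ 2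
        ≤ ∑ _i : Fin n, (M * D * s + (D * (1 + ‖β‖)) ^ 2) := by
      rw [← Finset.sum_sub_distrib]
      refine Finset.sum_le_sum fun i _ => ?_
      have i1 : |inner ℝ (X i - X' i) (β - β')| ≤ D * s :=
        (abs_real_inner_le_norm _ _).trans (mul_le_mul_of_nonneg_right (hX i) hs0)
      have i2 : |inner ℝ (X i - X' i) β| ≤ D * ‖β‖ :=
        (abs_real_inner_le_norm _ _).trans (mul_le_mul_of_nonneg_right (hX i) hb0)
      have i3 : deriv ρ (residual ρ g y X i) * inner ℝ (X i - X' i) (β - β') ≤ M * (D * s) := by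
        refine (le_abs_self _).trans ?_
        rw [abs_mul]
        exact mul_le_mul (H.psi_bound _) i1 (abs_nonneg _) hM
      have i4 : |y i - y' i - inner ℝ (X i - X' i) β| ≤ D * (1 + ‖β‖) := by
        have := abs_sub (y i - y' i) (inner ℝ (X i - X' i) β)
        have := hy i
        linarith
      have i5 : (y i - y' i - inner ℝ (X i - X' i) β) ^ 2 ≤ (D * (1 + ‖β‖)) ^ 2 :=
        sq_le_sq' (by linarith [(abs_le.1 i4).1]) (abs_le.1 i4).2
      nlinarith [sq_nonneg (2 * (deriv ρ (residual ρ g y X i) - deriv ρ (residual ρ g y' X' i))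
        - (y i - y' i - inner ℝ (X i - X' i) β)),
        sq_nonneg (y i - y' i - inner ℝ (X i - X' i) β)]
    simp only [Finset.sum_const, Finset.card_univ, Fintype.card_fin, nsmul_eq_mul] at h4
    linarith
  exact le_of_quadratic_le ha0 (by positivity) hn.le hD0 (by linarith) hs0 h1

theorem norm_mEstimator_le (H : IsLossPenalty n μ M S ρ g) : ∃ K : ℝ, 0 ≤ K ∧
    ∀ (y : Vec n) (X : Design n p), ‖mEstimator ρ g y X‖ ≤ K * ‖X‖ := by
  obtain ⟨κ, hκ, hκb⟩ := exists_mul_norm_le_sqrtLin H.posDef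
  have hn : (0 : ℝ) < n := Nat.cast_pos.2 H.n_pos
  have hμ := H.μ_pos
  have hM : 0 ≤ M := (abs_nonneg _).trans (H.psi_bound 0)
  refine ⟨2 * M / (μ * κ ^ 2), by positivity, fun y X => ?_⟩
  set β := mEstimator ρ g y X with hβ
  have h := H.norm_sq_le y X
  rw [← hβ] at h
  have h1 : ∑ i, deriv ρ (residual ρ g y X i) * inner ℝ (X i) β ≤ n * (M * (‖X‖ * ‖β‖)) := by
    calc _ ≤ ∑ _i : Fin n, M * (‖X‖ * ‖β‖) := by
          refine Finset.sum_le_sum fun i _ => (le_abs_self _).trans ?_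
          rw [abs_mul]
          refine mul_le_mul (H.psi_bound _) ((abs_real_inner_le_norm _ _).trans ?_)
            (abs_nonneg _) hM
          exact mul_le_mul_of_nonneg_right (norm_le_pi_norm X i) (norm_nonneg _)
      _ = _ := by simp
  have h2 : (κ * ‖β‖) ^ 2 ≤ ‖sqrtLin S β‖ ^ 2 := pow_le_pow_left₀ (by positivity) (hκb _) 2
  have h3 : n * μ * (κ * ‖β‖) ^ 2 ≤ 2 * (n * (M * (‖X‖ * ‖β‖))) := by
    have := mul_le_mul_of_nonneg_left h2 (mul_pos hn hμ).le
    linarith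
  rcases (norm_nonneg β).eq_or_lt with h0 | h0
  · rw [← h0]; positivity
  · rw [div_mul_eq_mul_div, le_div_iff₀ (by positivity)]
    have h4 : (n * ‖β‖) * (‖β‖ * (μ * κ ^ 2)) ≤ (n * ‖β‖) * (2 * M * ‖X‖) := by nlinarith
    exact le_of_mul_le_mul_left h4 (by positivity)

theorem locallyLipschitz_mEstimator (H : IsLossPenalty n μ M S ρ g) :
    LocallyLipschitz fun z : Vec n × Design n p => mEstimator ρ g z.1 z.2 := by
  obtain ⟨K, hK, h⟩ := H.exists_lipschitz_const
  obtain ⟨K', hK', h'⟩ := H.norm_mEstimator_le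
  intro z
  have hC : 0 ≤ K * (1 + K' * (‖z‖ + 1)) ^ 2 := by positivity
  refine ⟨(K * (1 + K' * (‖z‖ + 1)) ^ 2).toNNReal, Metric.ball z 1, Metric.ball_mem_nhds _ one_pos, ?_⟩
  refine LipschitzOnWith.of_dist_le_mul fun a ha b hb => (h a b).trans ?_
  rw [Real.coe_toNNReal _ hC]
  have hX : ‖a.2‖ ≤ ‖z‖ + 1 := by
    have h1 : ‖a.2‖ ≤ ‖a‖ := norm_snd_le a
    have h2 : ‖a - z‖ < 1 := by rwa [← dist_eq_norm]
    have h3 : ‖a‖ ≤ ‖z‖ + ‖a - z‖ := by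
      calc ‖a‖ = ‖z + (a - z)‖ := by rw [add_sub_cancel]
        _ ≤ _ := norm_add_le _ _
    linarith
  have h4 : ‖mEstimator ρ g a.1 a.2‖ ≤ K' * (‖z‖ + 1) :=
    (h' _ _).trans (mul_le_mul_of_nonneg_left hX hK')
  gcongr

theorem locallyLipschitz_residual (H : IsLossPenalty n μ M S ρ g) (i : Fin n) :
    LocallyLipschitz fun z : Vec n × Design n p => residual ρ g z.1 z.2 i := by
  have h : LocallyLipschitz fun w : (Vec n × Design n p) × Vec p =>
      w.1.1 i - inner ℝ (w.1.2 i) w.2 := by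
    refine ContDiff.locallyLipschitz (𝕂 := ℝ) ?_
    have h1 : ContDiff ℝ 1 fun w : (Vec n × Design n p) × Vec p => w.1.1 i :=
      (EuclideanSpace.proj (𝕜 := ℝ) i).contDiff.comp (contDiff_fst.comp contDiff_fst)
    have h2 : ContDiff ℝ 1 fun w : (Vec n × Design n p) × Vec p => w.1.2 i :=
      (ContinuousLinearMap.proj (R := ℝ) (φ := fun _ : Fin n => Vec p) i).contDiff.comp
        (contDiff_snd.comp contDiff_fst)
    exact h1.sub (h2.inner ℝ contDiff_snd)
  exact h.comp (LocallyLipschitz.id.prodMk H.locallyLipschitz_mEstimator)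

end IsLossPenalty

end Estimator

/-! ### Almost everywhere differentiability and existence of the derivative matrix. -/

theorem LocallyLipschitz.ae_differentiableAt {E F : Type*} [NormedAddCommGroup E] [NormedSpace ℝ E]
    [FiniteDimensional ℝ E] [MeasurableSpace E] [BorelSpace E] [NormedAddCommGroup F]
    [NormedSpace ℝ F] [FiniteDimensional ℝ F] {ν : Measure E} [ν.IsAddHaarMeasure] {f : E → F}
    (hf : LocallyLipschitz f) : ∀ᵐ x ∂ν, DifferentiableAt ℝ f x := by
  have : ProperSpace E := FiniteDimensional.proper ℝ E
  have h : ∀ k : ℕ, ∀ᵐ x ∂ν, x ∈ Metric.ball (0 : E) k → DifferentiableAt ℝ f x := by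
    intro k
    obtain ⟨K, hK⟩ := (hf.locallyLipschitzOn (s := Metric.closedBall (0 : E) k)
      ).exists_lipschitzOnWith_of_compact (isCompact_closedBall _ _)
    filter_upwards [(hK.mono Metric.ball_subset_closedBall).ae_differentiableWithinAt_of_mem
      (μ := ν)] with x hx hxb
    exact (hx hxb).differentiableAt (Metric.isOpen_ball.mem_nhds hxb)
  filter_upwards [ae_all_iff.2 h] with x hx
  obtain ⟨k, hk⟩ := exists_nat_gt ‖x‖
  exact hx k (by simpa using hk)

theorem IsLoss.psi_deriv_nonneg {ρ : ℝ → ℝ} (h : IsLoss ρ) (x : ℝ) : 0 ≤ deriv (deriv ρ) x :=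
  h.monotone_deriv.deriv_nonneg

theorem IsLoss.psi_deriv_le_one {ρ : ℝ → ℝ} (h : IsLoss ρ) (x : ℝ) :
    deriv (deriv ρ) x ≤ 1 := by
  have := norm_deriv_le_of_lipschitz (x₀ := x) h.lipschitz_deriv
  rw [Real.norm_eq_abs, NNReal.coe_one] at this
  exact (abs_le.1 this).2

theorem hasDerivAt_quadratic_le {V W : Type*} [NormedAddCommGroup V] [InnerProductSpace ℝ V]
    [NormedAddCommGroup W] [InnerProductSpace ℝ W] {T : V →ₗ[ℝ] W} (hT : Continuous T) {c : ℝ}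
    {a b : ℝ → V} {a' b' : V} (ha : HasDerivAt a a' 0) (hb : HasDerivAt b b' 0)
    (h : ∀ t, c * ‖T (a t - a 0)‖ ^ 2 ≤ inner ℝ (b t - b 0) (a t - a 0)) :
    c * ‖T a'‖ ^ 2 ≤ inner ℝ b' a' := by
  have ha' := hasDerivAt_iff_tendsto_slope_zero.1 ha
  have hb' := hasDerivAt_iff_tendsto_slope_zero.1 hb
  refine le_of_tendsto_of_tendsto ((((hT.tendsto a').comp ha').norm.pow 2).const_mul c)
    (hb'.inner ha') ?_
  filter_upwards with t
  have h1 := h t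
  simp only [Function.comp_apply, zero_add, map_smul, norm_smul, mul_pow, inner_smul_left,
    inner_smul_right, Real.norm_eq_abs, sq_abs, RCLike.conj_to_real]
  have h2 := mul_le_mul_of_nonneg_left h1 (sq_nonneg t⁻¹)
  nlinarith

/-- Lebesgue measure on the line is one-dimensional Hausdorff measure, which an inverse Lipschitz
map increases at most by a factor. -/
theorem antilipschitz_null_preimage {f : ℝ → ℝ} {K : NNReal} (hf : AntilipschitzWith K f)
    {N : Set ℝ} (hN : volume N = 0) : volume (f ⁻¹' N) = 0 := by
  have h := hf.hausdorffMeasure_preimage_le zero_le_one N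
  rw [hausdorffMeasure_real, hN, mul_zero] at h
  exact le_antisymm h (zero_le)

section

variable {n p : ℕ} {μ M : ℝ} {S : Matrix (Fin p) (Fin p) ℝ} {ρ : ℝ → ℝ} {g : Vec p → ℝ}

instance : (volume : Measure (Vec n × Design n p)).IsAddHaarMeasure := by
  apply Measure.prod.instIsAddHaarMeasure

namespace IsLossPenalty

/-- When only `y_i` moves by `a`, the contraction gives `c ‖Δβ̂‖² ≤ a |Δr_i|`, and `a ≤ |Δr_i| +
‖x_i‖ ‖Δβ̂‖`. The arithmetic-geometric mean inequality absorbs half of `a`, which yields the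
constant `2 + ‖x_i‖²/c`. -/
theorem antilipschitz_residual (H : IsLossPenalty n μ M S ρ g) (y : Vec n) (X : Design n p)
    (i : Fin n) : ∃ K, AntilipschitzWith K
      fun t : ℝ => residual ρ g (y + t • EuclideanSpace.single i 1) X i := by
  obtain ⟨κ, hκ, hκb⟩ := exists_mul_norm_le_sqrtLin H.posDef
  have hn : (0 : ℝ) < n := Nat.cast_pos.2 H.n_pos
  have hμ := H.μ_pos
  set c := n * μ * κ ^ 2 with hc
  have hc0 : 0 < c := by positivity
  have hP : 0 ≤ 2 + ‖X i‖ ^ 2 / c := by positivity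
  refine ⟨(2 + ‖X i‖ ^ 2 / c).toNNReal, AntilipschitzWith.of_le_mul_dist fun t t' => ?_⟩
  rw [Real.coe_toNNReal _ hP, Real.dist_eq, Real.dist_eq]
  have h := H.contraction (y + t • EuclideanSpace.single i 1) (y + t' • EuclideanSpace.single i 1)
    X X
  set Y := y + t • EuclideanSpace.single i (1 : ℝ)
  set Y' := y + t' • EuclideanSpace.single i (1 : ℝ)
  set β := mEstimator ρ g Y X
  set β' := mEstimator ρ g Y' X
  have hY : ∀ k, Y k - Y' k = if k = i then t - t' else 0 := fun k => by
    simp only [Y, Y', PiLp.add_apply, PiLp.smul_apply, PiLp.single_apply, smul_eq_mul]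
    split_ifs <;> ring
  simp only [sub_self, inner_zero_left, mul_zero, sub_zero, zero_add, hY, mul_ite,
    Finset.sum_ite_eq', Finset.mem_univ, if_true] at h
  set a := |t - t'|
  set d := |residual ρ g Y X i - residual ρ g Y' X i|
  have h1 : c * ‖β - β'‖ ^ 2 ≤ a * d := by
    have h2 : (κ * ‖β - β'‖) ^ 2 ≤ ‖sqrtLin S (β - β')‖ ^ 2 :=
      pow_le_pow_left₀ (by positivity) (hκb _) 2
    have h3 : 0 ≤ ∑ k, (deriv ρ (residual ρ g Y X k) - deriv ρ (residual ρ g Y' X k)) ^ 2 :=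
      Finset.sum_nonneg fun _ _ => sq_nonneg _
    have h4 : (deriv ρ (residual ρ g Y X i) - deriv ρ (residual ρ g Y' X i)) * (t - t')
        ≤ a * d := by
      refine (le_abs_self _).trans ?_
      rw [abs_mul, mul_comm]
      have := H.loss.lipschitz_deriv.dist_le_mul (residual ρ g Y X i) (residual ρ g Y' X i)
      rw [NNReal.coe_one, one_mul, Real.dist_eq, Real.dist_eq] at this
      exact mul_le_mul_of_nonneg_left this (abs_nonneg _)
    have h5 := mul_le_mul_of_nonneg_left h2 (mul_pos hn hμ).le
    rw [hc]
    nlinarith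
  have h6 : a ≤ d + ‖X i‖ * ‖β - β'‖ := by
    have e : t - t' = (residual ρ g Y X i - residual ρ g Y' X i) + inner ℝ (X i) (β - β') := by
      rw [residual_apply, residual_apply, inner_sub_right]
      have := hY i
      rw [if_pos rfl] at this
      rw [← this]; ring
    calc a = |(residual ρ g Y X i - residual ρ g Y' X i) + inner ℝ (X i) (β - β')| := by
          rw [← e]
      _ ≤ _ := (abs_add_le _ _).trans (add_le_add le_rfl (abs_real_inner_le_norm _ _))
  have ha : 0 ≤ a := abs_nonneg _
  have hd : 0 ≤ d := abs_nonneg _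
  have h7 : ‖X i‖ * ‖β - β'‖ ≤ (a + ‖X i‖ ^ 2 / c * d) / 2 := by
    refine abs_le_of_sq_le_sq' ?_ (by positivity) |>.2
    have h8 : (‖X i‖ * ‖β - β'‖) ^ 2 ≤ ‖X i‖ ^ 2 / c * (a * d) := by
      rw [div_mul_eq_mul_div, le_div_iff₀ hc0, mul_pow, mul_assoc]
      refine mul_le_mul_of_nonneg_left ?_ (sq_nonneg _)
      linarith
    nlinarith [sq_nonneg (a - ‖X i‖ ^ 2 / c * d)]
  linarith

/-- On every line in the direction `y_i` the residual `r_i` is antilipschitz, so it meets the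
Lebesgue-null set of bad points of `ψ` for almost no parameter. Fubini along these lines concludes.
-/
theorem ae_differentiableAt_psi (H : IsLossPenalty n μ M S ρ g) :
    ∀ᵐ z : Vec n × Design n p, ∀ i, DifferentiableAt ℝ (deriv ρ) (residual ρ g z.1 z.2 i) := by
  rw [ae_all_iff]
  intro i
  have hD : MeasurableSet {u : ℝ | DifferentiableAt ℝ (deriv ρ) u} :=
    measurableSet_of_differentiableAt ℝ _
  have hN : volume {u : ℝ | DifferentiableAt ℝ (deriv ρ) u}ᶜ = 0 :=
    H.loss.lipschitz_deriv.ae_differentiableAt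
  have hs : MeasurableSet {z : Vec n × Design n p |
      DifferentiableAt ℝ (deriv ρ) (residual ρ g z.1 z.2 i)} :=
    (H.locallyLipschitz_residual i).continuous.measurable hD
  let L : ℝ →ₗ[ℝ] Vec n × Design n p :=
    LinearMap.toSpanSingleton ℝ _ (EuclideanSpace.single i 1, 0)
  refine ae_mem_of_ae_add_linearMap_mem L volume volume hs fun z => ?_
  obtain ⟨K, hK⟩ := H.antilipschitz_residual z.1 z.2 i
  have h := antilipschitz_null_preimage hK hN
  filter_upwards [compl_mem_ae_iff.2 h] with t ht
  have e : z + L t = (z.1 + t • EuclideanSpace.single i 1, z.2) := by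
    ext1
    · simp [L]
    · simp [L]
  simp only [Set.mem_compl_iff, Set.mem_preimage, Set.mem_ofPred_eq, not_not] at ht
  change DifferentiableAt ℝ (deriv ρ) (residual ρ g (z + L t).1 (z + L t).2 i)
  rw [e]
  exact ht

/-- The derivative of `Xᵀ ψ(y - X β)` for fixed `β`. -/
def scoreDeriv (ρ : ℝ → ℝ) (g : Vec p → ℝ) (y : Vec n) (X : Design n p) :
    Vec n × Design n p →ₗ[ℝ] Vec p where
  toFun d := ∑ i, (deriv ρ (residual ρ g y X i) • d.2 i
    + (deriv (deriv ρ) (residual ρ g y X i) * (d.1 i - inner ℝ (d.2 i) (mEstimator ρ g y X))) • X i)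
  map_add' d d' := by
    rw [← Finset.sum_add_distrib]
    refine Finset.sum_congr rfl fun i _ => ?_
    simp only [Prod.fst_add, Prod.snd_add, PiLp.add_apply, Pi.add_apply, inner_add_left]
    module
  map_smul' t d := by
    rw [RingHom.id_apply, Finset.smul_sum]
    refine Finset.sum_congr rfl fun i _ => ?_
    simp only [Prod.smul_fst, Prod.smul_snd, PiLp.smul_apply, Pi.smul_apply, inner_smul_left,
      smul_eq_mul, RCLike.conj_to_real]
    module

/-- Linearization of `strong_monotone`. The full derivative of `Xᵀ ψ(r)` is `scoreDeriv` minus `Xᵀ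
diag(ψ') X` applied to the derivative of the estimator; the subtracted quadratic form is nonnegative
because `ψ` is nondecreasing, and it is dropped. -/
theorem fderiv_quadratic_le (H : IsLossPenalty n μ M S ρ g) {y : Vec n} {X : Design n p}
    (hβ : DifferentiableAt ℝ (fun z : Vec n × Design n p => mEstimator ρ g z.1 z.2) (y, X))
    (hψ : ∀ i, DifferentiableAt ℝ (deriv ρ) (residual ρ g y X i)) (d : Vec n × Design n p) :
    n * μ * ‖sqrtLin S
        (fderiv ℝ (fun z : Vec n × Design n p => mEstimator ρ g z.1 z.2) (y, X) d)‖ ^ 2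
      ≤ inner ℝ (scoreDeriv ρ g y X d)
        (fderiv ℝ (fun z : Vec n × Design n p => mEstimator ρ g z.1 z.2) (y, X) d) := by
  set L := fderiv ℝ (fun z : Vec n × Design n p => mEstimator ρ g z.1 z.2) (y, X) with hL
  set β := mEstimator ρ g y X with hβdef
  have hb : HasDerivAt (fun t : ℝ => mEstimator ρ g (y + t • d.1) (X + t • d.2)) (L d) 0 := by
    have := hβ.hasFDerivAt.hasLineDerivAt d
    exact this
  have hx : ∀ i, HasDerivAt (fun t : ℝ => (X + t • d.2) i) (d.2 i) 0 := fun i => by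
    have := ((hasDerivAt_id (0 : ℝ)).smul_const (d.2 i)).const_add (X i)
    simpa using this
  have hr : ∀ i, HasDerivAt (fun t : ℝ => residual ρ g (y + t • d.1) (X + t • d.2) i)
      (d.1 i - inner ℝ (d.2 i) β - inner ℝ (X i) (L d)) 0 := fun i => by
    have h1 : HasDerivAt (fun t : ℝ => (y + t • d.1) i) (d.1 i) 0 := by
      have := ((hasDerivAt_id (0 : ℝ)).mul_const (d.1 i)).const_add (y i)
      simpa using this
    have h2 := h1.sub ((hx i).inner ℝ hb)
    refine h2.congr_deriv ?_
    simp only [zero_smul, add_zero, ← hβdef]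
    ring
  have hp : ∀ i, HasDerivAt (fun t : ℝ => deriv ρ (residual ρ g (y + t • d.1) (X + t • d.2) i))
      (deriv (deriv ρ) (residual ρ g y X i)
        * (d.1 i - inner ℝ (d.2 i) β - inner ℝ (X i) (L d))) 0 := fun i => by
    have h1 : HasDerivAt (deriv ρ) (deriv (deriv ρ) (residual ρ g y X i))
        (residual ρ g (y + (0 : ℝ) • d.1) (X + (0 : ℝ) • d.2) i) := by
      simpa using (hψ i).hasDerivAt
    exact h1.comp (0 : ℝ) (hr i)
  have hv := HasDerivAt.fun_sum fun i (_ : i ∈ Finset.univ) => (hp i).smul (hx i)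
  have hT : Continuous (sqrtLin S) := LinearMap.continuous_of_finiteDimensional _
  have key := hasDerivAt_quadratic_le (c := n * μ) hT hb hv (fun t => ?_)
  · refine key.trans ?_
    simp only [zero_smul, add_zero]
    have e : inner ℝ (scoreDeriv ρ g y X d) (L d)
        - inner ℝ (∑ i, (deriv ρ (residual ρ g y X i) • d.2 i
          + (deriv (deriv ρ) (residual ρ g y X i)
            * (d.1 i - inner ℝ (d.2 i) β - inner ℝ (X i) (L d))) • X i)) (L d)
        = ∑ i, deriv (deriv ρ) (residual ρ g y X i) * inner ℝ (X i) (L d) ^ 2 := by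
      rw [← inner_sub_left]
      simp only [scoreDeriv, LinearMap.coe_mk, AddHom.coe_mk, ← Finset.sum_sub_distrib, sum_inner]
      refine Finset.sum_congr rfl fun i _ => ?_
      simp only [inner_sub_left, inner_add_left, real_inner_smul_left]
      ring
    have h0 : 0 ≤ ∑ i, deriv (deriv ρ) (residual ρ g y X i) * inner ℝ (X i) (L d) ^ 2 :=
      Finset.sum_nonneg fun i _ => mul_nonneg (H.loss.psi_deriv_nonneg _) (sq_nonneg _)
    linarith
  · have h1 := H.strong_monotone (y + t • d.1) (y + (0 : ℝ) • d.1) (X + t • d.2)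
      (X + (0 : ℝ) • d.2)
    refine h1.trans (le_of_eq ?_)
    rw [inner_sub_left, sum_inner, sum_inner, ← Finset.sum_sub_distrib]
    refine Finset.sum_congr rfl fun i _ => ?_
    simp only [Pi.smul_apply', real_inner_smul_left]

/-- The quadratic inequality shows that the derivative `L` of the estimator vanishes on the kernel
of the score derivative `W`. When `W` has a right inverse `s`, this gives `L = A W` with `A = L s`;
both derivative formulas are then evaluations of `W` on coordinate directions, and the same
inequality at `s(S^(1/2) v)` is the norm bound. -/
theorem exists_isDerivMatrix (H : IsLossPenalty n μ M S ρ g) {y : Vec n} {X : Design n p}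
    (hβ : DifferentiableAt ℝ (fun z : Vec n × Design n p => mEstimator ρ g z.1 z.2) (y, X))
    (hψ : ∀ i, DifferentiableAt ℝ (deriv ρ) (residual ρ g y X i)) (hy : y ≠ 0) :
    ∃ A, IsDerivMatrix μ S ρ g y X A := by
  have hn : (0 : ℝ) < n := Nat.cast_pos.2 H.n_pos
  have hμ := H.μ_pos
  have hquad := H.fderiv_quadratic_le hβ hψ
  set L := fderiv ℝ (fun z : Vec n × Design n p => mEstimator ρ g z.1 z.2) (y, X) with hL
  set β := mEstimator ρ g y X with hβdef
  set ψ : Fin n → ℝ := fun i => deriv ρ (residual ρ g y X i) with hψdef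
  set W := scoreDeriv ρ g y X with hW
  have hinj : ∀ v, sqrtLin S v = 0 → v = 0 := fun v hv => by
    rw [← sqrtInvLin_sqrtLin H.posDef v, hv, map_zero]
  have hker : ∀ d, W d = 0 → L d = 0 := fun d hd => by
    have h := hquad d
    rw [hd, inner_zero_left] at h
    have h1 : 0 < n * μ := by positivity
    have h2 : ‖sqrtLin S (L d)‖ ^ 2 = 0 := by nlinarith [sq_nonneg ‖sqrtLin S (L d)‖]
    exact hinj _ (by simpa using h2)
  -- If `ψ(r) = 0`, then `r = 0`, the norm bound forces `β̂ = 0`, and so `y = 0`, which is excluded.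
  have hΨ : 0 < ∑ i, ψ i ^ 2 := by
    refine lt_of_le_of_ne (Finset.sum_nonneg fun _ _ => sq_nonneg _) fun h0 => hy ?_
    have hz : ∀ i, ψ i = 0 := fun i => by
      have := (Finset.sum_eq_zero_iff_of_nonneg fun i _ => sq_nonneg (ψ i)).1 h0.symm i
        (Finset.mem_univ i)
      simpa using this
    have hr : ∀ i, residual ρ g y X i = 0 := fun i => (H.loss.deriv_eq_zero_iff _).1 (hz i)
    have hb := H.norm_sq_le y X
    simp only [hψdef] at hz
    simp only [hz, zero_mul, Finset.sum_const_zero, mul_zero] at hb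
    have h1 : 0 < n * μ := by positivity
    have h2 : ‖sqrtLin S β‖ ^ 2 = 0 := by
      rw [← hβdef] at hb
      nlinarith [sq_nonneg ‖sqrtLin S β‖]
    have hβ0 : β = 0 := hinj _ (by simpa using h2)
    ext i
    have := hr i
    rw [residual_apply, ← hβdef, hβ0, inner_zero_right, sub_zero] at this
    simpa using this
  set Ψ := ∑ i, ψ i ^ 2 with hΨdef
  -- Right inverse of `W`: each row moves by a multiple of `w` weighted by `ψ_i`, and `y_i` moves
  -- along so that the residuals at fixed `β̂` do not change. Only the term `∑ ψ_i dx_i` of the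
  -- score derivative remains.
  let s : Vec p →ₗ[ℝ] Vec n × Design n p :=
    { toFun := fun w => (WithLp.toLp 2 fun i => (ψ i / Ψ) * inner ℝ w β, fun i => (ψ i / Ψ) • w)
      map_add' := fun w w' => by
        ext i
        · simp [inner_add_left, mul_add]
        · simp
      map_smul' := fun t w => by
        ext i
        · simp [inner_smul_left]; ring
        · simp; ring }
  have hWs : ∀ w, W (s w) = w := fun w => by
    have h1 : W (s w) = ∑ i, (ψ i ^ 2 / Ψ) • w := by
      simp only [hW, scoreDeriv, LinearMap.coe_mk, AddHom.coe_mk, s]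
      refine Finset.sum_congr rfl fun i _ => ?_
      rw [real_inner_smul_left, ← hβdef, sub_self, mul_zero, zero_smul, add_zero, smul_smul]
      congr 1
      simp only [hψdef]; ring
    rw [h1, ← Finset.sum_smul, ← Finset.sum_div, div_self hΨ.ne', one_smul]
  let Alin : Vec p →ₗ[ℝ] Vec p := L.toLinearMap.comp s
  have hA : ∀ d, L d = Alin (W d) := fun d => by
    have h1 : W (d - s (W d)) = 0 := by rw [map_sub, hWs, sub_self]
    have h2 := hker _ h1
    rw [map_sub, sub_eq_zero] at h2
    exact h2
  set A := Matrix.toEuclideanLin.symm Alin with hAdef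
  have hAA : Matrix.toEuclideanLin A = Alin := LinearEquiv.apply_symm_apply _ _
  refine ⟨A, hβ, hψ, ?_, fun i => ?_, fun i j => ?_⟩
  · unfold opNorm
    refine ContinuousLinearMap.opNorm_le_bound _ (by positivity) fun v => ?_
    have e : LinearMap.toContinuousLinearMap (Matrix.toEuclideanLin (sqrtMat S * A * sqrtMat S)) v
        = sqrtLin S (Alin (sqrtLin S v)) := by
      rw [LinearMap.coe_toContinuousLinearMap', Matrix.toLpLin_mul_same, Matrix.toLpLin_mul_same,
        hAA]
      rfl
    rw [e]
    have h := hquad (s (sqrtLin S v))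
    rw [hWs] at h
    change n * μ * ‖sqrtLin S (Alin (sqrtLin S v))‖ ^ 2 ≤ inner ℝ _ (Alin (sqrtLin S v)) at h
    rw [inner_sqrtLin] at h
    have h1 := real_inner_le_norm v (sqrtLin S (Alin (sqrtLin S v)))
    set N := ‖sqrtLin S (Alin (sqrtLin S v))‖
    rw [inv_mul_eq_div, le_div_iff₀ (by positivity)]
    rcases (norm_nonneg (sqrtLin S (Alin (sqrtLin S v)))).eq_or_lt with h0 | h0
    · change 0 = N at h0
      rw [← h0, zero_mul]; positivity
    · change 0 < N at h0
      refine le_of_mul_le_mul_left ?_ h0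
      nlinarith
  · rw [← hL, hA, hAA]
    have : W (EuclideanSpace.single i 1, 0)
        = deriv (deriv ρ) (residual ρ g y X i) • X i := by
      simp only [hW, scoreDeriv, LinearMap.coe_mk, AddHom.coe_mk, Pi.zero_apply, smul_zero,
        zero_add, inner_zero_left, sub_zero]
      rw [Finset.sum_eq_single i]
      · simp
      · intro k _ hk; simp [hk]
      · simp
    rw [this, map_smul]
  · rw [← hL, hA, hAA]
    have : W (0, Pi.single i (EuclideanSpace.single j 1))
        = deriv ρ (residual ρ g y X i) • EuclideanSpace.single j 1
        - (deriv (deriv ρ) (residual ρ g y X i) * β j) • X i := by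
      simp only [hW, scoreDeriv, LinearMap.coe_mk, AddHom.coe_mk]
      rw [Finset.sum_eq_single i]
      · simp [← hβdef, sub_eq_add_neg, EuclideanSpace.inner_single_left]
      · intro k _ hk; simp [hk]
      · simp
    rw [this, map_sub, map_smul, map_smul]

theorem ae_exists_isDerivMatrix (H : IsLossPenalty n μ M S ρ g) :
    ∀ᵐ z : Vec n × Design n p, ∃ A, IsDerivMatrix μ S ρ g z.1 z.2 A := by
  have hne : ∀ᵐ z : Vec n × Design n p, z.1 ≠ 0 := by
    have : Nonempty (Fin n) := ⟨⟨0, H.n_pos⟩⟩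
    have h0 : ∀ᵐ y : Vec n, y ≠ 0 := Measure.ae_ne volume 0
    exact (Measure.quasiMeasurePreserving_fst (μ := (volume : Measure (Vec n)))
      (ν := (volume : Measure (Design n p)))).ae h0
  filter_upwards [LocallyLipschitz.ae_differentiableAt (ν := volume)
    H.locallyLipschitz_mEstimator, H.ae_differentiableAt_psi, hne] with z h1 h2 h3
  exact H.exists_isDerivMatrix h1 h2 h3

end IsLossPenalty

end

/-! ### Gradient and leave-one-out bounds implied by the contraction inequality. -/

section Contractive

variable {n p : ℕ}

/-- `‖Z‖ ^ 2 ≤ L` in operator norm. -/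
def OpBound (Z : Design n p) (L : ℝ) : Prop := ∀ v : Vec p, ∑ i, inner ℝ (Z i) v ^ 2 ≤ L * ‖v‖ ^ 2

theorem OpBound.norm_row_sq_le {Z : Design n p} {L : ℝ} (h : OpBound Z L) (hL : 0 ≤ L) (i : Fin n) :
    ‖Z i‖ ^ 2 ≤ L := by
  have h1 : inner ℝ (Z i) (Z i) ^ 2 ≤ L * ‖Z i‖ ^ 2 :=
    (Finset.single_le_sum (f := fun k => inner ℝ (Z k) (Z i) ^ 2) (fun k _ => sq_nonneg _)
      (Finset.mem_univ i)).trans (h (Z i))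
  rw [real_inner_self_eq_norm_sq] at h1
  rcases (sq_nonneg ‖Z i‖).eq_or_lt with h0 | h0
  · rw [← h0]; exact hL
  · exact le_of_mul_le_mul_right (by nlinarith) h0

/-- A pair of maps `h`, `ψ` of the design which satisfies the contraction inequality
of regularized M-estimators, depending on the rows in `s` only. -/
structure Contractive (μ M : ℝ) (s : Finset (Fin n)) (h : Design n p → Vec p)
    (ψ : Fin n → Design n p → ℝ) : Prop where
  lip_h : LocallyLipschitz h
  lip_ψ : ∀ i, LocallyLipschitz (ψ i)
  bound_ψ : ∀ i Z, |ψ i Z| ≤ M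
  contraction : ∀ Z Z', n * μ * ‖h Z - h Z'‖ ^ 2 + ∑ i, (ψ i Z - ψ i Z') ^ 2
    ≤ ∑ i ∈ s, (ψ i Z * inner ℝ (Z i - Z' i) (h Z - h Z')
      - (ψ i Z - ψ i Z') * inner ℝ (Z i - Z' i) (h Z))

/-- The linear map which replaces a row of the design by zero. -/
def dropRow (i : Fin n) : Design n p →L[ℝ] Design n p :=
  ContinuousLinearMap.pi fun k => if k = i then 0 else ContinuousLinearMap.proj k

theorem dropRow_apply (i k : Fin n) (Z : Design n p) :
    dropRow i Z k = if k = i then 0 else Z k := by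
  unfold dropRow
  rw [ContinuousLinearMap.pi_apply]
  split_ifs <;> rfl

theorem OpBound.dropRow {Z : Design n p} {L : ℝ} (h : OpBound Z L) (i : Fin n) :
    OpBound (dropRow i Z) L := fun v => by
  refine le_trans (Finset.sum_le_sum fun k _ => ?_) (h v)
  rw [dropRow_apply]
  split_ifs
  · simpa using sq_nonneg _
  · exact le_rfl

variable {μ M : ℝ} {s : Finset (Fin n)} {h : Design n p → Vec p} {ψ : Fin n → Design n p → ℝ}

/-- The zeroed row contributes no increment, so the leave-one-out map inherits the inequality with
that row removed from the sum. All gradient bounds thus hold for it with the same constants. -/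
theorem Contractive.comp_dropRow (H : Contractive μ M Finset.univ h ψ) (i : Fin n) :
    Contractive μ M (Finset.univ.erase i) (fun Z => h (dropRow i Z))
      (fun k Z => ψ k (dropRow i Z)) where
  lip_h := H.lip_h.comp (dropRow i).lipschitz.locallyLipschitz
  lip_ψ k := (H.lip_ψ k).comp (dropRow i).lipschitz.locallyLipschitz
  bound_ψ k Z := H.bound_ψ k _
  contraction Z Z' := by
    refine (H.contraction (dropRow i Z) (dropRow i Z')).trans (le_of_eq ?_)
    rw [← Finset.add_sum_erase _ _ (Finset.mem_univ i)]
    simp only [dropRow_apply, if_true, sub_self, inner_zero_left, mul_zero, zero_add]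
    refine Finset.sum_congr rfl fun k hk => ?_
    simp [Finset.ne_of_mem_erase hk]

theorem tendsto_slope_of_hasLineDerivAt {E F : Type*} [NormedAddCommGroup E] [NormedSpace ℝ E]
    [NormedAddCommGroup F] [NormedSpace ℝ F] {f : E → F} {f' : F} {x v : E}
    (hf : HasLineDerivAt ℝ f f' x v) :
    Tendsto (fun t : ℝ => t⁻¹ • (f x - f (x + t • v))) (𝓝[≠] 0) (𝓝 (-f')) := by
  have := (hasLineDerivAt_iff_tendsto_slope_zero.1 hf).neg
  refine this.congr fun t => ?_
  rw [← smul_neg, neg_sub]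

/-- The contraction inequality between `Z` and `Z + t V`, divided by `t²`, in the limit `t → 0`. The
signs of the difference quotients and of the row increments compensate. -/
theorem Contractive.deriv_le (H : Contractive μ M s h ψ) {Z V : Design n p} {h' : Vec p}
    {ψ' : Fin n → ℝ} (hh : HasLineDerivAt ℝ h h' Z V)
    (hψ : ∀ i, HasLineDerivAt ℝ (ψ i) (ψ' i) Z V) :
    n * μ * ‖h'‖ ^ 2 + ∑ i, ψ' i ^ 2
      ≤ ∑ i ∈ s, (ψ i Z * inner ℝ (V i) h' - ψ' i * inner ℝ (V i) (h Z)) := by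
  have th := tendsto_slope_of_hasLineDerivAt hh
  have tp := fun i => tendsto_slope_of_hasLineDerivAt (hψ i)
  have l1 := ((th.norm.pow 2).const_mul (n * μ)).add
    (tendsto_finsetSum Finset.univ fun i _ => (tp i).pow 2)
  have l2 := tendsto_finsetSum s fun i _ =>
    (((tendsto_const_nhds (x := V i)).inner th).const_mul (ψ i Z)).sub ((tp i).mul_const (inner ℝ (V i) (h Z)))
  have key := le_of_tendsto_of_tendsto l1 (l2.mul_const (-1 : ℝ)) ?_
  · simp only [norm_neg, inner_neg_right, neg_sq] at key
    refine key.trans (le_of_eq ?_)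
    rw [Finset.sum_mul]
    exact Finset.sum_congr rfl fun i _ => by ring
  · filter_upwards [self_mem_nhdsWithin] with t ht
    have ht0 : t ≠ 0 := ht
    have h1 := mul_le_mul_of_nonneg_left (H.contraction Z (Z + t • V)) (sq_nonneg t⁻¹)
    simp only [norm_smul, mul_pow, Real.norm_eq_abs, sq_abs, smul_eq_mul]
    have e1 : ∀ i, Z i - (Z + t • V) i = -(t • V i) := fun i => by simp
    simp only [e1, inner_neg_left, real_inner_smul_left] at h1
    rw [mul_add, Finset.mul_sum, Finset.mul_sum] at h1
    refine le_trans (le_of_eq ?_) (h1.trans (le_of_eq ?_))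
    · congr 1; ring
    · rw [Finset.sum_mul]
      refine Finset.sum_congr rfl fun i _ => ?_
      rw [real_inner_smul_right]
      field_simp
      ring

theorem sum_norm_sq_smul_le (s : Finset (Fin n)) (c : Fin n → ℝ) (V : Design n p) :
    ‖∑ i ∈ s, c i • V i‖ ^ 2 ≤ (∑ i, c i ^ 2) * ∑ i, ‖V i‖ ^ 2 := by
  have h1 : ‖∑ i ∈ s, c i • V i‖ ≤ ∑ i ∈ s, |c i| * ‖V i‖ := by
    refine (norm_sum_le _ _).trans (le_of_eq (Finset.sum_congr rfl fun i _ => ?_))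
    rw [norm_smul, Real.norm_eq_abs]
  calc ‖∑ i ∈ s, c i • V i‖ ^ 2 ≤ (∑ i ∈ s, |c i| * ‖V i‖) ^ 2 :=
        pow_le_pow_left₀ (norm_nonneg _) h1 2
    _ ≤ (∑ i ∈ s, |c i| ^ 2) * ∑ i ∈ s, ‖V i‖ ^ 2 := Finset.sum_mul_sq_le_sq_mul_sq _ _ _
    _ ≤ _ := by
        simp only [sq_abs]
        have a1 : ∑ i ∈ s, c i ^ 2 ≤ ∑ i, c i ^ 2 :=
          Finset.sum_le_sum_of_subset_of_nonneg (Finset.subset_univ s) fun _ _ _ => sq_nonneg _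
        have a2 : ∑ i ∈ s, ‖V i‖ ^ 2 ≤ ∑ i, ‖V i‖ ^ 2 :=
          Finset.sum_le_sum_of_subset_of_nonneg (Finset.subset_univ s) fun _ _ _ => sq_nonneg _
        exact mul_le_mul a1 a2 (Finset.sum_nonneg fun _ _ => sq_nonneg _)
          (Finset.sum_nonneg fun _ _ => sq_nonneg _)

theorem mul_le_half_sq {a x y : ℝ} (ha : 0 < a) : x * y ≤ a / 2 * y ^ 2 + x ^ 2 / (2 * a) := by
  have h : a / 2 * y ^ 2 + x ^ 2 / (2 * a) - x * y = (a * y - x) ^ 2 / (2 * a) := by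
    field_simp; ring
  have : 0 ≤ (a * y - x) ^ 2 / (2 * a) := by positivity
  linarith

/-- Young's inequality absorbs half of `n μ ‖h'‖²` from the first term on the right and the `ψ'`
squares from the second. -/
theorem Contractive.norm_deriv_sq_le (H : Contractive μ M s h ψ) (hn : 0 < n) (hμ : 0 < μ)
    {Z V : Design n p} {h' : Vec p}
    {ψ' : Fin n → ℝ} (hh : HasLineDerivAt ℝ h h' Z V)
    (hψ : ∀ i, HasLineDerivAt ℝ (ψ i) (ψ' i) Z V) :
    ‖h'‖ ^ 2 ≤ (‖∑ i ∈ s, ψ i Z • V i‖ ^ 2 / (n * μ)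
      + ∑ i, inner ℝ (V i) (h Z) ^ 2) / (n * μ) := by
  have h1 := H.deriv_le hh hψ
  have hn' : (0 : ℝ) < n := Nat.cast_pos.2 hn
  have ha : 0 < n * μ := by positivity
  rw [Finset.sum_sub_distrib] at h1
  have h2 : ∑ i ∈ s, ψ i Z * inner ℝ (V i) h' = inner ℝ (∑ i ∈ s, ψ i Z • V i) h' := by
    rw [sum_inner]
    exact Finset.sum_congr rfl fun i _ => by rw [real_inner_smul_left]
  have h3 : inner ℝ (∑ i ∈ s, ψ i Z • V i) h' ≤ n * μ / 2 * ‖h'‖ ^ 2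
      + ‖∑ i ∈ s, ψ i Z • V i‖ ^ 2 / (2 * (n * μ)) :=
    (real_inner_le_norm _ _).trans (mul_le_half_sq ha)
  have h4 : -∑ i ∈ s, ψ' i * inner ℝ (V i) (h Z)
      ≤ ∑ i, ψ' i ^ 2 + ∑ i, inner ℝ (V i) (h Z) ^ 2 / 2 := by
    rw [← Finset.sum_neg_distrib, ← Finset.sum_add_distrib]
    refine (Finset.sum_le_sum fun i _ => ?_).trans (Finset.sum_le_sum_of_subset_of_nonneg
      (Finset.subset_univ s) fun i _ _ => by positivity)
    nlinarith [sq_nonneg (ψ' i + inner ℝ (V i) (h Z)), sq_nonneg (ψ' i)]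
  rw [h2] at h1
  rw [le_div_iff₀ ha]
  rw [← Finset.sum_div] at h4
  have h5 : ‖∑ i ∈ s, ψ i Z • V i‖ ^ 2 / (2 * (n * μ))
      = ‖∑ i ∈ s, ψ i Z • V i‖ ^ 2 / (n * μ) / 2 := by field_simp
  linarith

/-- In the coordinate direction `(i, j)` the directional bound reads `(M²/(nμ) + h_j²)/(nμ)`; the
sum over all `n p` coordinates stays bounded when `p/n` does. -/
theorem Contractive.sum_norm_partial_sq_le (H : Contractive μ M s h ψ) (hn : 0 < n) (hμ : 0 < μ)
    {Z : Design n p} (hh : DifferentiableAt ℝ h Z) (hψ : ∀ i, DifferentiableAt ℝ (ψ i) Z) :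
    ∑ a : Fin n × Fin p, ‖fderiv ℝ h Z (designBasis a)‖ ^ 2
      ≤ p / n * (M / μ) ^ 2 + ‖h Z‖ ^ 2 / μ := by
  have hn' : (0 : ℝ) < n := Nat.cast_pos.2 hn
  have ha : 0 < n * μ := by positivity
  have h1 : ∀ a : Fin n × Fin p, ‖fderiv ℝ h Z (designBasis a)‖ ^ 2
      ≤ (M ^ 2 / (n * μ) + h Z a.2 ^ 2) / (n * μ) := by
    rintro ⟨i, j⟩
    refine (H.norm_deriv_sq_le hn hμ (hh.hasFDerivAt.hasLineDerivAt _)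
      (fun k => (hψ k).hasFDerivAt.hasLineDerivAt _)).trans ?_
    have e1 : ∑ k, inner ℝ (designBasis (i, j) k) (h Z) ^ 2 = h Z j ^ 2 := by
      rw [Finset.sum_eq_single i]
      · simp [designBasis, EuclideanSpace.inner_single_left]
      · intro k _ hk; simp [designBasis, hk]
      · simp
    have e2 : ‖∑ k ∈ s, ψ k Z • designBasis (i, j) k‖ ^ 2 ≤ M ^ 2 := by
      have : ‖∑ k ∈ s, ψ k Z • designBasis (i, j) k‖ ≤ M := by
        have hM : 0 ≤ M := (abs_nonneg _).trans (H.bound_ψ i Z)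
        by_cases hi : i ∈ s
        · rw [Finset.sum_eq_single i]
          · simpa [designBasis, norm_smul] using H.bound_ψ i Z
          · intro k _ hk; simp [designBasis, hk]
          · exact fun h => absurd hi h
        · rw [Finset.sum_eq_zero]
          · simpa using hM
          · intro k hk
            have : k ≠ i := fun e => hi (e ▸ hk)
            simp [designBasis, this]
      exact pow_le_pow_left₀ (norm_nonneg _) this 2
    rw [e1]
    gcongr
  refine (Finset.sum_le_sum fun a _ => h1 a).trans (le_of_eq ?_)
  rw [← Finset.sum_div, Fintype.sum_prod_type, EuclideanSpace.real_norm_sq_eq]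
  simp only [Finset.sum_add_distrib, Finset.sum_const, Finset.card_univ, Fintype.card_fin,
    nsmul_eq_mul]
  field_simp

theorem designBasis_sum_apply (c : Fin n × Fin p → ℝ) (i : Fin n) (j : Fin p) :
    (∑ a, c a • designBasis a : Design n p) i j = c (i, j) := by
  rw [← designCoord_apply (i, j), map_sum]
  simp only [map_smul, (isGaussWeight_design n p).dual, smul_eq_mul]
  simp

theorem sum_norm_sq_designBasis_sum (c : Fin n × Fin p → ℝ) :
    ∑ i, ‖(∑ a, c a • designBasis a : Design n p) i‖ ^ 2 = ∑ a, c a ^ 2 := by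
  rw [Fintype.sum_prod_type (fun a : Fin n × Fin p => c a ^ 2)]
  refine Finset.sum_congr rfl fun i _ => ?_
  rw [EuclideanSpace.real_norm_sq_eq]
  exact Finset.sum_congr rfl fun j _ => by rw [designBasis_sum_apply]

/-- An operator-norm bound for the gradient, by duality. Compared with the Hilbert-Schmidt bound it
gains a factor `1/n`, which is needed for `w = z_i`, whose squared norm is of order `n`. -/
theorem Contractive.sum_inner_partial_sq_le (H : Contractive μ M s h ψ) (hn : 0 < n) (hμ : 0 < μ)
    {Z : Design n p} (hh : DifferentiableAt ℝ h Z) (hψ : ∀ i, DifferentiableAt ℝ (ψ i) Z)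
    (w : Vec p) :
    ∑ a : Fin n × Fin p, inner ℝ w (fderiv ℝ h Z (designBasis a)) ^ 2
      ≤ (M ^ 2 / μ + ‖h Z‖ ^ 2) / (n * μ) * ‖w‖ ^ 2 := by
  have hn' : (0 : ℝ) < n := Nat.cast_pos.2 hn
  set c : Fin n × Fin p → ℝ := fun a => inner ℝ w (fderiv ℝ h Z (designBasis a)) with hc
  -- The extremal direction: the sum `Q` to be bounded equals `⟨w, ∂_V h⟩` and also the squared
  -- length of `V`, so a bound on `∂_V h` that is linear in the length of `V` closes on itself.
  set V : Design n p := ∑ a, c a • designBasis a with hV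
  set Q := ∑ a, c a ^ 2 with hQ
  have hQ0 : 0 ≤ Q := Finset.sum_nonneg fun _ _ => sq_nonneg _
  have hVQ : ∑ i, ‖V i‖ ^ 2 = Q := sum_norm_sq_designBasis_sum c
  have e1 : Q = inner ℝ w (fderiv ℝ h Z V) := by
    rw [hV, map_sum, inner_sum]
    refine Finset.sum_congr rfl fun a _ => ?_
    rw [map_smul, real_inner_smul_right, sq]
  have h1 := H.norm_deriv_sq_le hn hμ (hh.hasFDerivAt.hasLineDerivAt V)
      (fun k => (hψ k).hasFDerivAt.hasLineDerivAt V)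
  have h2 : ‖fderiv ℝ h Z V‖ ^ 2 ≤ (M ^ 2 / μ + ‖h Z‖ ^ 2) / (n * μ) * Q := by
    refine h1.trans ?_
    have i1 : ‖∑ i ∈ s, ψ i Z • V i‖ ^ 2 ≤ n * M ^ 2 * Q := by
      refine (sum_norm_sq_smul_le s _ V).trans ?_
      rw [hVQ]
      gcongr
      calc ∑ i, ψ i Z ^ 2 ≤ ∑ _i : Fin n, M ^ 2 := Finset.sum_le_sum fun i _ =>
            sq_le_sq' (by linarith [(abs_le.1 (H.bound_ψ i Z)).1]) (abs_le.1 (H.bound_ψ i Z)).2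
        _ = n * M ^ 2 := by simp
    have i2 : ∑ i, inner ℝ (V i) (h Z) ^ 2 ≤ ‖h Z‖ ^ 2 * Q := by
      rw [← hVQ, Finset.mul_sum]
      refine Finset.sum_le_sum fun i _ => ?_
      rw [mul_comm, ← mul_pow, ← sq_abs]
      exact pow_le_pow_left₀ (abs_nonneg _) (abs_real_inner_le_norm _ _) 2
    calc (‖∑ i ∈ s, ψ i Z • V i‖ ^ 2 / (n * μ) + ∑ i, inner ℝ (V i) (h Z) ^ 2) / (n * μ)
        ≤ (n * M ^ 2 * Q / (n * μ) + ‖h Z‖ ^ 2 * Q) / (n * μ) := by gcongr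
      _ = _ := by field_simp
  have h3 : Q ^ 2 ≤ (M ^ 2 / μ + ‖h Z‖ ^ 2) / (n * μ) * ‖w‖ ^ 2 * Q := by
    calc Q ^ 2 = inner ℝ w (fderiv ℝ h Z V) ^ 2 := by rw [← e1]
      _ ≤ (‖w‖ * ‖fderiv ℝ h Z V‖) ^ 2 := by
          rw [← sq_abs]
          exact pow_le_pow_left₀ (abs_nonneg _) (abs_real_inner_le_norm _ _) 2
      _ = ‖w‖ ^ 2 * ‖fderiv ℝ h Z V‖ ^ 2 := mul_pow _ _ _
      _ ≤ ‖w‖ ^ 2 * ((M ^ 2 / μ + ‖h Z‖ ^ 2) / (n * μ) * Q) := by gcongr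
      _ = _ := by ring
  rcases hQ0.eq_or_lt with h0 | h0
  · rw [← h0]; positivity
  · refine le_of_mul_le_mul_right ?_ h0
    linarith [sq Q]

/-- The contraction inequality for two designs that differ in row `i` only, followed by Young's
inequality. -/
theorem Contractive.norm_sub_dropRow_sq_le (H : Contractive μ M Finset.univ h ψ) (hn : 0 < n)
    (hμ : 0 < μ) (Z : Design n p) (i : Fin n) :
    ‖h Z - h (dropRow i Z)‖ ^ 2
      ≤ (M / (n * μ)) ^ 2 * ‖Z i‖ ^ 2 + inner ℝ (Z i) (h Z) ^ 2 / (n * μ) := by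
  have hn' : (0 : ℝ) < n := Nat.cast_pos.2 hn
  have ha : 0 < n * μ := by positivity
  have h1 := H.contraction Z (dropRow i Z)
  have e : ∀ k, Z k - dropRow i Z k = if k = i then Z i else 0 := fun k => by
    rw [dropRow_apply]
    split_ifs with hk
    · rw [hk, sub_zero]
    · rw [sub_self]
  have e' : ∑ k, (ψ k Z * inner ℝ (Z k - dropRow i Z k) (h Z - h (dropRow i Z))
      - (ψ k Z - ψ k (dropRow i Z)) * inner ℝ (Z k - dropRow i Z k) (h Z))
      = ψ i Z * inner ℝ (Z i) (h Z - h (dropRow i Z))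
      - (ψ i Z - ψ i (dropRow i Z)) * inner ℝ (Z i) (h Z) := by
    rw [Finset.sum_eq_single i (by intro k _ hk; simp [e, hk]) (by simp)]
    rw [e, if_pos rfl]
  rw [e'] at h1
  have h2 : ψ i Z * inner ℝ (Z i) (h Z - h (dropRow i Z))
      ≤ n * μ / 2 * ‖h Z - h (dropRow i Z)‖ ^ 2 + (M * ‖Z i‖) ^ 2 / (2 * (n * μ)) := by
    refine le_trans ?_ (mul_le_half_sq ha)
    refine (le_abs_self _).trans ?_
    rw [abs_mul, mul_assoc]
    exact mul_le_mul (H.bound_ψ i Z) (abs_real_inner_le_norm _ _) (abs_nonneg _)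
      ((abs_nonneg _).trans (H.bound_ψ i Z))
  have h3 : (ψ i Z - ψ i (dropRow i Z)) ^ 2 ≤ ∑ k, (ψ k Z - ψ k (dropRow i Z)) ^ 2 :=
    Finset.single_le_sum (f := fun k => (ψ k Z - ψ k (dropRow i Z)) ^ 2)
      (fun _ _ => sq_nonneg _) (Finset.mem_univ i)
  have h4 : n * μ * ‖h Z - h (dropRow i Z)‖ ^ 2
      ≤ (M * ‖Z i‖) ^ 2 / (n * μ) + inner ℝ (Z i) (h Z) ^ 2 := by
    have h5 : (M * ‖Z i‖) ^ 2 / (2 * (n * μ)) = (M * ‖Z i‖) ^ 2 / (n * μ) / 2 := by field_simp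
    nlinarith [sq_nonneg (2 * (ψ i Z - ψ i (dropRow i Z)) + inner ℝ (Z i) (h Z)),
      sq_nonneg (inner ℝ (Z i) (h Z))]
  have h5 : (M / (n * μ)) ^ 2 * ‖Z i‖ ^ 2 + inner ℝ (Z i) (h Z) ^ 2 / (n * μ)
      = ((M * ‖Z i‖) ^ 2 / (n * μ) + inner ℝ (Z i) (h Z) ^ 2) / (n * μ) := by
    field_simp
  rw [h5, le_div_iff₀ ha]
  linarith

/-- Summing the row-wise bounds, the operator norm controls `∑ ⟨z_i, h⟩²` by `K n ‖h‖²`, which the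
denominator `n μ` compensates: the total leave-one-out perturbation is bounded. -/
theorem Contractive.sum_norm_sub_dropRow_sq_le (H : Contractive μ M Finset.univ h ψ) (hn : 0 < n)
    (hμ : 0 < μ) {Z : Design n p} {K : ℝ} (hK : 0 ≤ K) (hZ : OpBound Z (K * n)) :
    ∑ i, ‖h Z - h (dropRow i Z)‖ ^ 2 ≤ (M / μ) ^ 2 * K + K * ‖h Z‖ ^ 2 / μ := by
  have hn' : (0 : ℝ) < n := Nat.cast_pos.2 hn
  calc ∑ i, ‖h Z - h (dropRow i Z)‖ ^ 2
      ≤ ∑ i, ((M / (n * μ)) ^ 2 * (K * n) + inner ℝ (Z i) (h Z) ^ 2 / (n * μ)) := by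
        refine Finset.sum_le_sum fun i _ => (H.norm_sub_dropRow_sq_le hn hμ Z i).trans ?_
        have := hZ.norm_row_sq_le (by positivity) i
        gcongr
    _ = (M / μ) ^ 2 * K + (∑ i, inner ℝ (Z i) (h Z) ^ 2) / (n * μ) := by
        rw [Finset.sum_add_distrib, ← Finset.sum_div]
        simp only [Finset.sum_const, Finset.card_univ, Fintype.card_fin, nsmul_eq_mul]
        congr 1
        field_simp
    _ ≤ (M / μ) ^ 2 * K + (K * n * ‖h Z‖ ^ 2) / (n * μ) := by
        gcongr; exact hZ _
    _ = _ := by field_simp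

end Contractive

/-! ### Second moments of the three divergences. -/

section Fields

variable {n p : ℕ}

/-- Lipschitz cutoff functions on the space of designs, supported in an operator norm ball. -/
structure IsCutoff (χ : Design n p → ℝ) (K : ℝ) : Prop where
  lip : LipCompact χ
  nonneg : ∀ Z, 0 ≤ χ Z
  le_one : ∀ Z, χ Z ≤ 1
  opBound : ∀ Z ∈ tsupport χ, OpBound Z (K * n)
  grad : ∀ Z, DifferentiableAt ℝ χ Z → ∑ a, fderiv ℝ χ Z (designBasis a) ^ 2 ≤ 1

/-- The Stein energy `‖F‖ ^ 2 + ‖∇F‖ ^ 2` of a vector field. -/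
def steinEnergy {α : Type*} [Fintype α] (φ : α → Fin n × Fin p) (F : α → Design n p → ℝ)
    (Z : Design n p) : ℝ :=
  ∑ a, F a Z ^ 2 + ∑ a, ∑ b, lineDeriv ℝ (F a) Z (designBasis (φ b)) ^ 2

theorem steinEnergy_cutoff_le {α : Type*} [Fintype α] {φ : α → Fin n × Fin p}
    (hφ : Function.Injective φ) {χ : Design n p → ℝ} {K : ℝ} (hχ : IsCutoff χ K)
    {f : α → Design n p → ℝ} {Z : Design n p} (hdχ : DifferentiableAt ℝ χ Z)
    (hf : ∀ a, DifferentiableAt ℝ (f a) Z) {B : ℝ} (hB0 : 0 ≤ B)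
    (hB : OpBound Z (K * n) → 3 * ∑ a, f a Z ^ 2
      + 2 * ∑ a, ∑ b, fderiv ℝ (f a) Z (designBasis (φ b)) ^ 2 ≤ B) :
    steinEnergy φ (fun a Z => χ Z * f a Z) Z ≤ B := by
  by_cases hZ : Z ∈ tsupport χ
  · refine le_trans ?_ (hB (hχ.opBound Z hZ))
    have hl : ∀ a b, lineDeriv ℝ (fun Z => χ Z * f a Z) Z (designBasis (φ b))
        = fderiv ℝ χ Z (designBasis (φ b)) * f a Z
          + χ Z * fderiv ℝ (f a) Z (designBasis (φ b)) := fun a b =>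
      (HasLineDerivAt.real_mul (hdχ.hasFDerivAt.hasLineDerivAt _)
        ((hf a).hasFDerivAt.hasLineDerivAt _)).lineDeriv
    have h0 := hχ.nonneg Z
    have h1 := hχ.le_one Z
    have hsq : χ Z ^ 2 ≤ 1 := pow_le_one₀ h0 h1
    have hg : ∑ b, fderiv ℝ χ Z (designBasis (φ b)) ^ 2 ≤ 1 := by
      refine le_trans ?_ (hχ.grad Z hdχ)
      refine (Finset.sum_map Finset.univ ⟨φ, hφ⟩
        (fun a => fderiv ℝ χ Z (designBasis a) ^ 2)).symm.le.trans ?_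
      exact Finset.sum_le_sum_of_subset_of_nonneg (Finset.subset_univ _) fun _ _ _ => sq_nonneg _
    unfold steinEnergy
    have i1 : ∑ a, (χ Z * f a Z) ^ 2 ≤ ∑ a, f a Z ^ 2 := by
      refine Finset.sum_le_sum fun a _ => ?_
      rw [mul_pow]
      exact mul_le_of_le_one_left (sq_nonneg _) hsq
    have i2 : ∑ a, ∑ b, lineDeriv ℝ (fun Z => χ Z * f a Z) Z (designBasis (φ b)) ^ 2
        ≤ 2 * ∑ a, f a Z ^ 2 + 2 * ∑ a, ∑ b, fderiv ℝ (f a) Z (designBasis (φ b)) ^ 2 := by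
      rw [Finset.mul_sum, Finset.mul_sum, ← Finset.sum_add_distrib]
      refine Finset.sum_le_sum fun a _ => ?_
      have i3 : ∀ b, lineDeriv ℝ (fun Z => χ Z * f a Z) Z (designBasis (φ b)) ^ 2
          ≤ 2 * f a Z ^ 2 * fderiv ℝ χ Z (designBasis (φ b)) ^ 2
            + 2 * fderiv ℝ (f a) Z (designBasis (φ b)) ^ 2 := fun b => by
        rw [hl]
        have i4 : χ Z ^ 2 * fderiv ℝ (f a) Z (designBasis (φ b)) ^ 2
          ≤ fderiv ℝ (f a) Z (designBasis (φ b)) ^ 2 := mul_le_of_le_one_left (sq_nonneg _) hsq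
        nlinarith [sq_nonneg (fderiv ℝ χ Z (designBasis (φ b)) * f a Z
          - χ Z * fderiv ℝ (f a) Z (designBasis (φ b)))]
      refine (Finset.sum_le_sum fun b _ => i3 b).trans ?_
      rw [Finset.sum_add_distrib, ← Finset.mul_sum, ← Finset.mul_sum]
      have : 2 * f a Z ^ 2 * ∑ b, fderiv ℝ χ Z (designBasis (φ b)) ^ 2 ≤ 2 * f a Z ^ 2 * 1 :=
        mul_le_mul_of_nonneg_left hg (by positivity)
      linarith
    linarith
  · have hev : ∀ a, (fun Z => χ Z * f a Z) =ᶠ[𝓝 Z] fun _ => 0 := fun a => by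
      filter_upwards [(isClosed_tsupport χ).isOpen_compl.mem_nhds hZ] with W hW
      rw [image_eq_zero_of_notMem_tsupport hW, zero_mul]
    have : steinEnergy φ (fun a Z => χ Z * f a Z) Z = 0 := by
      unfold steinEnergy
      have h1 : ∀ a, χ Z * f a Z = 0 := fun a => (hev a).self_of_nhds
      have h2 : ∀ a b, lineDeriv ℝ (fun Z => χ Z * f a Z) Z (designBasis (φ b)) = 0 :=
        fun a b => by rw [(hev a).lineDeriv_eq]; simp [lineDeriv]
      simp [h1, h2]
    rw [this]; exact hB0

variable {μ M K H₀ γ : ℝ} {h : Design n p → Vec p} {ψ : Fin n → Design n p → ℝ}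
  {χ : Design n p → ℝ}

/-- The divergence-type quantity of the field `χ ε_i h_j`. -/
def noiseDiv (χ : Design n p → ℝ) (h : Design n p → Vec p) (ε : Vec n) (Z : Design n p) : ℝ :=
  ∑ a, adjDeriv (fun a : Fin n × Fin p => designBasis (id a)) (fun a => designCoord (id a)) a
    (fun Z => χ Z * (ε a.1 * h Z a.2)) Z

/-- The divergence-type quantity of the field `χ (h_j - h_j^{(-i)})` in the `i`-th row. -/
def looDiv (χ : Design n p → ℝ) (h : Design n p → Vec p) (i : Fin n) (Z : Design n p) : ℝ :=
  ∑ j, adjDeriv (fun j : Fin p => designBasis (i, j)) (fun j => designCoord (i, j)) j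
    (fun Z => χ Z * (h Z j - h (dropRow i Z) j)) Z

/-- The divergence-type quantity of the field `χ h_j^{(-i)} ⟨z_i, h^{(-i)}⟩`. -/
def sqDiv (χ : Design n p → ℝ) (h : Design n p → Vec p) (Z : Design n p) : ℝ :=
  ∑ a, adjDeriv (fun a : Fin n × Fin p => designBasis (id a)) (fun a => designCoord (id a)) a
    (fun Z => χ Z * (h (dropRow a.1 Z) a.2 * inner ℝ (Z a.1) (h (dropRow a.1 Z)))) Z

theorem locallyLipschitz_coord {X : Type*} [PseudoEMetricSpace X] {f : X → Vec p}
    (hf : LocallyLipschitz f) (j : Fin p) : LocallyLipschitz fun x => f x j :=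
  (EuclideanSpace.proj (𝕜 := ℝ) (ι := Fin p) j).lipschitz.locallyLipschitz.comp hf

theorem locallyLipschitz_inner_row {f : Design n p → Vec p}
    (hf : LocallyLipschitz f) (i : Fin n) : LocallyLipschitz fun Z => inner ℝ (Z i) (f Z) := by
  have e : (fun Z : Design n p => inner ℝ (Z i) (f Z)) = fun Z => ∑ j, Z i j * f Z j := by
    ext Z
    simp [PiLp.inner_apply, mul_comm]
  rw [e]
  exact LocallyLipschitz.real_sum _ fun j => LocallyLipschitz.real_mul
    (locallyLipschitz_coord (LipschitzWith.eval i).locallyLipschitz j) (locallyLipschitz_coord hf j)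

theorem hasFDerivAt_coord {f : Design n p → Vec p} {Z : Design n p}
    (hf : DifferentiableAt ℝ f Z) (j : Fin p) :
    HasFDerivAt (fun Z => f Z j) ((EuclideanSpace.proj (𝕜 := ℝ) j).comp (fderiv ℝ f Z)) Z :=
  (EuclideanSpace.proj (𝕜 := ℝ) (ι := Fin p) j).hasFDerivAt.comp Z hf.hasFDerivAt

theorem fderiv_coord {f : Design n p → Vec p} {Z : Design n p}
    (hf : DifferentiableAt ℝ f Z) (j : Fin p) (V : Design n p) :
    fderiv ℝ (fun Z => f Z j) Z V = fderiv ℝ f Z V j := by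
  rw [(hasFDerivAt_coord hf j).fderiv]; rfl

theorem sum_sq_prod (ε : Vec n) (v : Vec p) :
    ∑ a : Fin n × Fin p, (ε a.1 * v a.2) ^ 2 = ‖ε‖ ^ 2 * ‖v‖ ^ 2 := by
  rw [Fintype.sum_prod_type (fun a : Fin n × Fin p => (ε a.1 * v a.2) ^ 2),
    EuclideanSpace.real_norm_sq_eq, EuclideanSpace.real_norm_sq_eq, Finset.sum_mul_sum]
  simp only [mul_pow]

theorem lintegral_le_of_ae_volume_le {f : Design n p → ℝ} {B : ℝ} (hf : ∀ᵐ Z, f Z ≤ B) :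
    ∫⁻ Z, ENNReal.ofReal (f Z) ∂(designGaussian n p) ≤ ENNReal.ofReal B := by
  calc ∫⁻ Z, ENNReal.ofReal (f Z) ∂(designGaussian n p)
      ≤ ∫⁻ _, ENNReal.ofReal B ∂(designGaussian n p) := by
        refine lintegral_mono_ae ?_
        filter_upwards [(designGaussian_absolutelyContinuous n p).ae_le hf] with Z hZ
        exact ENNReal.ofReal_le_ofReal hZ
    _ = ENNReal.ofReal B := by simp

/-- Common assumptions for the moment bounds. -/
structure FieldSetup (μ M K H₀ γ : ℝ) (h : Design n p → Vec p) (ψ : Fin n → Design n p → ℝ)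
    (χ : Design n p → ℝ) : Prop where
  n_pos : 0 < n
  μ_pos : 0 < μ
  K_nonneg : 0 ≤ K
  H_nonneg : 0 ≤ H₀
  γ_nonneg : 0 ≤ γ
  dim_le : (p : ℝ) / n ≤ γ
  contractive : Contractive μ M Finset.univ h ψ
  cutoff : IsCutoff χ K
  bound_h : ∀ Z, OpBound Z (K * n) → ‖h Z‖ ≤ H₀

/-- A bound for `‖∇h‖ ^ 2`. -/
def gradConst (μ M H₀ γ : ℝ) : ℝ := γ * (M / μ) ^ 2 + H₀ ^ 2 / μ

/-- A bound for the sum of the squared leave-one-out differences. -/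
def looConst (μ M K H₀ : ℝ) : ℝ := (M / μ) ^ 2 * K + K * H₀ ^ 2 / μ

/-- A bound for `n` times the squared operator norm of `∇h`. -/
def rowConst (μ M H₀ : ℝ) : ℝ := (M ^ 2 / μ + H₀ ^ 2) / μ

theorem dropRow_add_smul_designBasis (Z : Design n p) (i : Fin n) (j : Fin p) (t : ℝ) :
    dropRow i (Z + t • designBasis (i, j)) = dropRow i Z := by
  ext k l
  rw [dropRow_apply, dropRow_apply]
  split_ifs with hk
  · rfl
  · simp [designBasis, hk]

theorem fderiv_comp_dropRow_eq_zero {Z : Design n p} {i : Fin n}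
    (hd : DifferentiableAt ℝ (fun Z => h (dropRow i Z)) Z) (j : Fin p) :
    fderiv ℝ (fun Z => h (dropRow i Z)) Z (designBasis (i, j)) = 0 := by
  rw [← hd.lineDeriv_eq_fderiv]
  simp [lineDeriv, dropRow_add_smul_designBasis]

namespace FieldSetup

variable (T : FieldSetup μ M K H₀ γ h ψ χ)
include T

theorem gradConst_nonneg : 0 ≤ gradConst μ M H₀ γ := by
  have := T.μ_pos; have := T.γ_nonneg
  unfold gradConst; positivity

theorem looConst_nonneg : 0 ≤ looConst μ M K H₀ := by
  have := T.μ_pos; have := T.K_nonneg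
  unfold looConst; positivity

theorem rowConst_nonneg : 0 ≤ rowConst μ M H₀ := by
  have := T.μ_pos
  unfold rowConst; positivity

theorem ae_differentiable : ∀ᵐ Z : Design n p, DifferentiableAt ℝ χ Z ∧ DifferentiableAt ℝ h Z
    ∧ (∀ k, DifferentiableAt ℝ (ψ k) Z)
    ∧ (∀ i, DifferentiableAt ℝ (fun Z => h (dropRow i Z)) Z)
    ∧ ∀ i k, DifferentiableAt ℝ (fun Z => ψ k (dropRow i Z)) Z := by
  have H := T.contractive
  have h1 := T.cutoff.lip.ae_differentiableAt (μ := (volume : Measure (Design n p)))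
  have h2 := LocallyLipschitz.ae_differentiableAt (ν := (volume : Measure (Design n p))) H.lip_h
  have h3 := ae_all_iff.2 fun k =>
    LocallyLipschitz.ae_differentiableAt (ν := (volume : Measure (Design n p))) (H.lip_ψ k)
  have h4 := ae_all_iff.2 fun i => LocallyLipschitz.ae_differentiableAt
    (ν := (volume : Measure (Design n p))) (H.comp_dropRow i).lip_h
  have h5 := ae_all_iff.2 fun i => ae_all_iff.2 fun k => LocallyLipschitz.ae_differentiableAt
    (ν := (volume : Measure (Design n p))) ((H.comp_dropRow i).lip_ψ k)
  filter_upwards [h1, h2, h3, h4, h5] with Z g1 g2 g3 g4 g5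
  exact ⟨g1, g2, g3, g4, g5⟩

theorem sum_grad_le {s : Finset (Fin n)} {h' : Design n p → Vec p} {ψ' : Fin n → Design n p → ℝ}
    (H : Contractive μ M s h' ψ') {Z : Design n p} (hd : DifferentiableAt ℝ h' Z)
    (hψ : ∀ k, DifferentiableAt ℝ (ψ' k) Z) (hb : ‖h' Z‖ ≤ H₀) :
    ∑ a : Fin n × Fin p, ‖fderiv ℝ h' Z (designBasis a)‖ ^ 2 ≤ gradConst μ M H₀ γ := by
  refine (H.sum_norm_partial_sq_le T.n_pos T.μ_pos hd hψ).trans ?_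
  have := T.μ_pos
  have := T.dim_le
  unfold gradConst
  gcongr

theorem sum_inner_grad_le {s : Finset (Fin n)} {h' : Design n p → Vec p}
    {ψ' : Fin n → Design n p → ℝ}
    (H : Contractive μ M s h' ψ') {Z : Design n p} (hd : DifferentiableAt ℝ h' Z)
    (hψ : ∀ k, DifferentiableAt ℝ (ψ' k) Z) (hb : ‖h' Z‖ ≤ H₀) (w : Vec p) :
    ∑ a : Fin n × Fin p, inner ℝ w (fderiv ℝ h' Z (designBasis a)) ^ 2
      ≤ rowConst μ M H₀ / n * ‖w‖ ^ 2 := by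
  refine (H.sum_inner_partial_sq_le T.n_pos T.μ_pos hd hψ w).trans ?_
  have := T.μ_pos
  have hn' : (0 : ℝ) < n := Nat.cast_pos.2 T.n_pos
  calc (M ^ 2 / μ + ‖h' Z‖ ^ 2) / (n * μ) * ‖w‖ ^ 2
      ≤ (M ^ 2 / μ + H₀ ^ 2) / (n * μ) * ‖w‖ ^ 2 := by gcongr
    _ = _ := by unfold rowConst; field_simp

theorem sum_loo_le {Z : Design n p} (hZ : OpBound Z (K * n)) :
    ∑ i, ‖h Z - h (dropRow i Z)‖ ^ 2 ≤ looConst μ M K H₀ := by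
  refine (T.contractive.sum_norm_sub_dropRow_sq_le T.n_pos T.μ_pos T.K_nonneg hZ).trans ?_
  have := T.μ_pos
  have := T.K_nonneg
  have := T.bound_h Z hZ
  unfold looConst
  gcongr

theorem bound_dropRow {Z : Design n p} (hZ : OpBound Z (K * n)) (i : Fin n) :
    ‖h (dropRow i Z)‖ ≤ H₀ := T.bound_h _ (hZ.dropRow i)

/-- `⟨z_i, h^(-i)⟩` is replaced by `⟨z_i, h⟩`, whose squares sum to at most `K n ‖h‖²`; the error is
at most `‖z_i‖² ≤ K n` times a summable leave-one-out difference. -/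
theorem sum_inner_loo_sq_le {Z : Design n p} (hZ : OpBound Z (K * n)) :
    ∑ i, inner ℝ (Z i) (h (dropRow i Z)) ^ 2 ≤ 2 * K * (H₀ ^ 2 + looConst μ M K H₀) * n := by
  have hn' : (0 : ℝ) < n := Nat.cast_pos.2 T.n_pos
  have hK := T.K_nonneg
  have hKn : 0 ≤ K * n := by positivity
  calc ∑ i, inner ℝ (Z i) (h (dropRow i Z)) ^ 2
      ≤ ∑ i, (2 * inner ℝ (Z i) (h Z) ^ 2 + 2 * (K * n) * ‖h Z - h (dropRow i Z)‖ ^ 2) := by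
        refine Finset.sum_le_sum fun i _ => ?_
        have e : inner ℝ (Z i) (h (dropRow i Z))
          = inner ℝ (Z i) (h Z) - inner ℝ (Z i) (h Z - h (dropRow i Z)) := by
          rw [inner_sub_right]; ring
        have h1 : inner ℝ (Z i) (h Z - h (dropRow i Z)) ^ 2
            ≤ K * n * ‖h Z - h (dropRow i Z)‖ ^ 2 := by
          calc _ ≤ (‖Z i‖ * ‖h Z - h (dropRow i Z)‖) ^ 2 := by
                rw [← sq_abs]
                exact pow_le_pow_left₀ (abs_nonneg _) (abs_real_inner_le_norm _ _) 2
            _ ≤ _ := by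
                rw [mul_pow]
                exact mul_le_mul_of_nonneg_right (hZ.norm_row_sq_le hKn i) (sq_nonneg _)
        rw [e]
        nlinarith [sq_nonneg (inner ℝ (Z i) (h Z) + inner ℝ (Z i) (h Z - h (dropRow i Z)))]
    _ ≤ 2 * (K * n * H₀ ^ 2) + 2 * (K * n) * looConst μ M K H₀ := by
        rw [Finset.sum_add_distrib, ← Finset.mul_sum, ← Finset.mul_sum]
        have h1 := hZ (h Z)
        have h2 : K * n * ‖h Z‖ ^ 2 ≤ K * n * H₀ ^ 2 := by
          have := T.bound_h Z hZ
          gcongr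
        have h3 := mul_le_mul_of_nonneg_left (T.sum_loo_le hZ) (by positivity : 0 ≤ 2 * (K * n))
        linarith
    _ = _ := by ring

/-- For fixed noise the energy of the field `ε_i h_j` factorizes into `‖ε‖²` times that of `h`. -/
theorem lintegral_noiseDiv_le (ε : Vec n) :
    ∫⁻ Z, ENNReal.ofReal (noiseDiv χ h ε Z ^ 2) ∂(designGaussian n p)
      ≤ ENNReal.ofReal (‖ε‖ ^ 2 * (3 * H₀ ^ 2 + 2 * gradConst μ M H₀ γ)) := by
  have hg := T.gradConst_nonneg
  refine (lintegral_sum_adjDeriv_sq_le Function.injective_id fun a => ?_).trans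
    (lintegral_le_of_ae_volume_le ?_)
  · exact T.cutoff.lip.mul_right (LocallyLipschitz.real_mul (LocallyLipschitz.const _)
      (locallyLipschitz_coord T.contractive.lip_h _))
  · filter_upwards [T.ae_differentiable] with Z hZ
    obtain ⟨d1, d2, d3, -, -⟩ := hZ
    refine steinEnergy_cutoff_le Function.injective_id T.cutoff d1
      (f := fun a Z => ε a.1 * h Z a.2) (fun a => ?_) (by positivity) fun hop => ?_
    · exact ((hasFDerivAt_coord d2 a.2).differentiableAt).const_mul _
    · have hb := T.bound_h Z hop
      rw [sum_sq_prod]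
      have e : ∀ a b : Fin n × Fin p, fderiv ℝ (fun Z => ε a.1 * h Z a.2) Z (designBasis (id b))
          = ε a.1 * fderiv ℝ h Z (designBasis b) a.2 := fun a b => by
        rw [fderiv_const_mul (hasFDerivAt_coord d2 a.2).differentiableAt,
          _root_.smul_apply, fderiv_coord d2, smul_eq_mul, id]
      simp only [e]
      rw [Finset.sum_comm]
      simp only [sum_sq_prod]
      rw [← Finset.mul_sum]
      have h1 := T.sum_grad_le T.contractive d2 d3 hb
      have h2 : ‖h Z‖ ^ 2 ≤ H₀ ^ 2 := pow_le_pow_left₀ (norm_nonneg _) hb 2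
      have h3 := mul_le_mul_of_nonneg_left h1 (sq_nonneg ‖ε‖)
      have h4 := mul_le_mul_of_nonneg_left h2 (sq_nonneg ‖ε‖)
      linarith

/-- The Stein inequality is applied in each row separately, where `h^(-i)` is constant and drops out
of the gradient. The row gradients add up to the full gradient of `h`, so no factor `n` is lost in
the sum over rows. -/
theorem lintegral_looDiv_le :
    ∫⁻ Z, ∑ i, ENNReal.ofReal (looDiv χ h i Z ^ 2) ∂(designGaussian n p)
      ≤ ENNReal.ofReal (3 * looConst μ M K H₀ + 2 * gradConst μ M H₀ γ) := by
  classical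
  have hg := T.gradConst_nonneg
  have hl := T.looConst_nonneg
  have hinj : ∀ i : Fin n, Function.Injective fun j : Fin p => (i, j) := fun i j j' h => by
    simpa using h
  have hlip : ∀ i j, LipCompact fun Z => χ Z * (h Z j - h (dropRow i Z) j) := fun i j =>
    T.cutoff.lip.mul_right (LocallyLipschitz.real_sub
      (locallyLipschitz_coord T.contractive.lip_h _)
      (locallyLipschitz_coord (T.contractive.comp_dropRow i).lip_h _))
  have hm : ∀ i, Measurable fun Z => ENNReal.ofReal (looDiv χ h i Z ^ 2) := fun i => by
    refine ((Finset.measurable_sum _ fun a _ => ?_).pow_const 2).ennreal_ofReal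
    exact ((designCoord _).continuous.measurable.mul (hlip i a).continuous.measurable).sub
      (measurable_lineDeriv (hlip i a).continuous)
  rw [lintegral_finsetSum _ fun i _ => hm i]
  set E : Fin n → Design n p → ℝ := fun i => steinEnergy (fun j : Fin p => (i, j))
    (fun j Z => χ Z * (h Z j - h (dropRow i Z) j)) with hE
  have hE0 : ∀ i Z, 0 ≤ E i Z := fun i Z => add_nonneg (Finset.sum_nonneg fun _ _ => sq_nonneg _)
    (Finset.sum_nonneg fun _ _ => Finset.sum_nonneg fun _ _ => sq_nonneg _)
  have hmE : ∀ i, Measurable fun Z => ENNReal.ofReal (E i Z) := fun i => by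
    refine ((Finset.measurable_sum _ fun a _ => ?_).add (Finset.measurable_sum _ fun a _ =>
      Finset.measurable_sum _ fun b _ => ?_)).ennreal_ofReal
    · exact (hlip i a).continuous.measurable.pow_const 2
    · exact (measurable_lineDeriv (hlip i a).continuous).pow_const 2
  calc ∑ i, ∫⁻ Z, ENNReal.ofReal (looDiv χ h i Z ^ 2) ∂(designGaussian n p)
      ≤ ∑ i, ∫⁻ Z, ENNReal.ofReal (E i Z) ∂(designGaussian n p) :=
        Finset.sum_le_sum fun i _ => lintegral_sum_adjDeriv_sq_le (hinj i) (hlip i)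
    _ = ∫⁻ Z, ENNReal.ofReal (∑ i, E i Z) ∂(designGaussian n p) := by
        rw [← lintegral_finsetSum _ fun i _ => hmE i]
        refine lintegral_congr fun Z => ?_
        rw [ENNReal.ofReal_sum_of_nonneg fun i _ => hE0 i Z]
    _ ≤ _ := by
        refine lintegral_le_of_ae_volume_le ?_
        filter_upwards [T.ae_differentiable] with Z hZ
        obtain ⟨d1, d2, d3, d4, d5⟩ := hZ
        have hpt : ∀ i, E i Z ≤ if OpBound Z (K * n) then 3 * ‖h Z - h (dropRow i Z)‖ ^ 2
            + 2 * ∑ j, ‖fderiv ℝ h Z (designBasis (i, j))‖ ^ 2 else 0 := fun i => by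
          have hdj : ∀ j, DifferentiableAt ℝ (fun Z => h Z j - h (dropRow i Z) j) Z := fun j =>
            (hasFDerivAt_coord d2 j).differentiableAt.sub
              (hasFDerivAt_coord (d4 i) j).differentiableAt
          refine steinEnergy_cutoff_le (hinj i) T.cutoff d1
            (f := fun j Z => h Z j - h (dropRow i Z) j) hdj ?_ fun hop => ?_
          · split_ifs
            · positivity
            · exact le_rfl
          · rw [if_pos hop, EuclideanSpace.real_norm_sq_eq]
            refine le_of_eq ?_
            congr 2
            rw [Finset.sum_comm]
            refine Finset.sum_congr rfl fun l _ => ?_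
            rw [EuclideanSpace.real_norm_sq_eq]
            refine Finset.sum_congr rfl fun j _ => ?_
            rw [fderiv_fun_sub (hasFDerivAt_coord d2 j).differentiableAt
              (hasFDerivAt_coord (d4 i) j).differentiableAt, _root_.sub_apply,
              fderiv_coord d2, fderiv_coord (d4 i), fderiv_comp_dropRow_eq_zero (d4 i)]
            simp
        refine (Finset.sum_le_sum fun i _ => hpt i).trans ?_
        by_cases hop : OpBound Z (K * n)
        · simp only [if_pos hop]
          rw [Finset.sum_add_distrib, ← Finset.mul_sum, ← Finset.mul_sum]
          have h1 := T.sum_loo_le hop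
          have h2 := T.sum_grad_le T.contractive d2 d3 (T.bound_h Z hop)
          rw [Fintype.sum_prod_type (fun a : Fin n × Fin p =>
            ‖fderiv ℝ h Z (designBasis a)‖ ^ 2)] at h2
          linarith
        · simp only [if_neg hop, Finset.sum_const_zero]
          positivity

/-- The gradient is taken over all entries of the design, since `h^(-i)` depends on every other row.
The product rule gives three terms: the gradient of `h^(-i)` times `b_i = ⟨z_i, h^(-i)⟩`, then
`⟨z_i, ∂h^(-i)⟩`, then the explicit dependence on `z_i`. The first sums to `O(n)` because `∑ b_i² =
O(n)`, the other two are `O(1)` for each row. -/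
theorem lintegral_sqDiv_le :
    ∫⁻ Z, ENNReal.ofReal (sqDiv χ h Z ^ 2) ∂(designGaussian n p)
      ≤ ENNReal.ofReal (((3 * H₀ ^ 2 + 4 * gradConst μ M H₀ γ)
          * (2 * K * (H₀ ^ 2 + looConst μ M K H₀))
          + 8 * H₀ ^ 2 * (rowConst μ M H₀ * K + H₀ ^ 2)) * n) := by
  have hg := T.gradConst_nonneg
  have hl := T.looConst_nonneg
  have hr := T.rowConst_nonneg
  have hK := T.K_nonneg
  have hn' : (0 : ℝ) < n := Nat.cast_pos.2 T.n_pos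
  refine (lintegral_sum_adjDeriv_sq_le Function.injective_id fun a => ?_).trans
    (lintegral_le_of_ae_volume_le ?_)
  · have := (T.contractive.comp_dropRow a.1).lip_h
    exact T.cutoff.lip.mul_right (LocallyLipschitz.real_mul (locallyLipschitz_coord this _)
      (locallyLipschitz_inner_row this _))
  · filter_upwards [T.ae_differentiable] with Z hZ
    obtain ⟨d1, -, -, d4, d5⟩ := hZ
    set A : Fin n → Vec p := fun i => h (dropRow i Z) with hA
    set b : Fin n → ℝ := fun i => inner ℝ (Z i) (A i) with hb
    have hda : ∀ a : Fin n × Fin p, HasFDerivAt (fun Z => h (dropRow a.1 Z) a.2)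
        ((EuclideanSpace.proj (𝕜 := ℝ) a.2).comp
          (fderiv ℝ (fun Z => h (dropRow a.1 Z)) Z)) Z :=
      fun a => hasFDerivAt_coord (d4 a.1) a.2
    have hdb : ∀ i, HasFDerivAt (fun Z : Design n p => inner ℝ (Z i) (h (dropRow i Z)))
        ((innerSL ℝ (Z i)).comp (fderiv ℝ (fun Z => h (dropRow i Z)) Z)
          + (innerSL ℝ (A i)).comp
            (ContinuousLinearMap.proj (R := ℝ) (φ := fun _ : Fin n => Vec p) i)) Z := fun i => by
      have h1 : HasFDerivAt (fun Z : Design n p => Z i)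
          (ContinuousLinearMap.proj (R := ℝ) (φ := fun _ : Fin n => Vec p) i) Z :=
        (ContinuousLinearMap.proj (R := ℝ) (φ := fun _ : Fin n => Vec p) i).hasFDerivAt
      refine (h1.inner ℝ (d4 i).hasFDerivAt).congr_fderiv ?_
      ext V
      simp [fderivInnerCLM_apply, hA, real_inner_comm]
    refine steinEnergy_cutoff_le Function.injective_id T.cutoff d1
      (f := fun a Z => h (dropRow a.1 Z) a.2 * inner ℝ (Z a.1) (h (dropRow a.1 Z)))
      (fun a => (hda a).differentiableAt.mul (hdb a.1).differentiableAt) (by positivity)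
      fun hop => ?_
    have hA0 : ∀ i, ‖A i‖ ^ 2 ≤ H₀ ^ 2 := fun i =>
      pow_le_pow_left₀ (norm_nonneg _) (T.bound_dropRow hop i) 2
    have hbn := T.sum_inner_loo_sq_le hop
    change ∑ i, b i ^ 2 ≤ _ at hbn
    set Cb := 2 * K * (H₀ ^ 2 + looConst μ M K H₀) with hCb
    have hCb0 : 0 ≤ Cb := by positivity
    have s1 : ∑ a : Fin n × Fin p, (A a.1 a.2 * b a.1) ^ 2 ≤ H₀ ^ 2 * (Cb * n) := by
      rw [Fintype.sum_prod_type (fun a : Fin n × Fin p => (A a.1 a.2 * b a.1) ^ 2)]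
      calc ∑ i, ∑ j, (A i j * b i) ^ 2 = ∑ i, ‖A i‖ ^ 2 * b i ^ 2 := by
            refine Finset.sum_congr rfl fun i _ => ?_
            rw [EuclideanSpace.real_norm_sq_eq, Finset.sum_mul]
            exact Finset.sum_congr rfl fun j _ => mul_pow _ _ _
        _ ≤ ∑ i, H₀ ^ 2 * b i ^ 2 :=
            Finset.sum_le_sum fun i _ => mul_le_mul_of_nonneg_right (hA0 i) (sq_nonneg _)
        _ ≤ _ := by
            rw [← Finset.mul_sum]
            exact mul_le_mul_of_nonneg_left hbn (sq_nonneg _)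
    set dA : Fin n → Fin n × Fin p → Vec p := fun i c =>
      fderiv ℝ (fun Z => h (dropRow i Z)) Z (designBasis c) with hdA'
    have hf : ∀ a c : Fin n × Fin p, fderiv ℝ (fun Z : Design n p =>
        h (dropRow a.1 Z) a.2 * inner ℝ (Z a.1) (h (dropRow a.1 Z))) Z (designBasis (id c))
        = dA a.1 c a.2 * b a.1
          + A a.1 a.2 * (inner ℝ (Z a.1) (dA a.1 c) + inner ℝ (A a.1) (designBasis c a.1)) :=
      fun a c => by
        rw [((hda a).fun_mul (hdb a.1)).fderiv]
        simp [hdA', hA, hb]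
        ring
    have s2 : ∑ a : Fin n × Fin p, ∑ c : Fin n × Fin p, fderiv ℝ (fun Z : Design n p =>
        h (dropRow a.1 Z) a.2 * inner ℝ (Z a.1) (h (dropRow a.1 Z))) Z (designBasis (id c)) ^ 2
        ≤ 2 * (gradConst μ M H₀ γ * (Cb * n))
          + 4 * H₀ ^ 2 * (rowConst μ M H₀ * K + H₀ ^ 2) * n := by
      have t1 : ∀ i, ∑ c, ‖dA i c‖ ^ 2 ≤ gradConst μ M H₀ γ := fun i =>
        T.sum_grad_le (T.contractive.comp_dropRow i) (d4 i) (d5 i) (T.bound_dropRow hop i)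
      -- Here the factor `1/n` of the operator-norm gradient bound offsets `‖z_i‖² ≤ K n`.
      have t2 : ∀ i, ∑ c, inner ℝ (Z i) (dA i c) ^ 2 ≤ rowConst μ M H₀ * K := fun i => by
        refine (T.sum_inner_grad_le (T.contractive.comp_dropRow i) (d4 i) (d5 i)
          (T.bound_dropRow hop i) (Z i)).trans ?_
        have := hop.norm_row_sq_le (by positivity) i
        calc _ ≤ rowConst μ M H₀ / n * (K * n) := by gcongr
          _ = _ := by field_simp
      have t3 : ∀ i, ∑ c, inner ℝ (A i) ((designBasis c : Design n p) i) ^ 2 ≤ H₀ ^ 2 := fun i => by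
        rw [Fintype.sum_prod_type (fun c : Fin n × Fin p =>
          inner ℝ (A i) ((designBasis c : Design n p) i) ^ 2), Finset.sum_eq_single i]
        · simp only [designBasis, Pi.single_eq_same, EuclideanSpace.inner_single_right]
          refine le_trans (le_of_eq ?_) (hA0 i)
          rw [EuclideanSpace.real_norm_sq_eq]
          simp
        · intro k _ hk
          refine Finset.sum_eq_zero fun j _ => ?_
          simp [designBasis, Ne.symm hk]
        · simp
      have t4 : ∀ i, ∑ j, ∑ c : Fin n × Fin p, (dA i c j * b i
          + A i j * (inner ℝ (Z i) (dA i c) + inner ℝ (A i) (designBasis c i))) ^ 2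
          ≤ 2 * gradConst μ M H₀ γ * b i ^ 2
            + 4 * H₀ ^ 2 * (rowConst μ M H₀ * K + H₀ ^ 2) := fun i => by
        calc _ ≤ ∑ j, ∑ c : Fin n × Fin p, (2 * b i ^ 2 * dA i c j ^ 2
              + 4 * A i j ^ 2 * (inner ℝ (Z i) (dA i c) ^ 2
                + inner ℝ (A i) (designBasis c i) ^ 2)) := by
              refine Finset.sum_le_sum fun j _ => Finset.sum_le_sum fun c _ => ?_
              have q1 := sq_nonneg (dA i c j * b i
                - A i j * (inner ℝ (Z i) (dA i c) + inner ℝ (A i) (designBasis c i)))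
              have q2 := mul_nonneg (sq_nonneg (A i j))
                (sq_nonneg (inner ℝ (Z i) (dA i c) - inner ℝ (A i) (designBasis c i)))
              nlinarith
          _ = 2 * b i ^ 2 * ∑ c, ‖dA i c‖ ^ 2 + 4 * ‖A i‖ ^ 2 * (∑ c, inner ℝ (Z i) (dA i c) ^ 2
                + ∑ c, inner ℝ (A i) ((designBasis c : Design n p) i) ^ 2) := by
              simp only [Finset.sum_add_distrib, ← Finset.mul_sum]
              congr 1
              · rw [Finset.sum_comm]
                congr 1
                exact Finset.sum_congr rfl fun c _ => (EuclideanSpace.real_norm_sq_eq _).symm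
              · rw [← Finset.sum_mul, ← Finset.mul_sum, ← EuclideanSpace.real_norm_sq_eq]
          _ ≤ 2 * b i ^ 2 * gradConst μ M H₀ γ
                + 4 * H₀ ^ 2 * (rowConst μ M H₀ * K + H₀ ^ 2) := by
              have := t1 i; have := t2 i; have := t3 i; have := hA0 i
              have q3 : 0 ≤ ∑ c, inner ℝ (Z i) (dA i c) ^ 2
                + ∑ c, inner ℝ (A i) ((designBasis c : Design n p) i) ^ 2 :=
                add_nonneg (Finset.sum_nonneg fun _ _ => sq_nonneg _)
                  (Finset.sum_nonneg fun _ _ => sq_nonneg _)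
              gcongr
          _ = _ := by ring
      simp only [hf]
      rw [Fintype.sum_prod_type]
      refine (Finset.sum_le_sum fun i _ => t4 i).trans ?_
      rw [Finset.sum_add_distrib, ← Finset.mul_sum]
      simp only [Finset.sum_const, Finset.card_univ, Fintype.card_fin, nsmul_eq_mul]
      have := mul_le_mul_of_nonneg_left hbn (by positivity : 0 ≤ 2 * gradConst μ M H₀ γ)
      linarith
    change 3 * ∑ a : Fin n × Fin p, (A a.1 a.2 * b a.1) ^ 2 + 2 * _ ≤ _
    nlinarith

end FieldSetup

end Fields

/-! ### Construction of the operator-norm cutoff. -/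

section Cutoff

variable {n p : ℕ}

/-- The design as a continuous linear map `v ↦ Z v`. -/
def designOp (n p : ℕ) : Design n p →L[ℝ] Vec p →L[ℝ] Vec n :=
  LinearMap.toContinuousLinearMap
    { toFun := fun Z => LinearMap.toContinuousLinearMap (Matrix.toEuclideanLin (designMatrix Z))
      map_add' := fun Z Z' => by
        have : designMatrix (Z + Z') = designMatrix Z + designMatrix Z' := rfl
        rw [this, map_add, map_add]
      map_smul' := fun c Z => by
        have : designMatrix (c • Z) = c • designMatrix Z := rfl
        rw [this, map_smul, map_smul]; rfl }

theorem designOp_apply (Z : Design n p) (v : Vec p) :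
    designOp n p Z v = linearPredictor Z v := by
  ext i
  change (Matrix.toEuclideanLin (designMatrix Z) v) i = inner ℝ (Z i) v
  simp [Matrix.toLpLin_apply, Matrix.mulVec, dotProduct, designMatrix, PiLp.inner_apply, mul_comm]

theorem norm_linearPredictor_sq (Z : Design n p) (v : Vec p) :
    ‖linearPredictor Z v‖ ^ 2 = ∑ i, inner ℝ (Z i) v ^ 2 := by
  rw [EuclideanSpace.real_norm_sq_eq]; rfl

theorem opBound_of_norm_le {Z : Design n p} {L : ℝ} (h : ‖designOp n p Z‖ ≤ L) :
    OpBound Z (L ^ 2) := fun v => by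
  rw [← norm_linearPredictor_sq, ← designOp_apply, ← mul_pow]
  exact pow_le_pow_left₀ (norm_nonneg _) ((designOp n p Z).le_of_opNorm_le h v) 2

theorem norm_designOp_le (Z : Design n p) : ‖designOp n p Z‖ ≤ √(∑ i, ‖Z i‖ ^ 2) := by
  refine ContinuousLinearMap.opNorm_le_bound _ (Real.sqrt_nonneg _) fun v => ?_
  refine le_of_sq_le_sq ?_ (by positivity)
  rw [designOp_apply, norm_linearPredictor_sq, mul_pow,
    Real.sq_sqrt (Finset.sum_nonneg fun _ _ => sq_nonneg _), Finset.sum_mul]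
  refine Finset.sum_le_sum fun i _ => ?_
  rw [← mul_pow, ← sq_abs]
  exact pow_le_pow_left₀ (abs_nonneg _) (abs_real_inner_le_norm _ _) 2

theorem norm_row_le_designOp (Z : Design n p) (i : Fin n) : ‖Z i‖ ≤ ‖designOp n p Z‖ :=
  le_of_sq_le_sq ((opBound_of_norm_le le_rfl).norm_row_sq_le (sq_nonneg _) i) (norm_nonneg _)

/-- A cutoff function which is `1` where the operator norm is less than `L + 1` and vanishes
where it is more than `L + 2`. -/
def opCutoff (n p : ℕ) (L : ℝ) (Z : Design n p) : ℝ :=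
  max 0 (min 1 (L + 2 - ‖designOp n p Z‖))

/-- Truncation is 1-Lipschitz. The increment is measured by its own operator norm, which is what
gives a gradient bound free of dimension. -/
theorem abs_opCutoff_sub_le (L : ℝ) (Z V : Design n p) :
    |opCutoff n p L (Z + V) - opCutoff n p L Z| ≤ ‖designOp n p V‖ := by
  have h1 := abs_norm_sub_norm_le (designOp n p (Z + V)) (designOp n p Z)
  rw [← map_sub, add_sub_cancel_left] at h1
  unfold opCutoff
  refine (abs_max_sub_max_le_max _ _ _ _).trans ?_
  rw [sub_self, abs_zero]
  refine max_le (norm_nonneg _) ((abs_min_sub_min_le_max _ _ _ _).trans ?_)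
  rw [sub_self, abs_zero]
  refine max_le (norm_nonneg _) ?_
  rw [sub_sub_sub_cancel_left, abs_sub_comm]
  exact h1

theorem opCutoff_eq_zero {L : ℝ} {Z : Design n p} (h : L + 2 ≤ ‖designOp n p Z‖) :
    opCutoff n p L Z = 0 := by
  unfold opCutoff
  exact max_eq_left ((min_le_right _ _).trans (by linarith))

/-- The unit margin makes the cutoff constant in a neighbourhood, so that its derivative disappears
as well. -/
theorem opCutoff_eventually_eq_one {L : ℝ} {Z : Design n p} (h : ‖designOp n p Z‖ ≤ L) :
    opCutoff n p L =ᶠ[𝓝 Z] fun _ => 1 := by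
  have hc : Continuous fun Z : Design n p => ‖designOp n p Z‖ := (designOp n p).continuous.norm
  have : ∀ᶠ W in 𝓝 Z, ‖designOp n p W‖ < L + 1 :=
    hc.continuousAt.eventually_lt_const (by linarith)
  filter_upwards [this] with W hW
  unfold opCutoff
  rw [min_eq_left (by linarith), max_eq_right zero_le_one]

theorem tsupport_opCutoff (L : ℝ) :
    tsupport (opCutoff n p L) ⊆ {Z | ‖designOp n p Z‖ ≤ L + 2} := by
  refine closure_minimal (fun Z hZ => ?_)
    (isClosed_le (designOp n p).continuous.norm continuous_const)
  by_contra hcon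
  exact hZ (opCutoff_eq_zero (not_le.1 hcon).le)

theorem isCutoff_opCutoff {L K : ℝ} (hL : 0 ≤ L) (hK : (L + 2) ^ 2 ≤ K * n) :
    IsCutoff (opCutoff n p L) K where
  lip := by
    refine ⟨⟨‖designOp n p‖₊, LipschitzWith.of_dist_le_mul fun Z W => ?_⟩, ?_⟩
    · rw [Real.dist_eq, dist_eq_norm, coe_nnnorm]
      have := abs_opCutoff_sub_le L W (Z - W)
      rw [add_sub_cancel] at this
      exact this.trans ((designOp n p).le_opNorm _)
    · refine HasCompactSupport.intro (isCompact_closedBall (0 : Design n p) (L + 2)) fun Z hZ => ?_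
      refine opCutoff_eq_zero ?_
      by_contra hcon
      refine hZ (mem_closedBall_zero_iff.2 ((pi_norm_le_iff_of_nonneg (by positivity)).2 fun i => ?_))
      exact (norm_row_le_designOp Z i).trans (not_le.1 hcon).le
  nonneg Z := le_max_left _ _
  le_one Z := max_le zero_le_one (min_le_left _ _)
  opBound Z hZ v := by
    refine (opBound_of_norm_le (tsupport_opCutoff L hZ) v).trans ?_
    exact mul_le_mul_of_nonneg_right hK (sq_nonneg _)
  grad Z hd := by
    -- The derivative along the gradient `V` itself is `G`, and it is at most the operator norm of
    -- `V`, hence at most its Frobenius norm `√G`. Thus `G ≤ √G`, which forces `G ≤ 1`.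
    set G := ∑ a, fderiv ℝ (opCutoff n p L) Z (designBasis a) ^ 2 with hG
    set V : Design n p := ∑ a, fderiv ℝ (opCutoff n p L) Z (designBasis a) • designBasis a with hV
    have h1 : fderiv ℝ (opCutoff n p L) Z V = G := by
      rw [hV, map_sum]
      simp only [map_smul, smul_eq_mul, hG, sq]
    have h2 : ‖designOp n p V‖ ≤ √G := by
      refine (norm_designOp_le V).trans (le_of_eq ?_)
      rw [hV, sum_norm_sq_designBasis_sum]
    have h3 : ‖fderiv ℝ (opCutoff n p L) Z V‖ ≤ √G := by
      rw [← hd.lineDeriv_eq_fderiv]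
      refine norm_deriv_le_of_lip' (Real.sqrt_nonneg _) (Eventually.of_forall fun t => ?_)
      rw [zero_smul, add_zero, sub_zero, Real.norm_eq_abs]
      refine (abs_opCutoff_sub_le L Z (t • V)).trans ?_
      rw [map_smul, norm_smul, mul_comm]
      exact mul_le_mul_of_nonneg_right h2 (norm_nonneg _)
    have hG0 : 0 ≤ G := Finset.sum_nonneg fun _ _ => sq_nonneg _
    rw [h1] at h3
    have h4 : G ≤ √G := (le_abs_self _).trans h3
    have h5 := Real.sq_sqrt hG0
    by_contra hcon
    push Not at hcon
    have h6 : 1 < √G := by linarith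
    nlinarith

end Cutoff

/-! ### The estimation error as a function of noise and whitened design. -/

section Whitened

variable {n p : ℕ} {μ M : ℝ} {S : Matrix (Fin p) (Fin p) ℝ} {ρ : ℝ → ℝ} {g : Vec p → ℝ}

/-- The design with rows `S ^ (1/2) z_i`. -/
def colorDesign (n : ℕ) (S : Matrix (Fin p) (Fin p) ℝ) : Design n p →L[ℝ] Design n p :=
  ContinuousLinearMap.pi fun i =>
    (LinearMap.toContinuousLinearMap (sqrtLin S)).comp (ContinuousLinearMap.proj i)

theorem colorDesign_apply (Z : Design n p) (i : Fin n) :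
    colorDesign n S Z i = sqrtLin S (Z i) := rfl

/-- The linear map `Z ↦ (Z S ^ (1/2) β, Z S ^ (1/2))`. -/
def modelMap (n : ℕ) (S : Matrix (Fin p) (Fin p) ℝ) (β : Vec p) :
    Design n p →L[ℝ] Vec n × Design n p :=
  (((designOp n p).flip β).comp (colorDesign n S)).prod (colorDesign n S)

theorem modelMap_apply (β : Vec p) (Z : Design n p) :
    modelMap n S β Z = (linearPredictor (colorDesign n S Z) β, colorDesign n S Z) := by
  rw [← designOp_apply]; rfl

/-- The estimation error `S ^ (1/2) (β̂ - β)` as a function of the noise and of the whitened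
design. -/
def whiteError (ρ : ℝ → ℝ) (g : Vec p → ℝ) (S : Matrix (Fin p) (Fin p) ℝ) (β : Vec p)
    (ε : Vec n) (Z : Design n p) : Vec p :=
  sqrtLin S (mEstimator ρ g (linearPredictor (colorDesign n S Z) β + ε) (colorDesign n S Z) - β)

/-- The residuals as functions of the noise and of the whitened design. -/
def whiteResidual (ρ : ℝ → ℝ) (g : Vec p → ℝ) (S : Matrix (Fin p) (Fin p) ℝ) (β : Vec p)
    (ε : Vec n) (Z : Design n p) : Vec n :=
  residual ρ g (linearPredictor (colorDesign n S Z) β + ε) (colorDesign n S Z)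

theorem whiteResidual_apply (β : Vec p) (ε : Vec n) (Z : Design n p) (i : Fin n) :
    whiteResidual ρ g S β ε Z i = ε i - inner ℝ (Z i) (whiteError ρ g S β ε Z) := by
  unfold whiteResidual whiteError
  rw [residual_apply, ← inner_sqrtLin, inner_sub_right, colorDesign_apply]
  change inner ℝ (sqrtLin S (Z i)) β + ε i - _ = _
  ring

namespace IsLossPenalty

variable (H : IsLossPenalty n μ M S ρ g) (β : Vec p)
include H

theorem continuous_whiteError :
    Continuous fun w : Vec n × Design n p => whiteError ρ g S β w.1 w.2 := by
  have h1 : Continuous fun w : Vec n × Design n p => modelMap n S β w.2 + (w.1, 0) := by fun_prop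
  have h2 := H.locallyLipschitz_mEstimator.continuous.comp h1
  refine ((LinearMap.toContinuousLinearMap (sqrtLin S)).continuous.comp
    (h2.sub (continuous_const (y := β)))).congr fun w => ?_
  simp only [Function.comp_def, modelMap_apply]
  simp [whiteError]

theorem contractive_whiteError (ε : Vec n) :
    Contractive μ M Finset.univ (whiteError ρ g S β ε)
      (fun i Z => deriv ρ (whiteResidual ρ g S β ε Z i)) where
  lip_h := by
    have h1 : LocallyLipschitz fun Z : Design n p => modelMap n S β Z + (ε, 0) :=
      (ContDiff.locallyLipschitz (𝕂 := ℝ) (by fun_prop))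
    have h2 := H.locallyLipschitz_mEstimator.comp h1
    have h3 : LocallyLipschitz fun b : Vec p => sqrtLin S (b - β) :=
      ContDiff.locallyLipschitz (𝕂 := ℝ)
        ((LinearMap.toContinuousLinearMap (sqrtLin S)).contDiff.comp (contDiff_id.sub contDiff_const))
    have h4 := h3.comp h2
    simp only [Function.comp_def, modelMap_apply, Prod.mk_add_mk, add_zero] at h4
    exact h4
  lip_ψ i := by
    have h1 : LocallyLipschitz fun Z : Design n p => modelMap n S β Z + (ε, 0) :=
      (ContDiff.locallyLipschitz (𝕂 := ℝ) (by fun_prop))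
    have h4 := H.loss.lipschitz_deriv.locallyLipschitz.comp
      ((H.locallyLipschitz_residual i).comp h1)
    simp only [Function.comp_def, modelMap_apply, Prod.mk_add_mk, add_zero] at h4
    exact h4
  bound_ψ i Z := H.psi_bound _
  contraction Z Z' := by
    refine le_trans (le_of_eq ?_) ((H.contraction (linearPredictor (colorDesign n S Z) β + ε)
      (linearPredictor (colorDesign n S Z') β + ε) (colorDesign n S Z)
      (colorDesign n S Z')).trans (le_of_eq ?_))
    · unfold whiteError whiteResidual
      rw [← map_sub, sub_sub_sub_cancel_right]
    · refine Finset.sum_congr rfl fun i _ => ?_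
      set b := mEstimator ρ g (linearPredictor (colorDesign n S Z) β + ε) (colorDesign n S Z) with hb
      set b' := mEstimator ρ g (linearPredictor (colorDesign n S Z') β + ε) (colorDesign n S Z')
        with hb'
      have e1 : inner ℝ (colorDesign n S Z i - colorDesign n S Z' i) (b - b')
          = inner ℝ (Z i - Z' i) (whiteError ρ g S β ε Z - whiteError ρ g S β ε Z') := by
        unfold whiteError
        rw [← hb, ← hb', ← map_sub, sub_sub_sub_cancel_right, ← inner_sqrtLin, map_sub]
        rfl
      -- With the noise held fixed, the response moves only through `⟨x_i, β⟩`, which turns the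
      -- increment of the estimator's residual into one of the error `h`.
      have e2 : (linearPredictor (colorDesign n S Z) β + ε) i
          - (linearPredictor (colorDesign n S Z') β + ε) i
          - inner ℝ (colorDesign n S Z i - colorDesign n S Z' i) b
          = - inner ℝ (Z i - Z' i) (whiteError ρ g S β ε Z) := by
        unfold whiteError
        rw [← hb, ← inner_sqrtLin, map_sub, inner_sub_right, inner_sub_left _ _ β]
        change inner ℝ (colorDesign n S Z i) β + ε i - (inner ℝ (colorDesign n S Z' i) β + ε i) - _
          = - (_ - (inner ℝ (colorDesign n S Z i) β - inner ℝ (colorDesign n S Z' i) β))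
        rw [colorDesign_apply, colorDesign_apply]
        ring
      rw [e1, e2]
      unfold whiteResidual
      ring

/-- Cauchy-Schwarz in `norm_sq_le` with `|ψ| ≤ M` and the operator norm bound: both factors are of
order `√n`, matching the `n μ` on the left. The noise enters only through `ψ`, so the bound is
uniform in it. -/
theorem norm_whiteError_le (hβ : sqNormCov S β ≤ M) {K : ℝ} (hK : 0 ≤ K) (ε : Vec n)
    {Z : Design n p} (hZ : OpBound Z (K * n)) :
    ‖whiteError ρ g S β ε Z‖ ≤ √M + 2 * M * √K / μ := by
  have hn : (0 : ℝ) < n := Nat.cast_pos.2 H.n_pos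
  have hμ := H.μ_pos
  have hM : 0 ≤ M := (abs_nonneg _).trans (H.psi_bound 0)
  unfold whiteError
  set y := linearPredictor (colorDesign n S Z) β + ε
  set b := mEstimator ρ g y (colorDesign n S Z) with hb
  have h1 := H.norm_sq_le y (colorDesign n S Z)
  rw [← hb] at h1
  have h2 : ∑ i, deriv ρ (residual ρ g y (colorDesign n S Z) i) * inner ℝ (colorDesign n S Z i) b
      ≤ (√n * M) * (√(K * n) * ‖sqrtLin S b‖) := by
    refine (Real.sum_mul_le_sqrt_mul_sqrt _ _ _).trans ?_
    refine mul_le_mul ?_ ?_ (Real.sqrt_nonneg _) (by positivity)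
    · rw [← Real.sqrt_sq hM, ← Real.sqrt_mul hn.le]
      refine Real.sqrt_le_sqrt ?_
      calc _ ≤ ∑ _i : Fin n, M ^ 2 := Finset.sum_le_sum fun i _ => by
            rw [← sq_abs]; exact pow_le_pow_left₀ (abs_nonneg _) (H.psi_bound _) 2
        _ = _ := by simp
    · rw [← Real.sqrt_sq (norm_nonneg (sqrtLin S b)), ← Real.sqrt_mul (by positivity)]
      refine Real.sqrt_le_sqrt ?_
      simp only [colorDesign_apply, inner_sqrtLin]
      exact hZ _
  have h3 : ‖sqrtLin S b‖ ≤ 2 * M * √K / μ := by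
    rw [le_div_iff₀ hμ]
    rcases (norm_nonneg (sqrtLin S b)).eq_or_lt with h0 | h0
    · rw [← h0]; simp; positivity
    · have h4 : √(n : ℝ) * √(K * n) = √K * n := by
        rw [Real.sqrt_mul hK, mul_comm √K, ← mul_assoc, Real.mul_self_sqrt hn.le, mul_comm]
      have h5 : n * μ * ‖sqrtLin S b‖ ^ 2 ≤ 2 * M * (√K * n) * ‖sqrtLin S b‖ := by
        rw [← h4]; linarith
      have h6 : (‖sqrtLin S b‖ * μ) * (n * ‖sqrtLin S b‖)
          ≤ (2 * M * √K) * (n * ‖sqrtLin S b‖) := by linarith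
      exact le_of_mul_le_mul_right h6 (by positivity)
  have h4 : ‖sqrtLin S β‖ ≤ √M := Real.le_sqrt_of_sq_le hβ
  rw [map_sub]
  exact (norm_sub_le _ _).trans (by linarith)

end IsLossPenalty

end Whitened

/-! ### The derivative formulas in whitened coordinates. -/

section Derivative

variable {n p : ℕ} {μ M : ℝ} {S : Matrix (Fin p) (Fin p) ℝ} {ρ : ℝ → ℝ} {g : Vec p → ℝ}

theorem IsDerivMatrix.fderiv_apply_single {y : Vec n} {X : Design n p}
    {A : Matrix (Fin p) (Fin p) ℝ} (hA : IsDerivMatrix μ S ρ g y X A) (i : Fin n) (c : ℝ)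
    (v : Vec p) :
    fderiv ℝ (fun z : Vec n × Design n p => mEstimator ρ g z.1 z.2) (y, X)
        (EuclideanSpace.single i c, Pi.single i v)
      = deriv ρ (residual ρ g y X i) • Matrix.toEuclideanLin A v
        + (deriv (deriv ρ) (residual ρ g y X i) * (c - inner ℝ v (mEstimator ρ g y X))) •
          Matrix.toEuclideanLin A (X i) := by
  set D := fderiv ℝ (fun z : Vec n × Design n p => mEstimator ρ g z.1 z.2) (y, X) with hD
  set b := mEstimator ρ g y X
  have e1 : ((EuclideanSpace.single i c : Vec n), (Pi.single i v : Design n p))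
      = c • (EuclideanSpace.single i 1, 0)
        + ∑ j, v j • ((0 : Vec n), (Pi.single i (EuclideanSpace.single j 1) : Design n p)) := by
    refine Prod.ext ?_ ?_
    · ext k
      by_cases hk : k = i <;> simp [Prod.fst_sum, hk]
    · funext k
      ext l
      by_cases hk : k = i
      · subst hk
        simp [Prod.snd_sum, Pi.single_apply]
      · simp [Prod.snd_sum, hk]
  have e2 : Matrix.toEuclideanLin A v
      = ∑ j, v j • Matrix.toEuclideanLin A (EuclideanSpace.single j 1) := by
    conv_lhs => rw [show v = ∑ j, v j • (EuclideanSpace.single j 1 : Vec p) by ext l; simp [Pi.single_apply]]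
    simp only [map_sum, map_smul]
  have e3 : inner ℝ v b = ∑ j, v j * b j := by simp [PiLp.inner_apply, mul_comm]
  rw [e1, map_add, map_smul, map_sum]
  simp only [map_smul, hD, hA.deriv_y, hA.deriv_x, smul_sub, Finset.sum_sub_distrib]
  rw [e2, e3, Finset.smul_sum, mul_sub, sub_smul, Finset.mul_sum, Finset.sum_smul]
  simp only [smul_smul]
  have e4 : ∀ j, v j * deriv ρ (residual ρ g y X i) = deriv ρ (residual ρ g y X i) * v j :=
    fun j => mul_comm _ _
  have e5 : ∀ j, v j * (deriv (deriv ρ) (residual ρ g y X i) * b j)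
      = deriv (deriv ρ) (residual ρ g y X i) * (v j * b j) := fun j => by ring
  simp only [b, e4, e5, mul_comm c]
  abel

/-- `S ^ (1/2) A S ^ (1/2)` as a linear map. -/
def whiteMatrix (S A : Matrix (Fin p) (Fin p) ℝ) : Vec p →L[ℝ] Vec p :=
  LinearMap.toContinuousLinearMap (Matrix.toEuclideanLin (sqrtMat S * A * sqrtMat S))

theorem whiteMatrix_apply (S A : Matrix (Fin p) (Fin p) ℝ) (v : Vec p) :
    whiteMatrix S A v = sqrtLin S (Matrix.toEuclideanLin A (sqrtLin S v)) := by
  unfold whiteMatrix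
  change Matrix.toEuclideanLin (sqrtMat S * A * sqrtMat S) v = _
  rw [Matrix.toLpLin_mul_same, Matrix.toLpLin_mul_same]
  rfl

theorem sum_whiteMatrix_single (hS : S.PosDef) (A : Matrix (Fin p) (Fin p) ℝ) :
    ∑ j, whiteMatrix S A (EuclideanSpace.single j 1) j = (S * A).trace := by
  have e : (S * A).trace = (sqrtMat S * A * sqrtMat S).trace := by
    rw [Matrix.trace_mul_comm (sqrtMat S * A), ← mul_assoc, sqrtMat_mul_self hS]
  rw [e, Matrix.trace]
  refine Finset.sum_congr rfl fun j _ => ?_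
  change (Matrix.toEuclideanLin (sqrtMat S * A * sqrtMat S) (EuclideanSpace.single j 1)) j = _
  simp [Matrix.toLpLin_apply]
  rfl

/-- Chain rule. Moving the entry `(i, j)` of the whitened design moves `x_i` by `S^(1/2) e_j` and
`y_i` by `⟨S^(1/2) e_j, β⟩`; the combination of the two partial derivatives replaces `β̂` by the
error. -/
theorem IsDerivMatrix.hasFDerivAt_whiteError {β : Vec p} {ε : Vec n} {Z : Design n p}
    {A : Matrix (Fin p) (Fin p) ℝ}
    (hA : IsDerivMatrix μ S ρ g (linearPredictor (colorDesign n S Z) β + ε) (colorDesign n S Z) A) :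
    DifferentiableAt ℝ (whiteError ρ g S β ε) Z ∧
    ∀ i j, fderiv ℝ (whiteError ρ g S β ε) Z (designBasis (i, j))
      = deriv ρ (whiteResidual ρ g S β ε Z i) • whiteMatrix S A (EuclideanSpace.single j 1)
        - (deriv (deriv ρ) (whiteResidual ρ g S β ε Z i) * whiteError ρ g S β ε Z j) •
          whiteMatrix S A (Z i) := by
  set y := linearPredictor (colorDesign n S Z) β + ε with hy
  set X := colorDesign n S Z with hX
  set L := LinearMap.toContinuousLinearMap (sqrtLin S) with hL
  have hpt : modelMap n S β Z + (ε, 0) = (y, X) := by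
    rw [modelMap_apply, Prod.mk_add_mk, add_zero]
  have h1 : HasFDerivAt (fun Z : Design n p => modelMap n S β Z + (ε, 0)) (modelMap n S β) Z :=
    (modelMap n S β).hasFDerivAt.add_const _
  have h2 : HasFDerivAt (fun z : Vec n × Design n p => mEstimator ρ g z.1 z.2)
      (fderiv ℝ (fun z : Vec n × Design n p => mEstimator ρ g z.1 z.2) (y, X))
      (modelMap n S β Z + (ε, 0)) := by
    rw [hpt]; exact hA.differentiableAt.hasFDerivAt
  have h3 := L.hasFDerivAt.comp Z ((h2.comp Z h1).sub_const β)
  have h4 : whiteError ρ g S β ε = L ∘ fun Z : Design n p =>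
      ((fun z : Vec n × Design n p => mEstimator ρ g z.1 z.2) ∘
        fun Z : Design n p => modelMap n S β Z + (ε, 0)) Z - β := by
    funext W
    simp only [Function.comp_def, modelMap_apply, Prod.mk_add_mk, add_zero]
    rfl
  rw [← h4] at h3
  refine ⟨h3.differentiableAt, fun i j => ?_⟩
  rw [h3.fderiv]
  set e : Vec p := EuclideanSpace.single j 1 with he
  have h5 : modelMap n S β (designBasis (i, j))
      = (EuclideanSpace.single i (inner ℝ (sqrtLin S e) β), Pi.single i (sqrtLin S e)) := by
    have h6 : colorDesign n S (designBasis (i, j)) = Pi.single i (sqrtLin S e) := by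
      funext k
      rw [colorDesign_apply, designBasis]
      by_cases hk : k = i
      · subst hk; simp [he]
      · simp [hk]
    rw [modelMap_apply, h6]
    refine Prod.ext ?_ rfl
    ext k
    change inner ℝ ((Pi.single i (sqrtLin S e) : Design n p) k) β = _
    by_cases hk : k = i
    · subst hk; simp
    · simp [hk]
  have h7 : inner ℝ (sqrtLin S e) β - inner ℝ (sqrtLin S e) (mEstimator ρ g y X)
      = - whiteError ρ g S β ε Z j := by
    have : whiteError ρ g S β ε Z j = inner ℝ e (whiteError ρ g S β ε Z) := by
      simp [he, EuclideanSpace.inner_single_left]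
    rw [this]
    unfold whiteError
    rw [← inner_sqrtLin, inner_sub_right]
    ring
  change L (fderiv ℝ (fun z : Vec n × Design n p => mEstimator ρ g z.1 z.2) (y, X)
    (modelMap n S β (designBasis (i, j)))) = _
  rw [h5, hA.fderiv_apply_single, h7, map_add, map_smul, map_smul, mul_neg, neg_smul,
    ← sub_eq_add_neg, whiteMatrix_apply, whiteMatrix_apply]
  rfl

end Derivative

/-! ### Explicit values of the divergences where the cutoff is one. -/

section Evaluation

variable {n p : ℕ} {h : Design n p → Vec p} {χ : Design n p → ℝ} {Z : Design n p}

/-- `⟨z_i, h⟩ - ∑_j ∂_{ij} h_j`. -/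
def rowDiv (h : Design n p → Vec p) (Z : Design n p) (i : Fin n) : ℝ :=
  inner ℝ (Z i) (h Z) - ∑ j, fderiv ℝ h Z (designBasis (i, j)) j

theorem lineDeriv_cutoff_mul (hχ : χ =ᶠ[𝓝 Z] fun _ => 1) (f : Design n p → ℝ) (V : Design n p) :
    χ Z * f Z = f Z ∧ lineDeriv ℝ (fun Z => χ Z * f Z) Z V = lineDeriv ℝ f Z V := by
  refine ⟨by rw [hχ.self_of_nhds, one_mul], Filter.EventuallyEq.lineDeriv_eq ?_⟩
  filter_upwards [hχ] with W hW
  rw [hW, one_mul]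

theorem inner_eq_sum_mul (a b : Vec p) : inner ℝ a b = ∑ j, a j * b j := by
  simp [PiLp.inner_apply, mul_comm]

theorem noiseDiv_eq (hχ : χ =ᶠ[𝓝 Z] fun _ => 1) (hd : DifferentiableAt ℝ h Z) (ε : Vec n) :
    noiseDiv χ h ε Z = ∑ i, ε i * rowDiv h Z i := by
  unfold noiseDiv rowDiv
  rw [Fintype.sum_prod_type]
  refine Finset.sum_congr rfl fun i _ => ?_
  rw [inner_eq_sum_mul, ← Finset.sum_sub_distrib, Finset.mul_sum]
  refine Finset.sum_congr rfl fun j _ => ?_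
  unfold adjDeriv
  obtain ⟨h1, h2⟩ := lineDeriv_cutoff_mul hχ (fun Z => ε i * h Z j) (designBasis (i, j))
  have h3 : lineDeriv ℝ (fun Z => ε i * h Z j) Z (designBasis (i, j))
      = ε i * fderiv ℝ h Z (designBasis (i, j)) j :=
    (((hasFDerivAt_coord hd j).const_mul (ε i)).hasLineDerivAt _).lineDeriv
  simp only [id, h2, h3, designCoord_apply]
  rw [h1]
  ring

/-- `h^(-i)` does not change along row `i`, so only its inner product with `z_i` contributes to the
divergence. -/
theorem looDiv_eq (hχ : χ =ᶠ[𝓝 Z] fun _ => 1) (hd : DifferentiableAt ℝ h Z) (i : Fin n) :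
    looDiv χ h i Z = rowDiv h Z i - inner ℝ (Z i) (h (dropRow i Z)) := by
  unfold looDiv rowDiv
  rw [inner_eq_sum_mul, inner_eq_sum_mul, ← Finset.sum_sub_distrib, ← Finset.sum_sub_distrib]
  refine Finset.sum_congr rfl fun j _ => ?_
  unfold adjDeriv
  obtain ⟨h1, h2⟩ := lineDeriv_cutoff_mul hχ (fun Z => h Z j - h (dropRow i Z) j)
    (designBasis (i, j))
  have h3 : HasLineDerivAt ℝ (fun Z => h Z j - h (dropRow i Z) j)
      (fderiv ℝ h Z (designBasis (i, j)) j - 0) Z (designBasis (i, j)) := by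
    have h4 : HasDerivAt (fun t : ℝ => h (Z + t • designBasis (i, j)) j)
      (fderiv ℝ h Z (designBasis (i, j)) j) 0 := (hasFDerivAt_coord hd j).hasLineDerivAt _
    have h5 := h4.fun_sub (hasDerivAt_const (0 : ℝ) (h (dropRow i Z) j))
    refine h5.congr_of_eventuallyEq (Eventually.of_forall fun t => ?_)
    simp only [dropRow_add_smul_designBasis]
  beta_reduce
  rw [h1, h2, h3.lineDeriv, designCoord_apply]
  ring

/-- Along row `i` the vector `a = h^(-i)` is frozen, and the field `a_j ⟨z_i, a⟩` has derivative
`a_j²` in direction `j`. -/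
theorem sqDiv_eq (hχ : χ =ᶠ[𝓝 Z] fun _ => 1) :
    sqDiv χ h Z = ∑ i, (inner ℝ (Z i) (h (dropRow i Z)) ^ 2 - ‖h (dropRow i Z)‖ ^ 2) := by
  unfold sqDiv
  rw [Fintype.sum_prod_type]
  refine Finset.sum_congr rfl fun i _ => ?_
  rw [sq (inner ℝ (Z i) (h (dropRow i Z)))]
  conv_rhs => rw [inner_eq_sum_mul, EuclideanSpace.real_norm_sq_eq, Finset.sum_mul,
    ← Finset.sum_sub_distrib]
  refine Finset.sum_congr rfl fun j _ => ?_
  unfold adjDeriv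
  set a := h (dropRow i Z) with ha
  obtain ⟨h1, h2⟩ := lineDeriv_cutoff_mul hχ
    (fun Z => h (dropRow i Z) j * inner ℝ (Z i) (h (dropRow i Z))) (designBasis (i, j))
  have h3 : HasLineDerivAt ℝ (fun Z => h (dropRow i Z) j * inner ℝ (Z i) (h (dropRow i Z)))
      (a j * a j) Z (designBasis (i, j)) := by
    have h5 : HasDerivAt (fun t : ℝ => a j * (inner ℝ (Z i) a + t * a j)) (a j * a j) 0 := by
      have := (((hasDerivAt_id (0 : ℝ)).mul_const (a j)).const_add (inner ℝ (Z i) a)).const_mul (a j)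
      simpa using this
    refine h5.congr_of_eventuallyEq (Eventually.of_forall fun t => ?_)
    simp only [dropRow_add_smul_designBasis, ← ha]
    rw [Pi.add_apply, inner_add_left, Pi.smul_apply, real_inner_smul_left]
    congr 3
    simp [designBasis, EuclideanSpace.inner_single_left]
  simp only [id]
  rw [h1, h2, h3.lineDeriv, designCoord_apply, ← ha, ← inner_eq_sum_mul]
  ring

end Evaluation

/-! ### Deterministic expansion of the criterion. -/

section Expansion

theorem abs_two_mul_sum_mul_le {ι : Type*} [Fintype ι] (x y : ι → ℝ) {s : ℝ} (hs : 0 < s) :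
    |2 * ∑ i, x i * y i| ≤ (∑ i, x i ^ 2) / s + s * ∑ i, y i ^ 2 := by
  rw [Finset.mul_sum, Finset.sum_div, Finset.mul_sum, ← Finset.sum_add_distrib]
  refine (Finset.abs_sum_le_sum_abs _ _).trans (Finset.sum_le_sum fun i _ => ?_)
  have h1 : (x i) ^ 2 / s + s * y i ^ 2 - 2 * (x i * y i) = (x i - s * y i) ^ 2 / s := by
    field_simp; ring
  have h2 : (x i) ^ 2 / s + s * y i ^ 2 + 2 * (x i * y i) = (x i + s * y i) ^ 2 / s := by
    field_simp; ring
  have h3 : 0 ≤ (x i - s * y i) ^ 2 / s := by positivity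
  have h4 : 0 ≤ (x i + s * y i) ^ 2 / s := by positivity
  rw [abs_le]
  constructor <;> linarith

/-- Every error term is `O(N)` once the three divergences are normalized by `N`, `1` and `√n`.
Products are split by Young's inequality with weight `N` when the noise is involved and `s = √n ≤ N`
otherwise. -/
theorem abs_expansion_le {n : ℕ} {ε ξ e b : Fin n → ℝ} {N s H α La Cb E : ℝ}
    (hs : s ^ 2 = n) (hs1 : 1 ≤ s) (hsN : s ≤ N) (hCb : 0 ≤ Cb)
    (hε : ∑ i, ε i ^ 2 ≤ N ^ 2) (he : ∑ i, e i ^ 2 ≤ E) (hb : ∑ i, b i ^ 2 ≤ Cb * n)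
    (hα : |α - n * H| ≤ La * s) (hLa : 0 ≤ La) :
    |∑ i, (ε i - ξ i + e i) ^ 2 - ∑ i, ε i ^ 2 - n * H|
      ≤ N * (3 + La + 3 * Cb + 3 * E + 4 * ((∑ i, ε i * ξ i) ^ 2 / N ^ 2
        + ∑ i, (ξ i - b i) ^ 2 + (∑ i, b i ^ 2 - α) ^ 2 / n)) := by
  set D1 := ∑ i, ε i * ξ i with hD1
  set D2 := ∑ i, (ξ i - b i) ^ 2 with hD2
  set D3 := ∑ i, b i ^ 2 - α with hD3
  have hs0 : 0 < s := by linarith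
  have hN : 0 < N := by linarith
  have hN1 : 1 ≤ N := hs1.trans hsN
  have hD20 : 0 ≤ D2 := Finset.sum_nonneg fun _ _ => sq_nonneg _
  have hE0 : 0 ≤ E := (Finset.sum_nonneg fun _ _ => sq_nonneg _).trans he
  -- Each `ξ_i²` is expanded around `b_i²`, and `∑ b_i²` around `α`, the sum of the squared
  -- leave-one-out errors.
  have key : ∑ i, (ε i - ξ i + e i) ^ 2 - ∑ i, ε i ^ 2 - n * H
      = -(2 * D1) + D3 + (α - n * H) + 2 * ∑ i, b i * (ξ i - b i) + D2 + ∑ i, e i ^ 2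
        + 2 * ∑ i, ε i * e i - 2 * ∑ i, ξ i * e i := by
    have : ∑ i, (ε i - ξ i + e i) ^ 2 = ∑ i, (ε i ^ 2 - 2 * (ε i * ξ i) + b i ^ 2
        + 2 * (b i * (ξ i - b i)) + (ξ i - b i) ^ 2 + e i ^ 2 + 2 * (ε i * e i)
        - 2 * (ξ i * e i)) := Finset.sum_congr rfl fun i _ => by ring
    rw [this]
    simp only [Finset.sum_add_distrib, Finset.sum_sub_distrib, ← Finset.mul_sum]
    rw [hD1, hD2, hD3]
    ring
  have b1 : |2 * D1| ≤ N * (1 + D1 ^ 2 / N ^ 2) := by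
    have h1 : N * (1 + D1 ^ 2 / N ^ 2) - 2 * D1 = (N - D1) ^ 2 / N := by field_simp; ring
    have h2 : N * (1 + D1 ^ 2 / N ^ 2) + 2 * D1 = (N + D1) ^ 2 / N := by field_simp; ring
    have h3 : 0 ≤ (N - D1) ^ 2 / N := by positivity
    have h4 : 0 ≤ (N + D1) ^ 2 / N := by positivity
    rw [abs_le]; constructor <;> linarith
  have b3 : |D3| ≤ N * (1 + D3 ^ 2 / n) := by
    have h1 : |D3| ≤ s * (1 + D3 ^ 2 / n) := by
      rw [← hs]
      have h1 : s * (1 + D3 ^ 2 / s ^ 2) - 2 * |D3| = (s - |D3|) ^ 2 / s := by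
        rw [← sq_abs D3]; field_simp; ring
      have h3 : 0 ≤ (s - |D3|) ^ 2 / s := by positivity
      have := abs_nonneg D3
      linarith
    exact h1.trans (mul_le_mul_of_nonneg_right hsN (by positivity))
  have b4 : |2 * ∑ i, b i * (ξ i - b i)| ≤ N * (Cb + D2) := by
    refine (abs_two_mul_sum_mul_le _ _ hs0).trans ?_
    have h1 : (∑ i, b i ^ 2) / s ≤ Cb * s := by
      rw [div_le_iff₀ hs0]; rw [← hs] at hb; linarith
    have h2 := mul_le_mul_of_nonneg_right hsN (by positivity : 0 ≤ Cb + D2)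
    linarith
  have b5 : |2 * ∑ i, ε i * e i| ≤ N * (1 + E) := by
    refine (abs_two_mul_sum_mul_le _ _ hN).trans ?_
    have h1 : (∑ i, ε i ^ 2) / N ≤ N := by rw [div_le_iff₀ hN]; linarith
    have h2 := mul_le_mul_of_nonneg_left he hN.le
    linarith
  have b6 : |2 * ∑ i, ξ i * e i| ≤ N * (2 * Cb + 2 * D2 + E) := by
    refine (abs_two_mul_sum_mul_le _ _ hs0).trans ?_
    have h1 : ∑ i, ξ i ^ 2 ≤ 2 * ∑ i, b i ^ 2 + 2 * D2 := by
      rw [hD2, Finset.mul_sum, Finset.mul_sum, ← Finset.sum_add_distrib]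
      refine Finset.sum_le_sum fun i _ => ?_
      nlinarith [sq_nonneg (2 * b i - ξ i)]
    have h2 : (∑ i, ξ i ^ 2) / s ≤ s * (2 * Cb + 2 * D2) := by
      rw [div_le_iff₀ hs0]
      rw [← hs] at hb
      have h3 : D2 ≤ s ^ 2 * D2 := le_mul_of_one_le_left hD20 (one_le_pow₀ hs1)
      linarith
    have h4 := mul_le_mul_of_nonneg_left he hs0.le
    have h5 := mul_le_mul_of_nonneg_right hsN (by positivity : 0 ≤ 2 * Cb + 2 * D2 + E)
    linarith
  have b7 : D2 ≤ N * D2 := le_mul_of_one_le_left hD20 hN1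
  have b8 : ∑ i, e i ^ 2 ≤ N * E := he.trans (le_mul_of_one_le_left hE0 hN1)
  have b9 : |α - n * H| ≤ N * La :=
    hα.trans (by rw [mul_comm]; exact mul_le_mul_of_nonneg_right hsN hLa)
  have h0 : 0 ≤ ∑ i, e i ^ 2 := Finset.sum_nonneg fun _ _ => sq_nonneg _
  have h1 : 0 ≤ N * (D1 ^ 2 / N ^ 2) := by positivity
  have h2 : 0 ≤ N * (D3 ^ 2 / n) := by positivity
  rw [key]
  generalize D1 ^ 2 / N ^ 2 = w1 at *
  generalize D3 ^ 2 / (n : ℝ) = w3 at *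
  have e0 : N * (3 + La + 3 * Cb + 3 * E + 4 * (w1 + D2 + w3))
      = N * (1 + w1) + N * (1 + w3) + N * La + N * (Cb + D2) + N * D2 + N * E + N * (1 + E)
        + N * (2 * Cb + 2 * D2 + E) + 3 * (N * w1) + 3 * (N * w3) := by ring
  rw [e0]
  rw [abs_le] at b1 b3 b4 b5 b6 b9 ⊢
  constructor <;> linarith

end Expansion

/-! ### Pointwise approximation of the criterion. -/

section Pointwise

variable {n p : ℕ} {μ M K H₀ γ : ℝ} {S : Matrix (Fin p) (Fin p) ℝ} {ρ : ℝ → ℝ} {g : Vec p → ℝ}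
  {χ : Design n p → ℝ}

/-- The sum of the normalized squares of the three divergences. -/
def remainder (N : ℝ) (χ : Design n p → ℝ) (h : Design n p → Vec p) (ε : Vec n)
    (Z : Design n p) : ℝ :=
  noiseDiv χ h ε Z ^ 2 / N ^ 2 + ∑ i, looDiv χ h i Z ^ 2 + sqDiv χ h Z ^ 2 / n

theorem remainder_nonneg (N : ℝ) (χ : Design n p → ℝ) (h : Design n p → Vec p) (ε : Vec n)
    (Z : Design n p) : 0 ≤ remainder N χ h ε Z := by
  unfold remainder; positivity

theorem abs_criterion_sub_le (H : IsLossPenalty n μ M S ρ g) {β : Vec p} {ε : Vec n}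
    {ψ : Fin n → Design n p → ℝ} (T : FieldSetup μ M K H₀ γ (whiteError ρ g S β ε) ψ χ)
    {Z : Design n p} {A : Matrix (Fin p) (Fin p) ℝ} {N : ℝ}
    (hA : IsDerivMatrix μ S ρ g (linearPredictor (colorDesign n S Z) β + ε) (colorDesign n S Z) A)
    (hχ : χ =ᶠ[𝓝 Z] fun _ => 1) (hZ : OpBound Z (K * n)) (hN : √n ≤ N) (hε : ‖ε‖ ≤ N) :
    |‖whiteResidual ρ g S β ε Z + (S * A).trace • mapVec (deriv ρ) (whiteResidual ρ g S β ε Z)‖ ^ 2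
        - ‖ε‖ ^ 2 - n * ‖whiteError ρ g S β ε Z‖ ^ 2|
      ≤ N * (3 + 2 * H₀ * √(looConst μ M K H₀) + 3 * (2 * K * (H₀ ^ 2 + looConst μ M K H₀))
        + 3 * (K * (H₀ / μ) ^ 2) + 4 * remainder N χ (whiteError ρ g S β ε) ε Z) := by
  obtain ⟨hd, hD⟩ := hA.hasFDerivAt_whiteError
  set h := whiteError ρ g S β ε with hh
  set r := whiteResidual ρ g S β ε Z with hr
  set B := whiteMatrix S A with hB
  set t := (S * A).trace with ht
  have hn1 : (1 : ℝ) ≤ n := Nat.one_le_cast.2 H.n_pos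
  have hn0 : (0 : ℝ) < n := by linarith
  have hμ := H.μ_pos
  have hK := T.K_nonneg
  have hH0 := T.H_nonneg
  have hl := T.looConst_nonneg
  have hbh := T.bound_h Z hZ
  set e : Fin n → ℝ := fun i => deriv (deriv ρ) (r i) * inner ℝ (h Z) (B (Z i)) with he
  -- The trace `tr[S A]` appears as the row divergence of `h`; this is why the criterion carries
  -- this correction of the residuals.
  have hdiv : ∀ i, ∑ j, fderiv ℝ h Z (designBasis (i, j)) j = t * deriv ρ (r i) - e i := fun i => by
    rw [ht, ← sum_whiteMatrix_single H.posDef A, he]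
    simp only [hD]
    rw [inner_eq_sum_mul, Finset.sum_mul, Finset.mul_sum, ← Finset.sum_sub_distrib]
    refine Finset.sum_congr rfl fun j _ => ?_
    simp only [PiLp.sub_apply, PiLp.smul_apply, smul_eq_mul]
    ring
  have hc : ‖r + t • mapVec (deriv ρ) r‖ ^ 2 = ∑ i, (ε i - rowDiv h Z i + e i) ^ 2 := by
    rw [EuclideanSpace.real_norm_sq_eq]
    refine Finset.sum_congr rfl fun i _ => ?_
    change (r i + t * deriv ρ (r i)) ^ 2 = _
    unfold rowDiv
    rw [hdiv, hr, whiteResidual_apply, ← hh]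
    ring
  have hBn : ‖B‖ ≤ (n * μ)⁻¹ := hA.opNorm_le
  -- Moving the matrix to the other side by its adjoint makes the sum a squared norm of `Z` applied
  -- to a vector of length at most `H₀/(nμ)`.
  have hesq : ∑ i, e i ^ 2 ≤ K * (H₀ / μ) ^ 2 := by
    have h1 : ∀ i, e i ^ 2 ≤ inner ℝ (Z i) (B.adjoint (h Z)) ^ 2 := fun i => by
      have h2 : inner ℝ (h Z) (B (Z i)) = inner ℝ (Z i) (B.adjoint (h Z)) := by
        rw [ContinuousLinearMap.adjoint_inner_right, real_inner_comm]
      rw [he]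
      simp only [mul_pow, h2]
      exact mul_le_of_le_one_left (sq_nonneg _)
        (pow_le_one₀ (H.loss.psi_deriv_nonneg _) (H.loss.psi_deriv_le_one _))
    refine (Finset.sum_le_sum fun i _ => h1 i).trans ((hZ _).trans ?_)
    have h3 : ‖B.adjoint (h Z)‖ ≤ (n * μ)⁻¹ * H₀ := by
      refine (B.adjoint.le_opNorm _).trans ?_
      rw [LinearIsometryEquiv.norm_map]
      exact mul_le_mul hBn hbh (norm_nonneg _) (by positivity)
    calc K * n * ‖B.adjoint (h Z)‖ ^ 2 ≤ K * n * ((n * μ)⁻¹ * H₀) ^ 2 := by gcongr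
      _ = K * (H₀ / μ) ^ 2 / n := by field_simp
      _ ≤ _ := div_le_self (by positivity) hn1
  -- The leave-one-out differences are square summable, so by Cauchy-Schwarz their sum is `O(√n)`.
  have hα : |∑ i, ‖h (dropRow i Z)‖ ^ 2 - n * ‖h Z‖ ^ 2|
      ≤ 2 * H₀ * √(looConst μ M K H₀) * √n := by
    have h1 : ∑ i, ‖h (dropRow i Z)‖ ^ 2 - n * ‖h Z‖ ^ 2
        = ∑ i, (‖h (dropRow i Z)‖ ^ 2 - ‖h Z‖ ^ 2) := by simp
    rw [h1]
    have h2 : ∀ i, |‖h (dropRow i Z)‖ ^ 2 - ‖h Z‖ ^ 2| ≤ 2 * H₀ * ‖h Z - h (dropRow i Z)‖ :=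
      fun i => by
        rw [sq_sub_sq, abs_mul, abs_of_nonneg (by positivity)]
        have h3 := abs_norm_sub_norm_le (h (dropRow i Z)) (h Z)
        rw [norm_sub_rev] at h3
        have h4 := T.bound_dropRow hZ i
        exact mul_le_mul (by linarith) h3 (abs_nonneg _) (by positivity)
    have h5 : ∑ i, ‖h Z - h (dropRow i Z)‖ ≤ √(looConst μ M K H₀) * √n := by
      have h6 := Real.sum_mul_le_sqrt_mul_sqrt Finset.univ (fun i => ‖h Z - h (dropRow i Z)‖)
        (fun _ => 1)
      simp only [mul_one, one_pow, Finset.sum_const, Finset.card_univ, Fintype.card_fin,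
        nsmul_eq_mul] at h6
      exact h6.trans (mul_le_mul_of_nonneg_right (Real.sqrt_le_sqrt (T.sum_loo_le hZ))
        (Real.sqrt_nonneg _))
    refine (Finset.abs_sum_le_sum_abs _ _).trans ((Finset.sum_le_sum fun i _ => h2 i).trans ?_)
    rw [← Finset.mul_sum, mul_assoc (2 * H₀)]
    exact mul_le_mul_of_nonneg_left h5 (by positivity)
  have hmain := abs_expansion_le (ε := fun i => ε i) (ξ := rowDiv h Z) (e := e)
    (b := fun i => inner ℝ (Z i) (h (dropRow i Z))) (N := N) (s := √n) (H := ‖h Z‖ ^ 2)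
    (Real.sq_sqrt hn0.le) (Real.one_le_sqrt.2 hn1) hN
    (by positivity : 0 ≤ 2 * K * (H₀ ^ 2 + looConst μ M K H₀))
    (by rw [← EuclideanSpace.real_norm_sq_eq]; exact pow_le_pow_left₀ (norm_nonneg _) hε 2)
    hesq (T.sum_inner_loo_sq_le hZ) hα (by positivity)
  rw [hc, EuclideanSpace.real_norm_sq_eq ε]
  refine hmain.trans (le_of_eq ?_)
  unfold remainder
  rw [noiseDiv_eq hχ hd, sqDiv_eq hχ]
  simp only [looDiv_eq hχ hd, Finset.sum_sub_distrib]

end Pointwise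

/-! ### Joint measurability of the divergences in noise and design. -/

section Measurability

theorem measurable_adjDeriv_param {n p : ℕ} {Y : Type*} [TopologicalSpace Y] [MeasurableSpace Y]
    [OpensMeasurableSpace Y] [LocallyCompactSpace Y] [SecondCountableTopology Y]
    {F : Y → Design n p → ℝ} (hF : Continuous fun w : Y × Design n p => F w.1 w.2)
    {α : Type*} (φ : α → Fin n × Fin p) (i : α) :
    Measurable fun w : Y × Design n p =>
      adjDeriv (fun i => designBasis (φ i)) (fun i => designCoord (φ i)) i (F w.1) w.2 := by
  unfold adjDeriv
  refine Measurable.sub (Continuous.measurable ?_) ?_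
  · exact ((designCoord (φ i)).continuous.comp continuous_snd).mul hF
  · have h1 : Continuous (Function.uncurry fun (w : Y × Design n p) (t : ℝ) =>
        F w.1 (w.2 + t • designBasis (φ i))) := by
      have h2 : Continuous fun v : (Y × Design n p) × ℝ =>
        (v.1.1, v.1.2 + v.2 • (designBasis (φ i) : Design n p)) := by fun_prop
      exact hF.comp h2
    have h3 := measurable_deriv_with_param h1
    exact h3.comp (measurable_id.prodMk measurable_const)

end Measurability

/-! ### The error variable and its conditional mean. -/

section Remainder

variable {n p : ℕ} {μ M K H₀ γ : ℝ} {S : Matrix (Fin p) (Fin p) ℝ} {ρ : ℝ → ℝ} {g : Vec p → ℝ}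
  {χ : Design n p → ℝ}

theorem continuous_dropRow_comp {Y : Type*} [TopologicalSpace Y] {f : Y → Design n p → Vec p}
    (hf : Continuous fun w : Y × Design n p => f w.1 w.2) (i : Fin n) :
    Continuous fun w : Y × Design n p => f w.1 (dropRow i w.2) := by
  have : Continuous fun w : Y × Design n p => (w.1, dropRow i w.2) := by fun_prop
  exact hf.comp this

theorem measurable_remainder (H : IsLossPenalty n μ M S ρ g) (β : Vec p) (hχ : Continuous χ)
    (N : ℝ) : Measurable fun w : Vec n × Design n p =>
      remainder N χ (whiteError ρ g S β w.1) w.1 w.2 := by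
  have h1 := H.continuous_whiteError β
  have h2 := continuous_dropRow_comp h1
  have hχ' : Continuous fun w : Vec n × Design n p => χ w.2 := hχ.comp continuous_snd
  have hc : ∀ {f : Vec n × Design n p → Vec p}, Continuous f → ∀ j, Continuous fun w => f w j :=
    fun hf j => (EuclideanSpace.proj (𝕜 := ℝ) j).continuous.comp hf
  have hε : ∀ i, Continuous fun w : Vec n × Design n p => w.1 i := fun i =>
    (EuclideanSpace.proj (𝕜 := ℝ) i).continuous.comp continuous_fst
  have hz : ∀ i : Fin n, Continuous fun w : Vec n × Design n p => w.2 i := fun i =>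
    (continuous_apply i).comp continuous_snd
  unfold remainder
  refine ((Measurable.pow_const ?_ 2).div_const _).add
    (Finset.measurable_sum _ fun i _ => Measurable.pow_const ?_ 2) |>.add
    ((Measurable.pow_const ?_ 2).div_const _)
  · refine Finset.measurable_sum _ fun a _ => measurable_adjDeriv_param
      (F := fun ε Z => χ Z * (ε a.1 * whiteError ρ g S β ε Z a.2)) ?_ id a
    exact hχ'.mul ((hε _).mul (hc h1 _))
  · refine Finset.measurable_sum _ fun j _ => measurable_adjDeriv_param
      (F := fun ε Z => χ Z * (whiteError ρ g S β ε Z j - whiteError ρ g S β ε (dropRow i Z) j)) ?_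
      (fun j => (i, j)) j
    exact hχ'.mul ((hc h1 _).sub (hc (h2 i) _))
  · refine Finset.measurable_sum _ fun a _ => measurable_adjDeriv_param
      (F := fun ε Z => χ Z * (whiteError ρ g S β ε (dropRow a.1 Z) a.2
        * inner ℝ (Z a.1) (whiteError ρ g S β ε (dropRow a.1 Z)))) ?_ id a
    exact hχ'.mul ((hc (h2 _) _).mul ((hz _).inner (h2 _)))

/-- A bound for the expected remainder. -/
def remainderConst (μ M K H₀ γ : ℝ) : ℝ :=
  (3 * H₀ ^ 2 + 2 * gradConst μ M H₀ γ) + (3 * looConst μ M K H₀ + 2 * gradConst μ M H₀ γ)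
    + ((3 * H₀ ^ 2 + 4 * gradConst μ M H₀ γ) * (2 * K * (H₀ ^ 2 + looConst μ M K H₀))
          + 8 * H₀ ^ 2 * (rowConst μ M H₀ * K + H₀ ^ 2))

/-- The normalizations by `N²`, `1` and `n` are exactly the orders of the three second moments, so
the bound does not depend on `n`. -/
theorem FieldSetup.lintegral_remainder_le {h : Design n p → Vec p} {ψ : Fin n → Design n p → ℝ}
    (T : FieldSetup μ M K H₀ γ h ψ χ) {N : ℝ} (hN : 0 < N) {ε : Vec n} (hε : ‖ε‖ ≤ N) :
    ∫⁻ Z, ENNReal.ofReal (remainder N χ h ε Z) ∂(designGaussian n p)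
      ≤ ENNReal.ofReal (remainderConst μ M K H₀ γ) := by
  have hg := T.gradConst_nonneg
  have hl := T.looConst_nonneg
  have hr := T.rowConst_nonneg
  have hK := T.K_nonneg
  have hn : (0 : ℝ) < n := Nat.cast_pos.2 T.n_pos
  have hmeas : ∀ {f : Design n p → ℝ} (_ : LipCompact f) (a : Fin n × Fin p), Measurable
      fun Z => designCoord a Z * f Z - lineDeriv ℝ f Z (designBasis a) := fun hf a =>
    ((designCoord _).continuous.measurable.mul hf.continuous.measurable).sub
      (measurable_lineDeriv hf.continuous)
  have m1 : Measurable fun Z => ENNReal.ofReal (noiseDiv χ h ε Z ^ 2 / N ^ 2) := by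
    refine (((Finset.measurable_sum _ fun a _ => ?_).pow_const 2).div_const _).ennreal_ofReal
    exact hmeas (T.cutoff.lip.mul_right (LocallyLipschitz.real_mul (LocallyLipschitz.const _)
      (locallyLipschitz_coord T.contractive.lip_h _))) a
  have m2 : ∀ i, Measurable fun Z => ENNReal.ofReal (looDiv χ h i Z ^ 2) := fun i => by
    refine ((Finset.measurable_sum _ fun a _ => ?_).pow_const 2).ennreal_ofReal
    exact hmeas (T.cutoff.lip.mul_right (LocallyLipschitz.real_sub
      (locallyLipschitz_coord T.contractive.lip_h _)
      (locallyLipschitz_coord (T.contractive.comp_dropRow i).lip_h _))) (i, a)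
  have e : ∀ Z, ENNReal.ofReal (remainder N χ h ε Z)
      = ENNReal.ofReal (noiseDiv χ h ε Z ^ 2 / N ^ 2)
        + ∑ i, ENNReal.ofReal (looDiv χ h i Z ^ 2) + ENNReal.ofReal (sqDiv χ h Z ^ 2 / n) :=
    fun Z => by
      unfold remainder
      rw [ENNReal.ofReal_add (by positivity) (by positivity),
        ENNReal.ofReal_add (by positivity) (by positivity),
        ENNReal.ofReal_sum_of_nonneg fun _ _ => sq_nonneg _]
  simp only [e]
  rw [lintegral_add_left (m1.fun_add (Finset.measurable_sum _ fun i _ => m2 i)),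
    lintegral_add_left m1]
  unfold remainderConst
  rw [ENNReal.ofReal_add (by positivity) (by positivity),
    ENNReal.ofReal_add (by positivity) (by positivity)]
  have hscale : ∀ (f : Design n p → ℝ) {c B : ℝ}, 0 < c →
      ∫⁻ Z, ENNReal.ofReal (f Z) ∂(designGaussian n p) ≤ ENNReal.ofReal (B * c) →
      ∫⁻ Z, ENNReal.ofReal (f Z / c) ∂(designGaussian n p) ≤ ENNReal.ofReal B := by
    intro f c B hc hle
    have e1 : ∀ Z, ENNReal.ofReal (f Z / c) = ENNReal.ofReal c⁻¹ * ENNReal.ofReal (f Z) := fun Z => by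
      rw [← ENNReal.ofReal_mul (by positivity), div_eq_inv_mul]
    simp only [e1]
    rw [lintegral_const_mul' _ _ ENNReal.ofReal_ne_top]
    refine (mul_le_mul_right hle _).trans (le_of_eq ?_)
    rw [← ENNReal.ofReal_mul (by positivity)]
    congr 1
    field_simp
  refine add_le_add (add_le_add ?_ T.lintegral_looDiv_le) ?_
  · refine hscale _ (by positivity) ((T.lintegral_noiseDiv_le ε).trans ?_)
    refine ENNReal.ofReal_le_ofReal ?_
    rw [mul_comm]
    exact mul_le_mul_of_nonneg_left (pow_le_pow_left₀ (norm_nonneg _) hε 2) (by positivity)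
  · exact hscale _ hn T.lintegral_sqDiv_le

/-- The criterion approximates `‖ε‖ ^ 2 + n ‖S ^ (1/2) (β̂ - β)‖ ^ 2` up to `N (1 + W)`, with a
nonnegative error variable `W` whose expectation is bounded. -/
theorem exists_error_variable {γ μ M : ℝ} (hγ : 0 < γ) (hμ : 0 < μ) (hM : 0 < M) :
    ∃ C : ℝ, 0 < C ∧ ∀ (n p : ℕ) (S : Matrix (Fin p) (Fin p) ℝ) (ρ : ℝ → ℝ) (g : Vec p → ℝ)
      (β : Vec p) (N : ℝ), IsLossPenalty n μ M S ρ g → (p : ℝ) / n ≤ γ → sqNormCov S β ≤ M →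
      √n ≤ N →
      ∃ W : Vec n × Design n p → ℝ, Measurable W ∧ (∀ w, 0 ≤ W w) ∧
        (∀ ε : Vec n, ‖ε‖ ≤ N →
          ∫⁻ Z, ENNReal.ofReal (W (ε, Z)) ∂(designGaussian n p) ≤ ENNReal.ofReal C) ∧
        ∀ (ε : Vec n) (Z : Design n p) (A : Matrix (Fin p) (Fin p) ℝ),
          ‖designOp n p Z‖ ≤ 2 * √n + √p → ‖ε‖ ≤ N →
          IsDerivMatrix μ S ρ g (linearPredictor (colorDesign n S Z) β + ε)
            (colorDesign n S Z) A →
          |‖whiteResidual ρ g S β ε Z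
              + (S * A).trace • mapVec (deriv ρ) (whiteResidual ρ g S β ε Z)‖ ^ 2
            - ‖ε‖ ^ 2 - n * ‖whiteError ρ g S β ε Z‖ ^ 2| ≤ N * (C * (1 + W (ε, Z))) := by
  -- On the good event the operator norm is at most `(2 + √γ) √n`; the support of the cutoff reaches
  -- 2 further, and `2 ≤ 2 √n`.
  set K := (4 + √γ) ^ 2 with hK
  have hK0 : 0 ≤ K := sq_nonneg _
  set H₀ := √M + 2 * M * √K / μ with hH₀
  have hH0 : 0 ≤ H₀ := by positivity
  have hg : 0 ≤ gradConst μ M H₀ γ := by unfold gradConst; positivity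
  have hl : 0 ≤ looConst μ M K H₀ := by unfold looConst; positivity
  have hr : 0 ≤ rowConst μ M H₀ := by unfold rowConst; positivity
  have hR : 0 ≤ remainderConst μ M K H₀ γ := by unfold remainderConst; positivity
  set C₁ := 3 + 2 * H₀ * √(looConst μ M K H₀) + 3 * (2 * K * (H₀ ^ 2 + looConst μ M K H₀))
        + 3 * (K * (H₀ / μ) ^ 2) with hC₁
  have hC₁0 : 0 ≤ C₁ := by positivity
  refine ⟨C₁ + 4 + remainderConst μ M K H₀ γ, by positivity,
    fun n p S ρ g β N H hdim hβ hN => ?_⟩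
  have hn1 : (1 : ℝ) ≤ n := Nat.one_le_cast.2 H.n_pos
  have hn0 : (0 : ℝ) < n := by linarith
  have hs1 : 1 ≤ √(n : ℝ) := Real.one_le_sqrt.2 hn1
  have hN0 : 0 < N := by linarith
  set L := (2 + √γ) * √n with hL
  have hcut : IsCutoff (opCutoff n p L) K := by
    refine isCutoff_opCutoff (by positivity) ?_
    rw [hK, ← Real.sq_sqrt hn0.le, ← mul_pow]
    refine pow_le_pow_left₀ (by positivity) ?_ 2
    rw [hL]
    linarith
  have hT : ∀ ε, FieldSetup μ M K H₀ γ (whiteError ρ g S β ε)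
      (fun i Z => deriv ρ (whiteResidual ρ g S β ε Z i)) (opCutoff n p L) := fun ε =>
    { n_pos := H.n_pos, μ_pos := hμ, K_nonneg := hK0, H_nonneg := hH0, γ_nonneg := hγ.le,
      dim_le := hdim, contractive := H.contractive_whiteError β ε, cutoff := hcut,
      bound_h := fun Z hZ => H.norm_whiteError_le β hβ hK0 ε hZ }
  refine ⟨fun w => remainder N (opCutoff n p L) (whiteError ρ g S β w.1) w.1 w.2,
    measurable_remainder H β hcut.lip.continuous N, fun w => remainder_nonneg _ _ _ _ _,
    fun ε hε => ((hT ε).lintegral_remainder_le hN0 hε).trans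
      (ENNReal.ofReal_le_ofReal (by linarith)), fun ε Z A hZ hε hA => ?_⟩
  have hZL : ‖designOp n p Z‖ ≤ L := by
    refine hZ.trans ?_
    have : √(p : ℝ) ≤ √γ * √n := by
      rw [← Real.sqrt_mul hγ.le]
      exact Real.sqrt_le_sqrt ((div_le_iff₀ hn0).1 hdim)
    rw [hL]; linarith
  have hop : OpBound Z (K * n) := fun v => by
    refine (opBound_of_norm_le hZL v).trans (mul_le_mul_of_nonneg_right ?_ (sq_nonneg _))
    rw [hL, mul_pow, Real.sq_sqrt hn0.le, hK]
    have := Real.sqrt_nonneg γ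
    gcongr
    linarith
  refine (abs_criterion_sub_le H (hT ε) hA (opCutoff_eventually_eq_one hZL) hop hN hε).trans ?_
  refine mul_le_mul_of_nonneg_left ?_ hN0.le
  have hW := remainder_nonneg N (opCutoff n p L) (whiteError ρ g S β ε) ε Z
  change C₁ + 4 * remainder N (opCutoff n p L) (whiteError ρ g S β ε) ε Z
    ≤ (C₁ + 4 + remainderConst μ M K H₀ γ)
      * (1 + remainder N (opCutoff n p L) (whiteError ρ g S β ε) ε Z)
  have h1 := mul_nonneg hC₁0 hW
  have h2 := mul_nonneg hR hW
  linarith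

end Remainder

/-! ### Transport between the given model and the whitened Gaussian model. -/

section Transport

variable {n p : ℕ} {μ M : ℝ} {S : Matrix (Fin p) (Fin p) ℝ} {ρ : ℝ → ℝ} {g : Vec p → ℝ}

/-- The design with rows `S ^ (-1/2) x_i`. -/
def whitenDesign (n : ℕ) (S : Matrix (Fin p) (Fin p) ℝ) : Design n p →L[ℝ] Design n p :=
  ContinuousLinearMap.pi fun i =>
    (LinearMap.toContinuousLinearMap (sqrtInvLin S)).comp (ContinuousLinearMap.proj i)

theorem whitenDesign_apply (X : Design n p) (i : Fin n) :
    whitenDesign n S X i = sqrtInvLin S (X i) := rfl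

theorem colorDesign_whitenDesign (hS : S.PosDef) (X : Design n p) :
    colorDesign n S (whitenDesign n S X) = X := by
  funext i
  rw [colorDesign_apply, whitenDesign_apply, sqrtLin_sqrtInvLin hS]

theorem opNorm_designMatrix_mul (hS : S.PosDef) (X : Design n p) :
    opNorm (designMatrix X * (sqrtMat S)⁻¹) = ‖designOp n p (whitenDesign n S X)‖ := by
  unfold opNorm
  congr 1
  ext1 v
  rw [designOp_apply]
  have h1 : Matrix.toEuclideanLin (designMatrix X * (sqrtMat S)⁻¹) v
      = linearPredictor X (sqrtInvLin S v) := by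
    rw [← designOp_apply, Matrix.toLpLin_mul_same]; rfl
  refine h1.trans ?_
  ext i
  change inner ℝ (X i) (sqrtInvLin S v) = inner ℝ (sqrtInvLin S (X i)) v
  conv_lhs => rw [← sqrtLin_sqrtInvLin hS (X i)]
  rw [inner_sqrtLin, sqrtLin_sqrtInvLin hS]

theorem map_sqrtInvLin_multivariateGaussian (hS : S.PosDef) :
    (multivariateGaussian 0 S).map (sqrtInvLin S) = stdGaussian (Vec p) := by
  have hm : Measurable (sqrtInvLin S) :=
    (LinearMap.toContinuousLinearMap (sqrtInvLin S)).continuous.measurable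
  unfold multivariateGaussian
  rw [Measure.map_map hm (by fun_prop)]
  have : (sqrtInvLin S) ∘ (fun x : Vec p => 0 + Matrix.toEuclideanCLM (𝕜 := ℝ) (CFC.sqrt S) x)
      = id := by
    funext x
    rw [Function.comp_apply, zero_add]
    exact sqrtInvLin_sqrtLin hS x
  rw [this, Measure.map_id]

/-- The passage from `(ε, Z)` to `(y, X)` is an invertible linear map, so Lebesgue-null sets pull
back to null sets. -/
theorem quasiMeasurePreserving_model (hS : S.PosDef) (β : Vec p) :
    Measure.QuasiMeasurePreserving (fun w : Vec n × Design n p =>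
      (linearPredictor (colorDesign n S w.2) β + w.1, colorDesign n S w.2)) volume volume := by
  set f : Vec n × Design n p →ₗ[ℝ] Vec n × Design n p :=
    ((modelMap n S β).comp (ContinuousLinearMap.snd ℝ (Vec n) (Design n p))
      + (ContinuousLinearMap.inl ℝ (Vec n) (Design n p)).comp
        (ContinuousLinearMap.fst ℝ (Vec n) (Design n p))).toLinearMap with hf
  have hfe : ∀ w, f w = (linearPredictor (colorDesign n S w.2) β + w.1, colorDesign n S w.2) :=
    fun w => by
      change modelMap n S β w.2 + (w.1, 0) = _
      rw [modelMap_apply, Prod.mk_add_mk, add_zero]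
  have hinj : LinearMap.ker f = ⊥ := by
    refine LinearMap.ker_eq_bot'.2 fun w hw => ?_
    rw [hfe, Prod.mk_eq_zero] at hw
    have h2 : w.2 = 0 := by
      funext i
      have h3 : sqrtLin S (w.2 i) = 0 := congrFun hw.2 i
      rw [← sqrtInvLin_sqrtLin hS (w.2 i), h3, map_zero]; rfl
    have h1 := hw.1
    rw [h2, map_zero, ← designOp_apply, map_zero, _root_.zero_apply, zero_add] at h1
    exact Prod.ext h1 h2
  have hdet : LinearMap.det f ≠ 0 :=
    (((LinearMap.isUnit_iff_ker_eq_bot f).2 hinj).map LinearMap.det).ne_zero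
  have h := Measure.LinearMap.quasiMeasurePreserving (volume : Measure (Vec n × Design n p)) f hdet
  have e : (⇑f) = fun w : Vec n × Design n p =>
      (linearPredictor (colorDesign n S w.2) β + w.1, colorDesign n S w.2) := funext hfe
  rwa [e] at h

namespace SelectionProblem.Assumptions

variable {D : SelectionProblem.{u} n} {γ μ q M : ℝ} {F : Measure ℝ}
  (H : D.Assumptions γ μ q M F)
include H

theorem isLossPenalty₁ (hn : 0 < n) (hμ : 0 < μ) : IsLossPenalty n μ M D.S D.ρ₁ D.g₁ :=
  ⟨hn, hμ, H.cov_posDef, H.loss₁, H.penalty₁, H.penalty_min₁, H.psi_bound₁⟩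

theorem isLossPenalty₂ (hn : 0 < n) (hμ : 0 < μ) : IsLossPenalty n μ M D.S D.ρ₂ D.g₂ :=
  ⟨hn, hμ, H.cov_posDef, H.loss₂, H.penalty₂, H.penalty_min₂, H.psi_bound₂⟩

theorem map_whitenDesign :
    D.P.map (fun ω => whitenDesign n D.S (D.X ω)) = designGaussian n D.p := by
  have := H.isProbabilityMeasure
  have hm : Measurable (sqrtInvLin D.S) :=
    (LinearMap.toContinuousLinearMap (sqrtInvLin D.S)).continuous.measurable
  have hX : ∀ i, Measurable fun ω => D.X ω i := fun i =>
    (measurable_pi_apply i).comp H.measurable_X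
  have h1 : iIndepFun (fun (i : Fin n) ω => sqrtInvLin D.S (D.X ω i)) D.P :=
    H.indep_rows.comp (fun _ => sqrtInvLin D.S) fun _ => hm
  have h2 := (iIndepFun_iff_map_fun_eq_pi_map fun i => (hm.comp (hX i)).aemeasurable).1 h1
  change D.P.map (fun ω i => sqrtInvLin D.S (D.X ω i)) = _
  refine h2.trans ?_
  unfold designGaussian
  congr 1
  funext i
  rw [← map_sqrtInvLin_multivariateGaussian H.cov_posDef, ← H.law_rows i,
    Measure.map_map hm (hX i)]

theorem map_pair :
    D.P.map (fun ω => (D.ε ω, whitenDesign n D.S (D.X ω)))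
      = (D.P.map D.ε).prod (designGaussian n D.p) := by
  have := H.isProbabilityMeasure
  have hw : Measurable (whitenDesign n D.S) := (whitenDesign n D.S).continuous.measurable
  have h1 : IndepFun D.ε (whitenDesign n D.S ∘ D.X) D.P :=
    (H.indep_X_ε.symm).comp measurable_id hw
  rw [← H.map_whitenDesign]
  exact (indepFun_iff_map_prod_eq_prod_map_map H.measurable_ε.aemeasurable
    (hw.comp H.measurable_X).aemeasurable).1 h1

theorem isProbabilityMeasure_noise (hn : 0 < n) : IsProbabilityMeasure F := by
  have := H.isProbabilityMeasure
  rw [← H.law_noise ⟨0, hn⟩]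
  refine Measure.isProbabilityMeasure_map ?_
  exact ((EuclideanSpace.proj (𝕜 := ℝ) _).continuous.measurable.comp H.measurable_ε).aemeasurable

theorem map_noise_absolutelyContinuous (hn : 0 < n) : D.P.map D.ε ≪ volume := by
  have := H.isProbabilityMeasure
  have := H.isProbabilityMeasure_noise hn
  have hε : ∀ i, Measurable fun ω => D.ε ω i := fun i =>
    (EuclideanSpace.proj (𝕜 := ℝ) i).continuous.measurable.comp H.measurable_ε
  have h2 := (iIndepFun_iff_map_fun_eq_pi_map fun i => (hε i).aemeasurable).1 H.indep_noise
  have h3 : D.P.map (fun ω i => D.ε ω i) ≪ (volume : Measure (Fin n → ℝ)) := by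
    rw [h2, volume_pi]
    refine pi_absolutelyContinuous fun i => ?_
    rw [H.law_noise i]; exact H.noise_continuous
  have h4 : D.P.map D.ε = (D.P.map (fun ω i => D.ε ω i)).map (WithLp.toLp 2) := by
    rw [Measure.map_map (by fun_prop) (measurable_pi_lambda _ hε)]
    rfl
  rw [h4, ← (PiLp.volume_preserving_toLp (Fin n)).map_eq]
  exact h3.map (by fun_prop)

/-- The joint law of noise and whitened design is absolutely continuous, by independence and the
densities of both; Lebesgue-almost-everywhere differentiability therefore becomes almost sure. -/
theorem ae_exists_isDerivMatrix {ρ : ℝ → ℝ} {g : Vec D.p → ℝ}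
    (hL : IsLossPenalty n μ M D.S ρ g) :
    ∀ᵐ ω ∂D.P, ∃ A, IsDerivMatrix μ D.S ρ g (D.y ω) (D.X ω) A := by
  have := H.isProbabilityMeasure
  have h1 := (quasiMeasurePreserving_model (n := n) H.cov_posDef D.βstar).ae
    hL.ae_exists_isDerivMatrix
  have h2 : (D.P.map D.ε).prod (designGaussian n D.p) ≪ volume :=
    (H.map_noise_absolutelyContinuous hL.n_pos).prod (designGaussian_absolutelyContinuous n D.p)
  have h3 := h2.ae_le h1
  rw [← H.map_pair] at h3
  have hw : Measurable (whitenDesign n D.S) := (whitenDesign n D.S).continuous.measurable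
  have h4 := ae_of_ae_map
    (H.measurable_ε.prodMk (hw.comp H.measurable_X)).aemeasurable h3
  filter_upwards [h4] with ω hω
  simp only [Function.comp_apply, colorDesign_whitenDesign H.cov_posDef] at hω
  exact hω

end SelectionProblem.Assumptions

end Transport

/-! ### The probability of a wrong selection. -/

section Selection

theorem measure_prod_le_of_section_le {α β : Type*} [MeasurableSpace α] [MeasurableSpace β]
    {μ : Measure α} {ν : Measure β} [IsProbabilityMeasure μ] [SFinite ν] {s : Set (α × β)}
    (hs : MeasurableSet s) {c : ENNReal} (h : ∀ x, ν (Prod.mk x ⁻¹' s) ≤ c) :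
    μ.prod ν s ≤ c := by
  rw [Measure.prod_apply hs]
  calc ∫⁻ x, ν (Prod.mk x ⁻¹' s) ∂μ ≤ ∫⁻ _, c ∂μ := lintegral_mono h
    _ = c := by simp

variable {n : ℕ}

theorem SelectionProblem.Assumptions.isDerivMatrix_white {D : SelectionProblem.{u} n}
    {γ μ q M : ℝ} {F : Measure ℝ} (H : D.Assumptions γ μ q M F) {ρ : ℝ → ℝ} {g : Vec D.p → ℝ}
    {A : Vec n → Design n D.p → Matrix (Fin D.p) (Fin D.p) ℝ} {ω : D.Ω} :
    let Z := whitenDesign n D.S (D.X ω)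
    (IsDerivMatrix μ D.S ρ g (D.y ω) (D.X ω) (A (D.y ω) (D.X ω)) →
      IsDerivMatrix μ D.S ρ g (linearPredictor (colorDesign n D.S Z) D.βstar + D.ε ω)
        (colorDesign n D.S Z) (A (D.y ω) (D.X ω))) ∧
    criterion D.S ρ g A (D.y ω) (D.X ω)
      = ‖whiteResidual ρ g D.S D.βstar (D.ε ω) Z + (D.S * A (D.y ω) (D.X ω)).trace •
          mapVec (deriv ρ) (whiteResidual ρ g D.S D.βstar (D.ε ω) Z)‖ ^ 2 ∧
    sqNormCov D.S (mEstimator ρ g (D.y ω) (D.X ω) - D.βstar)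
      = ‖whiteError ρ g D.S D.βstar (D.ε ω) Z‖ ^ 2 := by
  intro Z
  have e : colorDesign n D.S Z = D.X ω := colorDesign_whitenDesign H.cov_posDef _
  unfold whiteResidual whiteError
  rw [e]
  exact ⟨id, rfl, rfl⟩

/-- Since `q < 1`, errors of order `√n` are dominated by the noise scale `N`. -/
theorem sqrt_le_rpow {n : ℕ} {q : ℝ} (hn : 0 < n) (hq : q ∈ Set.Ioo (0 : ℝ) 1) :
    √(n : ℝ) ≤ (n : ℝ) ^ (1 / (1 + q)) := by
  rw [Real.sqrt_eq_rpow]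
  refine Real.rpow_le_rpow_of_exponent_le (Nat.one_le_cast.2 hn) ?_
  have := hq.1
  have := hq.2
  exact one_div_le_one_div_of_le (by linarith) (by linarith)

/-- Markov's inequality conditionally on the noise, then integration over the noise. The restriction
`‖ε‖ ≤ N` is part of the event because the conditional mean is controlled only there. -/
theorem measure_error_le {p : ℕ} {N C η q : ℝ} (hn : 0 < n) (hη : 0 < η) (hC : 0 < C) {ν : Measure (Vec n)} [IsProbabilityMeasure ν]
    {W₁ W₂ : Vec n × Design n p → ℝ} (hW₁ : Measurable W₁) (hW₂ : Measurable W₂)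
    (h₁ : ∀ w, 0 ≤ W₁ w) (h₂ : ∀ w, 0 ≤ W₂ w)
    (i₁ : ∀ ε : Vec n, ‖ε‖ ≤ N →
      ∫⁻ Z, ENNReal.ofReal (W₁ (ε, Z)) ∂(designGaussian n p) ≤ ENNReal.ofReal C)
    (i₂ : ∀ ε : Vec n, ‖ε‖ ≤ N →
      ∫⁻ Z, ENNReal.ofReal (W₂ (ε, Z)) ∂(designGaussian n p) ≤ ENNReal.ofReal C) :
    MeasurableSet {w : Vec n × Design n p | ‖w.1‖ ≤ N ∧
      η * (n : ℝ) ^ (q / (1 + q)) ≤ C * (2 + W₁ w + W₂ w)} ∧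
    ν.prod (designGaussian n p) {w | ‖w.1‖ ≤ N ∧
      η * (n : ℝ) ^ (q / (1 + q)) ≤ C * (2 + W₁ w + W₂ w)}
      ≤ ENNReal.ofReal (C * (2 + 2 * C) / η * (n : ℝ) ^ (-(q / (1 + q)))) := by
  have hn0 : (0 : ℝ) < n := Nat.cast_pos.2 hn
  set t := η * (n : ℝ) ^ (q / (1 + q)) with ht
  have ht0 : 0 < t := by positivity
  have hms : MeasurableSet {w : Vec n × Design n p | ‖w.1‖ ≤ N ∧ t ≤ C * (2 + W₁ w + W₂ w)} := by
    exact (measurableSet_le measurable_fst.norm measurable_const).inter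
      (measurableSet_le (f := fun _ => t) (g := fun w => C * (2 + W₁ w + W₂ w)) measurable_const
        (((hW₁.const_add _).add hW₂).const_mul _))
  refine ⟨hms, measure_prod_le_of_section_le hms fun ε => ?_⟩
  by_cases hε : ‖ε‖ ≤ N
  · have m1 : Measurable fun Z => W₁ (ε, Z) := hW₁.comp measurable_prodMk_left
    have m2 : Measurable fun Z => W₂ (ε, Z) := hW₂.comp measurable_prodMk_left
    have hlin : ∫⁻ Z, ENNReal.ofReal (C * (2 + W₁ (ε, Z) + W₂ (ε, Z))) ∂(designGaussian n p)
        ≤ ENNReal.ofReal (C * (2 + 2 * C)) := by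
      have e : ∀ Z, ENNReal.ofReal (C * (2 + W₁ (ε, Z) + W₂ (ε, Z)))
          = ENNReal.ofReal C * (ENNReal.ofReal 2 + ENNReal.ofReal (W₁ (ε, Z))
            + ENNReal.ofReal (W₂ (ε, Z))) := fun Z => by
        have := h₁ (ε, Z)
        rw [ENNReal.ofReal_mul hC.le, ENNReal.ofReal_add (by positivity) (h₂ _),
          ENNReal.ofReal_add (by positivity) (h₁ _)]
      simp only [e]
      rw [lintegral_const_mul' _ _ ENNReal.ofReal_ne_top,
        lintegral_add_right _ m2.ennreal_ofReal, lintegral_add_left measurable_const,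
        lintegral_const, measure_univ, mul_one, ENNReal.ofReal_mul hC.le]
      refine mul_le_mul_right ((add_le_add (add_le_add_right (i₁ ε hε) _) (i₂ ε hε)).trans
        (le_of_eq ?_)) _
      rw [← ENNReal.ofReal_add (by positivity) (by positivity),
        ← ENNReal.ofReal_add (by positivity) (by positivity)]
      congr 1
      ring
    calc designGaussian n p (Prod.mk ε ⁻¹' {w | ‖w.1‖ ≤ N ∧ t ≤ C * (2 + W₁ w + W₂ w)})
        ≤ designGaussian n p {Z | ENNReal.ofReal t
            ≤ ENNReal.ofReal (C * (2 + W₁ (ε, Z) + W₂ (ε, Z)))} :=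
          measure_mono fun Z hZ => ENNReal.ofReal_le_ofReal hZ.2
      _ ≤ (∫⁻ Z, ENNReal.ofReal (C * (2 + W₁ (ε, Z) + W₂ (ε, Z))) ∂(designGaussian n p))
            / ENNReal.ofReal t :=
          meas_ge_le_lintegral_div
            ((((m1.const_add _).add m2).const_mul _).ennreal_ofReal).aemeasurable
            (ENNReal.ofReal_pos.2 ht0).ne' ENNReal.ofReal_ne_top
      _ ≤ ENNReal.ofReal (C * (2 + 2 * C)) / ENNReal.ofReal t := by gcongr
      _ = _ := by
          rw [← ENNReal.ofReal_div_of_pos ht0, ht, Real.rpow_neg hn0.le]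
          congr 1
          field_simp
  · refine le_trans (le_of_eq ?_) zero_le
    have : Prod.mk ε ⁻¹' {w : Vec n × Design n p | ‖w.1‖ ≤ N ∧ t ≤ C * (2 + W₁ w + W₂ w)} = ∅ := by
      ext Z
      simp [hε]
    rw [this, measure_empty]

/-- The probability of selecting the worse estimator. -/
theorem exists_wrongSelection_bound {γ μ η q M : ℝ} (hγ : 0 < γ) (hμ : 0 < μ) (hη : 0 < η)
    (hq : q ∈ Set.Ioo (0 : ℝ) 1) (hM : 0 < M) :
    ∃ C : ℝ, 0 < C ∧ ∀ (n : ℕ) (D : SelectionProblem.{u} n) (F : Measure ℝ), 0 < n →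
        D.Assumptions γ μ q M F →
        ∀ A₁ A₂ : Vec n → Design n D.p → Matrix (Fin D.p) (Fin D.p) ℝ,
          IsDerivMatrixChoice μ D.S D.ρ₁ D.g₁ A₁ →
          IsDerivMatrixChoice μ D.S D.ρ₂ D.g₂ A₂ →
          (∀ᵐ ω ∂D.P,
            IsDerivMatrix μ D.S D.ρ₁ D.g₁ (D.y ω) (D.X ω) (A₁ (D.y ω) (D.X ω)) ∧
            IsDerivMatrix μ D.S D.ρ₂ D.g₂ (D.y ω) (D.X ω) (A₂ (D.y ω) (D.X ω))) ∧
          D.P (D.wrongSelection η A₁ A₂) ≤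
            ENNReal.ofReal (C * (n : ℝ) ^ (-(q / (1 + q)))) + D.P (D.goodEvent q)ᶜ := by
  obtain ⟨C, hC, hmain⟩ := exists_error_variable hγ hμ hM
  refine ⟨C * (2 + 2 * C) / η, by positivity, fun n D F hn H A₁ A₂ hA₁ hA₂ => ?_⟩
  have := H.isProbabilityMeasure
  have L₁ := H.isLossPenalty₁ hn hμ
  have L₂ := H.isLossPenalty₂ hn hμ
  have hae : ∀ᵐ ω ∂D.P,
      IsDerivMatrix μ D.S D.ρ₁ D.g₁ (D.y ω) (D.X ω) (A₁ (D.y ω) (D.X ω)) ∧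
      IsDerivMatrix μ D.S D.ρ₂ D.g₂ (D.y ω) (D.X ω) (A₂ (D.y ω) (D.X ω)) := by
    filter_upwards [H.ae_exists_isDerivMatrix L₁, H.ae_exists_isDerivMatrix L₂] with ω h1 h2
    exact ⟨hA₁ _ _ h1, hA₂ _ _ h2⟩
  refine ⟨hae, ?_⟩
  have hn0 : (0 : ℝ) < n := Nat.cast_pos.2 hn
  have hq0 : 0 < 1 + q := by linarith [hq.1]
  set N := (n : ℝ) ^ (1 / (1 + q)) with hN
  have hN0 : 0 < N := Real.rpow_pos_of_pos hn0 _
  obtain ⟨W₁, m₁, p₁, i₁, b₁⟩ := hmain n D.p D.S D.ρ₁ D.g₁ D.βstar N L₁ H.dim_le H.signal_bound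
    (sqrt_le_rpow hn hq)
  obtain ⟨W₂, m₂, p₂, i₂, b₂⟩ := hmain n D.p D.S D.ρ₂ D.g₂ D.βstar N L₂ H.dim_le H.signal_bound
    (sqrt_le_rpow hn hq)
  have : IsProbabilityMeasure (D.P.map D.ε) :=
    Measure.isProbabilityMeasure_map H.measurable_ε.aemeasurable
  obtain ⟨hms, hmeas⟩ := measure_error_le (ν := D.P.map D.ε) hn hη hC m₁ m₂ p₁ p₂ i₁ i₂
  set G := {w : Vec n × Design n D.p | ‖w.1‖ ≤ N ∧
      η * (n : ℝ) ^ (q / (1 + q)) ≤ C * (2 + W₁ w + W₂ w)} with hG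
  set pair : D.Ω → Vec n × Design n D.p := fun ω => (D.ε ω, whitenDesign n D.S (D.X ω)) with hpair
  have hpm : Measurable pair := H.measurable_ε.prodMk
    ((whitenDesign n D.S).continuous.measurable.comp H.measurable_X)
  have hsub : D.wrongSelection η A₁ A₂ ≤ᵐ[D.P] (pair ⁻¹' G ∪ (D.goodEvent q)ᶜ : Set D.Ω) := by
    filter_upwards [hae] with ω hω hw
    by_cases hgood : ω ∈ D.goodEvent q
    · refine Or.inl ?_
      obtain ⟨g1, g2⟩ := hgood
      obtain ⟨w1, w2⟩ := hw
      have hε : ‖D.ε ω‖ ≤ N := by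
        refine le_of_sq_le_sq (le_trans g2 (le_of_eq ?_)) hN0.le
        rw [hN, ← Real.rpow_natCast, ← Real.rpow_mul hn0.le]
        congr 1
        push_cast
        field_simp
      have hZ : ‖designOp n D.p (whitenDesign n D.S (D.X ω))‖ ≤ 2 * √n + √D.p := by
        rw [← opNorm_designMatrix_mul H.cov_posDef]; exact g1
      obtain ⟨d1, c1, s1⟩ := H.isDerivMatrix_white (ρ := D.ρ₁) (g := D.g₁) (A := A₁) (ω := ω)
      obtain ⟨d2, c2, s2⟩ := H.isDerivMatrix_white (ρ := D.ρ₂) (g := D.g₂) (A := A₂) (ω := ω)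
      have k1 := b₁ _ _ _ hZ hε (d1 hω.1)
      have k2 := b₂ _ _ _ hZ hε (d2 hω.2)
      rw [← c1, ← s1] at k1
      rw [← c2, ← s2] at k2
      refine ⟨hε, ?_⟩
      rw [abs_le] at k1 k2
      -- This factorization turns the comparison of `n η` with errors of size `N` into the rate
      -- `n^(q/(1+q))`.
      have hnN : (n : ℝ) = N * (n : ℝ) ^ (q / (1 + q)) := by
        rw [hN, ← Real.rpow_add hn0]
        have : 1 / (1 + q) + q / (1 + q) = 1 := by field_simp
        rw [this, Real.rpow_one]
      have h3 : N * (η * (n : ℝ) ^ (q / (1 + q)))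
          ≤ N * (C * (2 + W₁ (pair ω) + W₂ (pair ω))) := by
        have h4 : N * (η * (n : ℝ) ^ (q / (1 + q))) = n * η := by
          rw [mul_left_comm, ← hnN, mul_comm]
        rw [h4]
        have h5 := mul_lt_mul_of_pos_left w1 hn0
        have h6 : N * (C * (2 + W₁ (pair ω) + W₂ (pair ω)))
          = N * (C * (1 + W₁ (pair ω))) + N * (C * (1 + W₂ (pair ω))) := by ring
        rw [h6]
        rw [mul_sub] at h5
        linarith [k1.1, k2.2]
      exact le_of_mul_le_mul_left h3 hN0
    · exact Or.inr hgood
  calc D.P (D.wrongSelection η A₁ A₂) ≤ D.P (pair ⁻¹' G ∪ (D.goodEvent q)ᶜ) := measure_mono_ae hsub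
    _ ≤ D.P (pair ⁻¹' G) + D.P (D.goodEvent q)ᶜ := measure_union_le _ _
    _ ≤ _ := by
      gcongr
      rw [← Measure.map_apply hpm hms, hpair, H.map_pair]
      exact hmeas

end Selection

/-! ### Gaussian comparison of maxima. -/

section Slepian

variable {κ : Type*} [Fintype κ]

theorem integrable_inner_stdGaussian (w : EuclideanSpace ℝ κ) :
    Integrable (fun x => inner ℝ w x) (stdGaussian (EuclideanSpace ℝ κ)) :=
  (IsGaussian.memLp_dual (stdGaussian (EuclideanSpace ℝ κ)) (innerSL ℝ w) 1
    ENNReal.one_ne_top).integrable le_rfl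

/-- Gaussian integration by parts for bounded functions with bounded derivatives. -/
theorem integral_inner_mul_stdGaussian {f : EuclideanSpace ℝ κ → ℝ} {w : EuclideanSpace ℝ κ}
    {f' : EuclideanSpace ℝ κ → ℝ} (hf : Differentiable ℝ f) (hfw : ∀ x, fderiv ℝ f x w = f' x)
    (hf' : Continuous f') {B B' : ℝ} (hB : ∀ x, |f x| ≤ B) (hB' : ∀ x, |f' x| ≤ B') :
    ∫ x, inner ℝ w x * f x ∂(stdGaussian (EuclideanSpace ℝ κ))
      = ∫ x, f' x ∂(stdGaussian (EuclideanSpace ℝ κ)) := by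
  obtain ⟨K, hK, hγ, hint⟩ := stdGaussian_eq_withDensity κ
  set D : EuclideanSpace ℝ κ → ℝ := fun x => K * Real.exp (-‖x‖ ^ 2 / 2) with hD
  have hD0 : ∀ x, 0 ≤ D x := fun x => by positivity
  have hDm : Measurable fun x => ENNReal.ofReal (D x) := by fun_prop
  have hlt : ∀ᵐ x ∂(volume : Measure (EuclideanSpace ℝ κ)), ENNReal.ofReal (D x) < ⊤ :=
    ae_of_all _ fun _ => ENNReal.ofReal_lt_top
  have hDd : ∀ x, HasFDerivAt D (-(D x) • innerSL ℝ x) x := fun x => by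
    have h1 : HasFDerivAt (fun x : EuclideanSpace ℝ κ => ‖x‖ ^ 2) (2 • innerSL ℝ x) x := by
      simpa using (hasStrictFDerivAt_norm_sq x).hasFDerivAt
    have h2 := (((h1.neg.mul_const (2⁻¹ : ℝ)).exp).const_mul K)
    simp only [← div_eq_mul_inv] at h2
    refine h2.congr_fderiv ?_
    ext y
    simp [hD]
    ring
  have hmoment : Integrable (fun x => inner ℝ w x * f x) (stdGaussian (EuclideanSpace ℝ κ)) :=
    (integrable_inner_stdGaussian w).mul_bdd hf.continuous.aestronglyMeasurable
      (ae_of_all _ fun x => by simpa using hB x)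
  rw [hγ] at hmoment ⊢
  rw [integrable_withDensity_iff_integrable_smul' hDm hlt] at hmoment
  rw [integral_withDensity_eq_integral_toReal_smul hDm hlt,
    integral_withDensity_eq_integral_toReal_smul hDm hlt]
  simp only [ENNReal.toReal_ofReal (hD0 _), smul_eq_mul] at hmoment ⊢
  have hDw : ∀ x, fderiv ℝ D x w = -(D x * inner ℝ w x) := fun x => by
    rw [(hDd x).fderiv]
    simp [real_inner_comm]
  have key := integral_mul_fderiv_eq_neg_fderiv_mul_of_integrable
    (μ := (volume : Measure (EuclideanSpace ℝ κ))) (f := f) (g := D) (v := w) ?_ ?_ ?_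
    (fun x _ => hf x) (fun x _ => (hDd x).differentiableAt)
  · simp only [hDw, hfw, mul_neg, integral_neg, neg_inj] at key
    calc ∫ x, D x * (inner ℝ w x * f x) = ∫ x, f x * (D x * inner ℝ w x) :=
          integral_congr_ae (ae_of_all _ fun x => by ring)
      _ = ∫ x, f' x * D x := key
      _ = ∫ x, D x * f' x := integral_congr_ae (ae_of_all _ fun x => mul_comm _ _)
  · simp only [hfw]
    exact hint.bdd_mul hf'.aestronglyMeasurable (ae_of_all _ fun x => by simpa using hB' x)
  · simp only [hDw]
    refine hmoment.neg.congr (ae_of_all _ fun x => ?_)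
    simp only [Pi.neg_apply]
    ring
  · exact hint.bdd_mul hf.continuous.aestronglyMeasurable (ae_of_all _ fun x => by simpa using hB x)

theorem mul_exp_neg_le_one {x S : ℝ} (h : x ≤ S) : x * Real.exp (-S) ≤ 1 := by
  have h1 : x ≤ Real.exp S := h.trans (by linarith [Real.add_one_le_exp S])
  calc x * Real.exp (-S) ≤ Real.exp S * Real.exp (-S) :=
        mul_le_mul_of_nonneg_right h1 (Real.exp_pos _).le
    _ = 1 := by rw [← Real.exp_add, add_neg_cancel, Real.exp_zero]

/-- The exponential is split into two equal factors, one for each of `x` and `y`. -/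
theorem mul_mul_exp_neg_le {x y S : ℝ} (hy : 0 ≤ y) (hxS : x ≤ S) (hyS : y ≤ S) :
    x * y * Real.exp (-S) ≤ 4 := by
  have e : Real.exp (-S) = Real.exp (-(S / 2)) * Real.exp (-(S / 2)) := by
    rw [← Real.exp_add]; congr 1; ring
  have h1 := mul_exp_neg_le_one (show x / 2 ≤ S / 2 by linarith)
  have h2 := mul_exp_neg_le_one (show y / 2 ≤ S / 2 by linarith)
  have h3 : 0 ≤ y / 2 * Real.exp (-(S / 2)) := by positivity
  calc x * y * Real.exp (-S)
      = 4 * ((x / 2 * Real.exp (-(S / 2))) * (y / 2 * Real.exp (-(S / 2)))) := by rw [e]; ring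
    _ ≤ 4 * (1 * 1) := by gcongr
    _ = 4 := by norm_num

variable {ι : Type*} [Fintype ι]

/-- The soft count `∑_t exp (l (⟨z_t, x⟩ - T))`. -/
def softCount (l T : ℝ) (z : ι → EuclideanSpace ℝ κ) (x : EuclideanSpace ℝ κ) : ℝ :=
  ∑ t, Real.exp (l * (inner ℝ (z t) x - T))

variable {l T : ℝ}

theorem exp_le_softCount (z : ι → EuclideanSpace ℝ κ) (x : EuclideanSpace ℝ κ) (t : ι) :
    Real.exp (l * (inner ℝ (z t) x - T)) ≤ softCount l T z x :=
  Finset.single_le_sum (f := fun t => Real.exp (l * (inner ℝ (z t) x - T)))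
    (fun _ _ => (Real.exp_pos _).le) (Finset.mem_univ t)

theorem softCount_nonneg (z : ι → EuclideanSpace ℝ κ) (x : EuclideanSpace ℝ κ) :
    0 ≤ softCount l T z x := Finset.sum_nonneg fun _ _ => (Real.exp_pos _).le

theorem continuous_softCount (z : ι → EuclideanSpace ℝ κ) : Continuous (softCount l T z) := by
  unfold softCount; fun_prop

theorem hasFDerivAt_softCount (z : ι → EuclideanSpace ℝ κ) (x : EuclideanSpace ℝ κ) :
    HasFDerivAt (softCount l T z)
      (∑ t, (Real.exp (l * (inner ℝ (z t) x - T)) * l) • innerSL ℝ (z t)) x := by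
  refine HasFDerivAt.fun_sum fun t _ => ?_
  have h := ((((innerSL ℝ (z t)).hasFDerivAt (x := x)).sub_const T).const_mul l).exp
  refine h.congr_fderiv ?_
  rw [smul_smul]; rfl

/-- Gaussian integration by parts in direction `w`. Orthogonality of `w` to `z_t` removes the
derivative of the first exponential, and only the derivative of the soft count remains. -/
theorem integral_inner_mul_softCount (z : ι → EuclideanSpace ℝ κ) (w : EuclideanSpace ℝ κ) (t : ι)
    (hw : inner ℝ w (z t) = 0) :
    ∫ x, inner ℝ w x * (Real.exp (l * (inner ℝ (z t) x - T)) * Real.exp (-softCount l T z x))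
        ∂(stdGaussian (EuclideanSpace ℝ κ))
      = ∫ x, -(l * ∑ s, inner ℝ w (z s) * (Real.exp (l * (inner ℝ (z t) x - T))
          * Real.exp (l * (inner ℝ (z s) x - T)) * Real.exp (-softCount l T z x)))
        ∂(stdGaussian (EuclideanSpace ℝ κ)) := by
  have hd : ∀ x, HasFDerivAt (fun x => Real.exp (l * (inner ℝ (z t) x - T))
      * Real.exp (-softCount l T z x)) (Real.exp (l * (inner ℝ (z t) x - T)) •
        (Real.exp (-softCount l T z x) •
          -∑ t, (Real.exp (l * (inner ℝ (z t) x - T)) * l) • innerSL ℝ (z t))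
        + Real.exp (-softCount l T z x) • (Real.exp (l * (inner ℝ (z t) x - T)) • l • innerSL ℝ (z t)))
      x := fun x => by
    have h1 := ((((innerSL ℝ (z t)).hasFDerivAt (x := x)).sub_const T).const_mul l).exp
    exact h1.mul (hasFDerivAt_softCount z x).neg.exp
  refine integral_inner_mul_stdGaussian (B := 1) (B' := |l| * ∑ s, |inner ℝ w (z s)| * 4)
    (fun x => (hd x).differentiableAt) (fun x => ?_) ?_ (fun x => ?_) fun x => ?_
  · rw [(hd x).fderiv]
    simp only [_root_.add_apply, _root_.smul_apply, _root_.neg_apply,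
      _root_.sum_apply, innerSL_apply_apply, smul_eq_mul, real_inner_comm w]
    rw [real_inner_comm, hw, mul_zero, mul_zero, mul_zero, add_zero, mul_neg, mul_neg, neg_inj,
      Finset.mul_sum, Finset.mul_sum, Finset.mul_sum]
    exact Finset.sum_congr rfl fun s _ => by ring
  · have := continuous_softCount (l := l) (T := T) z
    fun_prop
  · rw [abs_of_nonneg (by positivity)]
    exact mul_exp_neg_le_one (exp_le_softCount z x t)
  · rw [abs_neg, abs_mul]
    refine mul_le_mul_of_nonneg_left ((Finset.abs_sum_le_sum_abs _ _).trans
      (Finset.sum_le_sum fun s _ => ?_)) (abs_nonneg _)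
    rw [abs_mul, abs_of_nonneg (a := _ * _ * _) (by positivity)]
    exact mul_le_mul_of_nonneg_left (mul_mul_exp_neg_le (Real.exp_pos _).le
      (exp_le_softCount z x t) (exp_le_softCount z x s)) (abs_nonneg _)

/-- Slepian's comparison inequality for the soft maximum. -/
theorem slepian_softCount {a b : ι → EuclideanSpace ℝ κ} (hl : 0 ≤ l)
    (hab : ∀ t s, inner ℝ (a t) (b s) = 0) (hn : ∀ t, ‖a t‖ = ‖b t‖)
    (hle : ∀ t s, inner ℝ (b t) (b s) ≤ inner ℝ (a t) (a s)) :
    ∫ x, Real.exp (-softCount l T b x) ∂(stdGaussian (EuclideanSpace ℝ κ))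
      ≤ ∫ x, Real.exp (-softCount l T a x) ∂(stdGaussian (EuclideanSpace ℝ κ)) := by
  set γ := stdGaussian (EuclideanSpace ℝ κ) with hγ
  -- Rotation from `a` at `θ = 0` to `b` at `θ = π/2`, with `w` its derivative. As the two families
  -- are orthogonal, the inner products of `w` and `z` are `sin θ cos θ` times the covariance
  -- difference, which is zero on the diagonal by equality of norms and nonpositive elsewhere.
  set z : ℝ → ι → EuclideanSpace ℝ κ := fun θ t => Real.cos θ • a t + Real.sin θ • b t with hz
  set w : ℝ → ι → EuclideanSpace ℝ κ := fun θ t => -Real.sin θ • a t + Real.cos θ • b t with hw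
  have hwz : ∀ θ t s, inner ℝ (w θ t) (z θ s)
      = Real.sin θ * Real.cos θ * (inner ℝ (b t) (b s) - inner ℝ (a t) (a s)) := fun θ t s => by
    simp only [hz, hw, inner_add_left, inner_add_right, real_inner_smul_left,
      real_inner_smul_right, hab, real_inner_comm (a s) (b t)]
    ring
  set F' : ℝ → EuclideanSpace ℝ κ → ℝ := fun θ x => -(l * ∑ t, inner ℝ (w θ t) x *
    (Real.exp (l * (inner ℝ (z θ t) x - T)) * Real.exp (-softCount l T (z θ) x))) with hF'
  have hder : ∀ θ, HasDerivAt (fun θ => ∫ x, Real.exp (-softCount l T (z θ) x) ∂γ)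
      (∫ x, F' θ x ∂γ) θ := fun θ => by
    refine (hasDerivAt_integral_of_dominated_loc_of_deriv_le (s := Set.univ)
      (bound := fun x => l * ∑ t, (|inner ℝ (a t) x| + |inner ℝ (b t) x|))
      Filter.univ_mem (Eventually.of_forall fun θ => ?_) ?_ ?_ (ae_of_all _ fun x θ _ => ?_) ?_
      (ae_of_all _ fun x θ _ => ?_)).2
    · exact (Real.continuous_exp.comp (continuous_softCount (z θ)).neg).aestronglyMeasurable
    · refine (integrable_const (1 : ℝ)).mono'
        (Real.continuous_exp.comp (continuous_softCount (z θ)).neg).aestronglyMeasurable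
        (ae_of_all _ fun x => ?_)
      rw [Real.norm_eq_abs, Real.abs_exp, Real.exp_le_one_iff]
      linarith [softCount_nonneg (l := l) (T := T) (z θ) x]
    · have := continuous_softCount (l := l) (T := T) (z θ)
      have : Continuous (F' θ) := by fun_prop
      exact this.aestronglyMeasurable
    · simp only [hF', norm_neg, norm_mul, Real.norm_eq_abs, abs_of_nonneg hl]
      refine mul_le_mul_of_nonneg_left ((Finset.abs_sum_le_sum_abs _ _).trans
        (Finset.sum_le_sum fun t _ => ?_)) hl
      have h1 := mul_exp_neg_le_one (exp_le_softCount (l := l) (T := T) (z θ) x t)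
      have h2 : |inner ℝ (w θ t) x| ≤ |inner ℝ (a t) x| + |inner ℝ (b t) x| := by
        simp only [hw, inner_add_left, real_inner_smul_left]
        refine (abs_add_le _ _).trans (add_le_add ?_ ?_)
        · rw [abs_mul, abs_neg]
          exact mul_le_of_le_one_left (abs_nonneg _) (Real.abs_sin_le_one _)
        · rw [abs_mul]
          exact mul_le_of_le_one_left (abs_nonneg _) (Real.abs_cos_le_one _)
      rw [abs_mul, abs_of_nonneg (a := _ * Real.exp _) (by positivity)]
      exact (mul_le_of_le_one_right (abs_nonneg _) h1).trans h2
    · exact (integrable_finsetSum _ fun t _ => (integrable_inner_stdGaussian (a t)).abs.add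
        (integrable_inner_stdGaussian (b t)).abs).const_mul _
    · have h1 : ∀ t, HasDerivAt (fun θ => inner ℝ (z θ t) x) (inner ℝ (w θ t) x) θ := fun t => by
        simp only [hz, hw, inner_add_left, real_inner_smul_left]
        exact ((Real.hasDerivAt_cos θ).mul_const _).add ((Real.hasDerivAt_sin θ).mul_const _)
      have h2 : HasDerivAt (fun θ => softCount l T (z θ) x)
          (∑ t, Real.exp (l * (inner ℝ (z θ t) x - T)) * (l * inner ℝ (w θ t) x)) θ :=
        HasDerivAt.fun_sum fun t _ => (((h1 t).sub_const T).const_mul l).exp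
      refine h2.fun_neg.exp.congr_deriv ?_
      simp only [hF']
      rw [mul_neg, neg_inj, Finset.mul_sum, Finset.mul_sum]
      exact Finset.sum_congr rfl fun t _ => by ring
  have hval : ∀ θ ∈ Set.Icc 0 (Real.pi / 2), ∫ x, F' θ x ∂γ ≤ 0 := fun θ hθ => by
    have hs : 0 ≤ Real.sin θ :=
      Real.sin_nonneg_of_nonneg_of_le_pi hθ.1 (by linarith [hθ.2, Real.pi_pos])
    have hc : 0 ≤ Real.cos θ := Real.cos_nonneg_of_mem_Icc ⟨by linarith [hθ.1, Real.pi_pos], hθ.2⟩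
    have hint : ∀ t, Integrable (fun x => inner ℝ (w θ t) x *
        (Real.exp (l * (inner ℝ (z θ t) x - T)) * Real.exp (-softCount l T (z θ) x))) γ := fun t => by
      have := continuous_softCount (l := l) (T := T) (z θ)
      refine (integrable_inner_stdGaussian (w θ t)).mul_bdd (c := 1)
        (Continuous.aestronglyMeasurable (by fun_prop)) (ae_of_all _ fun x => ?_)
      rw [Real.norm_eq_abs, abs_of_nonneg (by positivity)]
      exact mul_exp_neg_le_one (exp_le_softCount (z θ) x t)
    simp only [hF']
    rw [integral_neg, integral_const_mul, integral_finsetSum _ fun t _ => hint t, neg_nonpos]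
    refine mul_nonneg hl (Finset.sum_nonneg fun t _ => ?_)
    rw [integral_inner_mul_softCount (z θ) (w θ t) t]
    · refine integral_nonneg fun x => ?_
      rw [Pi.zero_apply, neg_nonneg]
      refine mul_nonpos_of_nonneg_of_nonpos hl (Finset.sum_nonpos fun s _ => ?_)
      refine mul_nonpos_of_nonpos_of_nonneg ?_ (by positivity)
      rw [hwz]
      exact mul_nonpos_of_nonneg_of_nonpos (by positivity) (by linarith [hle t s])
    · rw [hwz, real_inner_self_eq_norm_sq, real_inner_self_eq_norm_sq, hn, sub_self, mul_zero]
  have hanti := antitoneOn_of_deriv_nonpos (convex_Icc 0 (Real.pi / 2))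
    (fun θ _ => (hder θ).continuousAt.continuousWithinAt)
    (fun θ _ => (hder θ).differentiableAt.differentiableWithinAt)
    (fun θ hθ => by rw [(hder θ).deriv]; exact hval θ (interior_subset hθ))
  have hpi : 0 ≤ Real.pi / 2 := by positivity
  have := hanti (Set.left_mem_Icc.2 hpi) (Set.right_mem_Icc.2 hpi) hpi
  simpa [hz] using this

/-- Slepian's inequality for the tails of maxima, up to a constant factor. -/
theorem slepian_measure_le {a b : ι → EuclideanSpace ℝ κ}
    (hab : ∀ t s, inner ℝ (a t) (b s) = 0) (hn : ∀ t, ‖a t‖ = ‖b t‖)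
    (hle : ∀ t s, inner ℝ (b t) (b s) ≤ inner ℝ (a t) (a s)) {T δ : ℝ} (hδ : 0 < δ) :
    (stdGaussian (EuclideanSpace ℝ κ)).real {x | ∃ t, T ≤ inner ℝ (a t) x}
      ≤ 2 * (stdGaussian (EuclideanSpace ℝ κ)).real {x | ∃ t, T - δ < inner ℝ (b t) x} := by
  set γ := stdGaussian (EuclideanSpace ℝ κ) with hγ
  set A := {x : EuclideanSpace ℝ κ | ∃ t, T ≤ inner ℝ (a t) x} with hA
  set B := {x : EuclideanSpace ℝ κ | ∃ t, T - δ < inner ℝ (b t) x} with hB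
  have hAm : MeasurableSet A := by
    rw [hA, Set.ofPred_exists]
    exact MeasurableSet.iUnion fun t => measurableSet_le measurable_const (by fun_prop)
  have hBm : MeasurableSet B := by
    rw [hB, Set.ofPred_exists]
    exact MeasurableSet.iUnion fun t => measurableSet_lt measurable_const (by fun_prop)
  -- If some `⟨a_t, x⟩ ≥ T`, the soft count is at least 1 and `exp(-1) ≤ 1/2`: this costs the factor
  -- 2. If all `⟨b_t, x⟩ ≤ T - δ`, the soft count is at most `card ι · exp(-lδ)`, which vanishes as
  -- `l → ∞`.
  have key : ∀ l : ℝ, 0 ≤ l →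
      γ.real A ≤ 2 * γ.real B + 2 * (Fintype.card ι * Real.exp (-(l * δ))) := fun l hl => by
    have hi : ∀ c : ι → EuclideanSpace ℝ κ,
        Integrable (fun x => Real.exp (-softCount l T c x)) γ := fun c => by
      refine (integrable_const (1 : ℝ)).mono'
        (Real.continuous_exp.comp (continuous_softCount c).neg).aestronglyMeasurable
        (ae_of_all _ fun x => ?_)
      rw [Real.norm_eq_abs, Real.abs_exp, Real.exp_le_one_iff]
      linarith [softCount_nonneg (l := l) (T := T) c x]
    have h1 : ∫ x, Real.exp (-softCount l T a x) ∂γ ≤ ∫ x, (1 - A.indicator (fun _ => 2⁻¹) x) ∂γ := by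
      refine integral_mono (hi a) ((integrable_const _).sub
        ((integrable_const _).indicator hAm)) fun x => ?_
      by_cases hx : x ∈ A
      · obtain ⟨t, ht⟩ := id hx
        rw [Set.indicator_of_mem hx]
        have h2 : 1 ≤ softCount l T a x :=
          (Real.one_le_exp (mul_nonneg hl (by linarith))).trans (exp_le_softCount a x t)
        have h3 : Real.exp (-softCount l T a x) ≤ Real.exp (-1) := Real.exp_le_exp.2 (by linarith)
        have h4 : Real.exp (-1) ≤ 2⁻¹ := by
          rw [Real.exp_neg]
          exact inv_anti₀ two_pos (by linarith [Real.add_one_le_exp (1 : ℝ)])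
        norm_num at h4 ⊢
        linarith
      · rw [Set.indicator_of_notMem hx, sub_zero, Real.exp_le_one_iff]
        linarith [softCount_nonneg (l := l) (T := T) a x]
    have h2 : ∫ x, (1 - B.indicator (fun _ => 1) x - Fintype.card ι * Real.exp (-(l * δ))) ∂γ
        ≤ ∫ x, Real.exp (-softCount l T b x) ∂γ := by
      refine integral_mono (((integrable_const _).sub
        ((integrable_const _).indicator hBm)).sub (integrable_const _)) (hi b) fun x => ?_
      have hc : (0 : ℝ) ≤ Fintype.card ι * Real.exp (-(l * δ)) := by positivity
      by_cases hx : x ∈ B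
      · simp only [Set.indicator_of_mem hx]
        linarith [Real.exp_pos (-softCount l T b x)]
      · simp only [Set.indicator_of_notMem hx]
        have h3 : softCount l T b x ≤ Fintype.card ι * Real.exp (-(l * δ)) := by
          unfold softCount
          calc _ ≤ ∑ _t : ι, Real.exp (-(l * δ)) := by
                refine Finset.sum_le_sum fun t _ => Real.exp_le_exp.2 ?_
                have : inner ℝ (b t) x ≤ T - δ := not_lt.1 fun h => hx ⟨t, h⟩
                nlinarith
            _ = _ := by simp
        linarith [Real.add_one_le_exp (-softCount l T b x)]
    have h3 := h2.trans ((slepian_softCount hl hab hn hle).trans h1)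
    have h4 : Integrable (fun x => 1 - B.indicator (fun _ => (1 : ℝ)) x) γ :=
      (integrable_const _).sub ((integrable_const _).indicator hBm)
    rw [integral_sub (integrable_const _) ((integrable_const _).indicator hAm),
      integral_sub h4 (integrable_const _), integral_sub (integrable_const _)
        ((integrable_const _).indicator hBm), integral_indicator_const _ hAm,
      integral_indicator_const _ hBm] at h3
    simp only [integral_const, probReal_univ, smul_eq_mul] at h3
    linarith
  have hlim : Tendsto (fun l : ℝ => 2 * γ.real B + 2 * (Fintype.card ι * Real.exp (-(l * δ))))
      atTop (𝓝 (2 * γ.real B + 2 * (Fintype.card ι * 0))) := by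
    refine tendsto_const_nhds.add (tendsto_const_nhds.mul (tendsto_const_nhds.mul ?_))
    exact Real.tendsto_exp_neg_atTop_nhds_zero.comp (tendsto_id.atTop_mul_const hδ)
  rw [mul_zero, mul_zero, add_zero] at hlim
  exact ge_of_tendsto hlim ((eventually_ge_atTop 0).mono key)

end Slepian

/-! ### Chebyshev bound for sums of squared Gaussian coordinates. -/

section ChiSquare

/-- The variance of the square of a standard Gaussian variable. -/
def gaussSqVar : ℝ := Var[fun x : ℝ => x ^ 2; gaussianReal 0 1]

theorem gaussSqVar_nonneg : 0 ≤ gaussSqVar := variance_nonneg _ _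

theorem memLp_sq_gaussianReal : MemLp (fun x : ℝ => x ^ 2) 2 (gaussianReal 0 1) := by
  refine (memLp_two_iff_integrable_sq (by fun_prop)).2 ?_
  have h := (memLp_id_gaussianReal (μ := 0) (v := 1) 4).integrable_norm_pow (by norm_num)
  refine h.congr (ae_of_all _ fun x => ?_)
  simp only [id, Real.norm_eq_abs]
  rw [← pow_mul]
  norm_num
  exact (Even.pow_abs (by decide) x)

theorem integral_sq_gaussianReal : ∫ x, x ^ 2 ∂(gaussianReal 0 1) = 1 := by
  have h := variance_id_gaussianReal (μ := 0) (v := 1)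
  rw [variance_of_integral_eq_zero aemeasurable_id integral_id_gaussianReal] at h
  simpa using h

/-- The squares are independent with mean one and finite variance; a polynomial tail is enough for
the limit, so no exponential moments are used. -/
theorem stdGaussian_sum_sq_ge_le {κ α : Type*} [Fintype κ] [Fintype α] {φ : α → κ}
    (hφ : Function.Injective φ) {c : ℝ} (hc : 0 < c) :
    stdGaussian (EuclideanSpace ℝ κ) {x | Fintype.card α + c ≤ ∑ a, x (φ a) ^ 2}
      ≤ ENNReal.ofReal (gaussSqVar * Fintype.card α / c ^ 2) := by
  set P : Measure (κ → ℝ) := Measure.pi fun _ => gaussianReal 0 1 with hP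
  have hev : ∀ k, P.map (fun x => x k) = gaussianReal 0 1 := fun k =>
    (measurePreserving_eval (fun _ : κ => gaussianReal 0 1) k).map_eq
  have hm : ∀ k : κ, Measurable fun x : κ → ℝ => x k := fun k => measurable_pi_apply k
  set X : α → (κ → ℝ) → ℝ := fun a x => x (φ a) ^ 2 with hX
  have hL : ∀ a, MemLp (X a) 2 P := fun a => by
    have h := memLp_sq_gaussianReal
    rw [← hev (φ a)] at h
    exact h.comp_of_map (hm _).aemeasurable
  have hmean : ∀ a, ∫ x, X a x ∂P = 1 := fun a => by
    have h := integral_sq_gaussianReal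
    rw [← hev (φ a), integral_map (hm _).aemeasurable (by fun_prop)] at h
    exact h
  have hvar : ∀ a, Var[X a; P] = gaussSqVar := fun a => by
    unfold gaussSqVar
    rw [← hev (φ a), variance_map (by fun_prop) (hm _).aemeasurable]
    rfl
  have hind : iIndepFun (fun (k : κ) (x : κ → ℝ) => (x k) ^ 2) P :=
    iIndepFun_pi (X := fun _ (x : ℝ) => x ^ 2) fun _ => by fun_prop
  have hsum : Var[∑ a, X a; P] = gaussSqVar * Fintype.card α := by
    rw [IndepFun.variance_sum (fun a _ => hL a)
      (fun a _ b _ hab => hind.indepFun (hφ.ne hab))]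
    simp [hvar, mul_comm]
  have hmeanS : ∫ x, (∑ a, X a) x ∂P = Fintype.card α := by
    simp only [Finset.sum_apply]
    rw [integral_finsetSum _ fun a _ => (hL a).integrable one_le_two]
    simp [hmean]
  rw [← map_pi_eq_stdGaussian, Measure.map_apply (by fun_prop)
    (measurableSet_le (by fun_prop) (by fun_prop))]
  have hch := meas_ge_le_variance_div_sq (μ := P) (X := ∑ a, X a)
    (memLp_finsetSum' _ fun a _ => hL a) hc
  rw [hsum, hmeanS] at hch
  refine (measure_mono fun x hx => ?_).trans hch
  have hx' : (Fintype.card α : ℝ) + c ≤ ∑ a, x (φ a) ^ 2 := hx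
  have e : (∑ a, X a) x = ∑ a, x (φ a) ^ 2 := by simp [hX]
  change c ≤ |(∑ a, X a) x - Fintype.card α|
  rw [e]
  exact le_trans (by linarith) (le_abs_self _)

end ChiSquare

/-! ### Operator norm of a Gaussian design by a Chevet-type comparison. -/

section OperatorNorm

variable {n p : ℕ}

/-- The design is realized as a block of coordinates of a larger Gaussian vector, leaving room for
the auxiliary variables of the comparison. Characteristic functions identify the law. -/
theorem map_stdGaussian_designGaussian (κ : Type*) [Fintype κ] :
    (stdGaussian (EuclideanSpace ℝ ((Fin n × Fin p) ⊕ κ))).map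
      (fun x i => WithLp.toLp 2 fun j => x (Sum.inl (i, j))) = designGaussian n p := by
  set Q : EuclideanSpace ℝ ((Fin n × Fin p) ⊕ κ) → Design n p :=
    fun x i => WithLp.toLp 2 fun j => x (Sum.inl (i, j)) with hQ
  have hQm : Measurable Q := by
    refine measurable_pi_lambda _ fun i => ?_
    fun_prop
  have : IsProbabilityMeasure ((stdGaussian (EuclideanSpace ℝ ((Fin n × Fin p) ⊕ κ))).map Q) :=
    Measure.isProbabilityMeasure_map hQm.aemeasurable
  refine charFun_eq_pi_iff.1 fun t => ?_
  rw [Measure.map_map (by fun_prop) hQm, charFun_apply, integral_map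
    (Measurable.aemeasurable (by fun_prop)) (by fun_prop)]
  set t' : EuclideanSpace ℝ ((Fin n × Fin p) ⊕ κ) :=
    WithLp.toLp 2 (Sum.elim (fun q => t q.1 q.2) fun _ => 0) with ht'
  have e : ∀ x, inner ℝ ((WithLp.toLp 2 ∘ Q) x) t = inner ℝ x t' := fun x => by
    rw [PiLp.inner_apply, PiLp.inner_apply, Fintype.sum_sum_type, Fintype.sum_prod_type]
    simp [ht', hQ, PiLp.inner_apply]
  simp only [e]
  rw [← charFun_apply, charFun_stdGaussian]
  simp only [charFun_stdGaussian]
  rw [← Complex.exp_sum]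
  congr 1
  have h1 : ‖t'‖ ^ 2 = ∑ i, ‖t i‖ ^ 2 := by
    rw [EuclideanSpace.real_norm_sq_eq, Fintype.sum_sum_type, Fintype.sum_prod_type]
    simp [ht', EuclideanSpace.real_norm_sq_eq]
  rw [← Finset.sum_div, Finset.sum_neg_distrib]
  congr 2
  exact_mod_cast h1

theorem inner_eq_sum {κ : Type*} [Fintype κ] (a b : EuclideanSpace ℝ κ) :
    inner ℝ a b = ∑ k, a k * b k := by
  simp [PiLp.inner_apply, mul_comm]

/-- The index set of the Gaussian variables in the comparison of Chevet type. -/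
abbrev ChevetIndex (n p : ℕ) : Type := (Fin n × Fin p) ⊕ (Unit ⊕ (Fin n ⊕ Fin p))

/-- The vector representing `uᵀ G v + z`. -/
def chevetA (u : Vec n) (v : Vec p) : EuclideanSpace ℝ (ChevetIndex n p) :=
  WithLp.toLp 2 (Sum.elim (fun q => u q.1 * v q.2) (Sum.elim (fun _ => 1) fun _ => 0))

/-- The vector representing `⟨g, u⟩ + ⟨h, v⟩`. -/
def chevetB (u : Vec n) (v : Vec p) : EuclideanSpace ℝ (ChevetIndex n p) :=
  WithLp.toLp 2 (Sum.elim (fun _ => 0) (Sum.elim (fun _ => 0) (Sum.elim (fun i => u i) fun j => v j)))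

theorem inner_chevetA (u : Vec n) (v : Vec p) (x : EuclideanSpace ℝ (ChevetIndex n p)) :
    inner ℝ (chevetA u v) x
      = ∑ i, ∑ j, u i * v j * x (Sum.inl (i, j)) + x (Sum.inr (Sum.inl ())) := by
  rw [inner_eq_sum, Fintype.sum_sum_type, Fintype.sum_prod_type, Fintype.sum_sum_type]
  simp [chevetA]

theorem inner_chevetB (u : Vec n) (v : Vec p) (x : EuclideanSpace ℝ (ChevetIndex n p)) :
    inner ℝ (chevetB u v) x
      = ∑ i, u i * x (Sum.inr (Sum.inr (Sum.inl i)))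
        + ∑ j, v j * x (Sum.inr (Sum.inr (Sum.inr j))) := by
  rw [inner_eq_sum, Fintype.sum_sum_type, Fintype.sum_sum_type, Fintype.sum_sum_type]
  simp [chevetB]

theorem inner_chevetA_chevetA (u u' : Vec n) (v v' : Vec p) :
    inner ℝ (chevetA u v) (chevetA u' v') = inner ℝ u u' * inner ℝ v v' + 1 := by
  rw [inner_chevetA, inner_eq_sum_mul u, inner_eq_sum_mul v, Finset.sum_mul_sum]
  simp only [chevetA, Sum.elim_inl, Sum.elim_inr]
  congr 1
  exact Finset.sum_congr rfl fun i _ => Finset.sum_congr rfl fun j _ => by ring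

theorem inner_chevetB_chevetB (u u' : Vec n) (v v' : Vec p) :
    inner ℝ (chevetB u v) (chevetB u' v') = inner ℝ u u' + inner ℝ v v' := by
  rw [inner_chevetB, inner_eq_sum_mul u, inner_eq_sum_mul v]
  simp [chevetB]

theorem inner_chevetA_chevetB (u u' : Vec n) (v v' : Vec p) :
    inner ℝ (chevetA u v) (chevetB u' v') = 0 := by
  rw [inner_chevetA]
  simp [chevetB]

theorem inner_linearPredictor (Z : Design n p) (u : Vec n) (v : Vec p) :
    inner ℝ u (designOp n p Z v) = ∑ i, ∑ j, u i * v j * Z i j := by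
  rw [designOp_apply, inner_eq_sum_mul]
  refine Finset.sum_congr rfl fun i _ => ?_
  change u i * inner ℝ (Z i) v = _
  rw [inner_eq_sum_mul, Finset.mul_sum]
  exact Finset.sum_congr rfl fun j _ => by ring

theorem sum_mul_le_of_norm_eq_one {k : ℕ} {u : Vec k} (hu : ‖u‖ = 1) (x : Fin k → ℝ) :
    ∑ i, u i * x i ≤ √(∑ i, x i ^ 2) := by
  have h := real_inner_le_norm u (WithLp.toLp 2 x)
  rw [hu, one_mul, inner_eq_sum_mul, EuclideanSpace.norm_eq] at h
  simpa using h

/-- A constant in the tail bound for the operator norm. -/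
def opTailConst (γ : ℝ) : ℝ := gaussSqVar * (1024 + 2 * (16 / 9) ^ 2 + 512 * γ)

/-- The process `uᵀ G v + z`, with `z` an extra Gaussian that equalizes the variances, is compared
with `⟨g, u⟩ + ⟨h, v⟩`, whose maximum is at most `‖g‖ + ‖h‖`. The bound does not involve the number
of pairs, which is what permits the passage to the whole spheres. -/
theorem finite_max_tail_le {ι : Type*} [Fintype ι] (u : ι → Vec n) (v : ι → Vec p)
    (hu : ∀ t, ‖u t‖ = 1) (hv : ∀ t, ‖v t‖ = 1) {γ : ℝ} (hn : 32 ≤ n) (hγ : (p : ℝ) / n ≤ γ) :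
    designGaussian n p {Z | ∃ t, 2 * √n + √p < inner ℝ (u t) (designOp n p Z (v t))}
      ≤ ENNReal.ofReal (opTailConst γ / n) := by
  have hn0 : (32 : ℝ) ≤ n := by exact_mod_cast hn
  have hn1 : (0 : ℝ) < n := by linarith
  have hsn : 0 < √(n : ℝ) := Real.sqrt_pos.2 hn1
  have hsq : √(n : ℝ) ^ 2 = n := Real.sq_sqrt hn1.le
  have hsp : √(p : ℝ) ^ 2 = p := Real.sq_sqrt (Nat.cast_nonneg p)
  have hv0 := gaussSqVar_nonneg
  have hp : (p : ℝ) ≤ γ * n := (div_le_iff₀ hn1).1 hγ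
  set G := stdGaussian (EuclideanSpace ℝ (ChevetIndex n p)) with hG
  set L := 2 * √(n : ℝ) + √p with hL
  set a := fun t => chevetA (u t) (v t) with ha
  set b := fun t => chevetB (u t) (v t) with hb
  have hm : MeasurableSet {Z : Design n p | ∃ t, L < inner ℝ (u t) (designOp n p Z (v t))} := by
    rw [Set.ofPred_exists]
    exact MeasurableSet.iUnion fun t => measurableSet_lt measurable_const (by fun_prop)
  -- The slack `√n` between `2√n + √p` and the typical size `√n + √p` is spent in four quarters: on
  -- `z ≥ -√n/4`, on the margin `δ` of the comparison, on `‖g‖ ≤ 5√n/4` and on `‖h‖ ≤ √p + √n/4`.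
  -- The condition `n ≥ 32` enters through `1 + n/32 ≤ n/16` for `z²`.
  set E1 := {x : EuclideanSpace ℝ (ChevetIndex n p) | ∃ t, L - √n / 4 ≤ inner ℝ (a t) x} with hE1
  set E2 := {x : EuclideanSpace ℝ (ChevetIndex n p) | ((Fintype.card Unit : ℕ) : ℝ) + n / 32
    ≤ ∑ i : Unit, x (Sum.inr (Sum.inl i)) ^ 2} with hE2
  set E3 := {x : EuclideanSpace ℝ (ChevetIndex n p) | ∃ t, L - √n / 4 - √n / 4 < inner ℝ (b t) x}
    with hE3
  set E4 := {x : EuclideanSpace ℝ (ChevetIndex n p) | ((Fintype.card (Fin n) : ℕ) : ℝ) + 9 * n / 16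
    ≤ ∑ i : Fin n, x (Sum.inr (Sum.inr (Sum.inl i))) ^ 2} with hE4
  set E5 := {x : EuclideanSpace ℝ (ChevetIndex n p) | ((Fintype.card (Fin p) : ℕ) : ℝ) + n / 16
    ≤ ∑ i : Fin p, x (Sum.inr (Sum.inr (Sum.inr i))) ^ 2} with hE5
  have b2 : G E2 ≤ ENNReal.ofReal (gaussSqVar * 1024 / n) := by
    refine (stdGaussian_sum_sq_ge_le (φ := fun i : Unit => Sum.inr (Sum.inl i))
      (fun _ _ _ => rfl) (by positivity)).trans (ENNReal.ofReal_le_ofReal ?_)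
    rw [Fintype.card_unit, div_le_div_iff₀ (by positivity) hn1]
    push_cast
    nlinarith [mul_nonneg hv0 hn1.le]
  have b4 : G E4 ≤ ENNReal.ofReal (gaussSqVar * (16 / 9) ^ 2 / n) := by
    refine (stdGaussian_sum_sq_ge_le (φ := fun i : Fin n => Sum.inr (Sum.inr (Sum.inl i)))
      (fun i j h => by simpa using h) (by positivity)).trans (ENNReal.ofReal_le_ofReal ?_)
    rw [Fintype.card_fin]
    refine le_of_eq ?_
    field_simp
  have b5 : G E5 ≤ ENNReal.ofReal (gaussSqVar * (256 * γ) / n) := by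
    refine (stdGaussian_sum_sq_ge_le (φ := fun i : Fin p => Sum.inr (Sum.inr (Sum.inr i)))
      (fun i j h => by simpa using h) (by positivity)).trans (ENNReal.ofReal_le_ofReal ?_)
    rw [Fintype.card_fin]
    calc gaussSqVar * p / (n / 16) ^ 2 ≤ gaussSqVar * (γ * n) / (n / 16) ^ 2 := by gcongr
      _ = _ := by field_simp; norm_num
  have s3 : E3 ⊆ E4 ∪ E5 := by
    rintro x ⟨t, ht⟩
    by_contra hcon
    rw [Set.mem_union, not_or] at hcon
    obtain ⟨h4, h5⟩ := hcon
    rw [hE4, Set.mem_ofPred_eq, not_le, Fintype.card_fin] at h4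
    rw [hE5, Set.mem_ofPred_eq, not_le, Fintype.card_fin] at h5
    have k4 : √(∑ i : Fin n, x (Sum.inr (Sum.inr (Sum.inl i))) ^ 2) ≤ 5 / 4 * √n := by
      refine Real.sqrt_le_iff.2 ⟨by positivity, ?_⟩
      rw [mul_pow, hsq]
      linarith
    have k5 : √(∑ i : Fin p, x (Sum.inr (Sum.inr (Sum.inr i))) ^ 2) ≤ √p + √n / 4 := by
      refine Real.sqrt_le_iff.2 ⟨by positivity, ?_⟩
      have : (√(p : ℝ) + √n / 4) ^ 2 = p + √p * √n / 2 + n / 16 := by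
        rw [add_sq, hsp, div_pow, hsq]; ring
      rw [this]
      have : 0 ≤ √(p : ℝ) * √n := by positivity
      linarith
    have k6 := sum_mul_le_of_norm_eq_one (hu t) fun i => x (Sum.inr (Sum.inr (Sum.inl i)))
    have k7 := sum_mul_le_of_norm_eq_one (hv t) fun i => x (Sum.inr (Sum.inr (Sum.inr i)))
    rw [hb, inner_chevetB] at ht
    linarith
  have b1 : G E1 ≤ 2 * G E3 := by
    have h := slepian_measure_le (a := a) (b := b)
      (fun t s => inner_chevetA_chevetB _ _ _ _)
      (fun t => by
        rw [← sq_eq_sq₀ (norm_nonneg _) (norm_nonneg _), ← real_inner_self_eq_norm_sq,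
          ← real_inner_self_eq_norm_sq, inner_chevetA_chevetA, inner_chevetB_chevetB,
          real_inner_self_eq_norm_sq, real_inner_self_eq_norm_sq, hu, hv]
        norm_num)
      -- With unit vectors the covariance inequality is `(1 - ⟨u, u'⟩)(1 - ⟨v, v'⟩) ≥ 0`.
      (fun t s => by
        rw [inner_chevetA_chevetA, inner_chevetB_chevetB]
        have h1 := real_inner_le_norm (u t) (u s)
        have h2 := real_inner_le_norm (v t) (v s)
        rw [hu, hu] at h1
        rw [hv, hv] at h2
        nlinarith)
      (T := L - √n / 4) (δ := √n / 4) (by positivity)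
    calc G E1 = ENNReal.ofReal (G.real E1) := (ofReal_measureReal (s := E1)).symm
      _ ≤ ENNReal.ofReal (2 * G.real E3) := ENNReal.ofReal_le_ofReal h
      _ = 2 * G E3 := by
          rw [ENNReal.ofReal_mul zero_le_two, ENNReal.ofReal_ofNat, ofReal_measureReal]
  rw [← map_stdGaussian_designGaussian (Unit ⊕ (Fin n ⊕ Fin p)), Measure.map_apply
    (measurable_pi_lambda _ fun i => by fun_prop) hm]
  calc _ ≤ G (E1 ∪ E2) := by
        refine measure_mono fun x hx => ?_
        obtain ⟨t, ht⟩ := hx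
        by_cases h2 : x ∈ E2
        · exact Or.inr h2
        · refine Or.inl ⟨t, ?_⟩
          rw [hE2, Set.mem_ofPred_eq, not_le, Fintype.card_unit] at h2
          simp only [Finset.univ_unique, Finset.sum_singleton, Nat.cast_one] at h2
          rw [inner_linearPredictor] at ht
          rw [ha, inner_chevetA]
          have h3 : -(√n / 4) ≤ x (Sum.inr (Sum.inl ())) := by
            refine (abs_le.1 (abs_le_of_sq_le_sq ?_ (by positivity))).1
            rw [div_pow, hsq]
            refine h2.le.trans ?_
            linarith
          linarith
    _ ≤ G E1 + G E2 := measure_union_le _ _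
    _ ≤ 2 * (G E4 + G E5) + G E2 := by
        gcongr
        exact b1.trans (by gcongr; exact (measure_mono s3).trans (measure_union_le _ _))
    _ ≤ 2 * (ENNReal.ofReal (gaussSqVar * (16 / 9) ^ 2 / n)
          + ENNReal.ofReal (gaussSqVar * (256 * γ) / n))
          + ENNReal.ofReal (gaussSqVar * 1024 / n) := by gcongr
    _ = _ := by
        have hγ0 : 0 ≤ γ := le_trans (by positivity) hγ
        rw [← ENNReal.ofReal_ofNat 2, ← ENNReal.ofReal_add (by positivity) (by positivity),
          ← ENNReal.ofReal_mul zero_le_two, ← ENNReal.ofReal_add (by positivity) (by positivity)]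
        congr 1
        unfold opTailConst
        ring

/-- The operator norm of a standard Gaussian design is at most `2 √n + √p` with high probability. -/
theorem designGaussian_opNorm_tail_le {γ : ℝ} (hn : 32 ≤ n) (hγ : (p : ℝ) / n ≤ γ) :
    designGaussian n p {Z | 2 * √n + √p < ‖designOp n p Z‖}
      ≤ ENNReal.ofReal (opTailConst γ / n) := by
  set L := 2 * √(n : ℝ) + √p with hL
  have hL0 : 0 ≤ L := by positivity
  rcases Nat.eq_zero_or_pos p with hp | hp
  · subst hp
    have : {Z : Design n 0 | L < ‖designOp n 0 Z‖} = ∅ := by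
      ext Z
      simp [hL0]
    rw [this, measure_empty]
    exact zero_le
  have : Nonempty (Fin n) := ⟨⟨0, by omega⟩⟩
  have : Nonempty (Fin p) := ⟨⟨0, hp⟩⟩
  have : Nonempty (Metric.sphere (0 : Vec n) 1) := (NormedSpace.sphere_nonempty.2 zero_le_one).to_subtype
  have : Nonempty (Metric.sphere (0 : Vec p) 1) := (NormedSpace.sphere_nonempty.2 zero_le_one).to_subtype
  -- The operator norm is the supremum over pairs of unit vectors, and exceeding `L` is an open
  -- condition on the pair, so it is seen by a dense sequence. The events for its initial segments
  -- increase, and each satisfies the same bound.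
  set U := TopologicalSpace.denseSeq (Metric.sphere (0 : Vec n) 1 × Metric.sphere (0 : Vec p) 1)
  set A : ℕ → Set (Design n p) := fun k =>
    {Z | ∃ t : Fin k, L < inner ℝ ((U t).1 : Vec n) (designOp n p Z (U t).2)} with hA
  have hmono : Monotone A := fun k l hkl Z ⟨t, ht⟩ => ⟨Fin.castLE hkl t, ht⟩
  have hsub : {Z : Design n p | L < ‖designOp n p Z‖} ⊆ ⋃ k, A k := by
    intro Z hZ
    have h1 : ∃ w : Metric.sphere (0 : Vec n) 1 × Metric.sphere (0 : Vec p) 1,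
        L < inner ℝ (w.1 : Vec n) (designOp n p Z w.2) := by
      by_contra! hcon
      refine absurd (show L < ‖designOp n p Z‖ from hZ) (not_lt.2 ?_)
      refine ContinuousLinearMap.opNorm_le_bound _ hL0 fun v => ?_
      by_cases hv : v = 0
      · simp [hv]
      by_cases hw : designOp n p Z v = 0
      · rw [hw, norm_zero]; positivity
      have hv' : 0 < ‖v‖ := norm_pos_iff.2 hv
      have hw' : 0 < ‖designOp n p Z v‖ := norm_pos_iff.2 hw
      have h2 := hcon (⟨‖designOp n p Z v‖⁻¹ • designOp n p Z v, by
        simp [norm_smul, hw'.ne']⟩, ⟨‖v‖⁻¹ • v, by simp [norm_smul, hv'.ne']⟩)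
      simp only [map_smul, real_inner_smul_left, real_inner_smul_right,
        real_inner_self_eq_norm_sq] at h2
      have h3 : ‖v‖⁻¹ * (‖designOp n p Z v‖⁻¹ * ‖designOp n p Z v‖ ^ 2)
          = ‖designOp n p Z v‖ / ‖v‖ := by field_simp
      rw [h3] at h2
      exact (div_le_iff₀ hv').1 h2
    have hopen : IsOpen {w : Metric.sphere (0 : Vec n) 1 × Metric.sphere (0 : Vec p) 1 |
        L < inner ℝ (w.1 : Vec n) (designOp n p Z w.2)} :=
      isOpen_lt continuous_const (by fun_prop)
    obtain ⟨k, hk⟩ := (TopologicalSpace.denseRange_denseSeq _).exists_mem_open hopen h1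
    exact Set.mem_iUnion.2 ⟨k + 1, ⟨⟨k, Nat.lt_succ_self k⟩, hk⟩⟩
  refine (measure_mono hsub).trans ?_
  rw [hmono.measure_iUnion]
  refine iSup_le fun k => ?_
  exact finite_max_tail_le (fun t : Fin k => ((U t).1 : Vec n)) (fun t => ((U t).2 : Vec p))
    (fun t => mem_sphere_zero_iff_norm.1 (U t).1.2) (fun t => mem_sphere_zero_iff_norm.1 (U t).2.2)
    hn hγ

end OperatorNorm

/-! ### Truncation for noise with a finite moment of order below two. -/

section Noise

/-- A truncation bound for sums of squares of identically distributed variables. -/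
theorem measure_sum_sq_gt_le {Ω : Type*} [MeasurableSpace Ω] {P : Measure Ω} {n : ℕ}
    {X : Fin n → Ω → ℝ} (hX : ∀ i, Measurable (X i)) {F : Measure ℝ} (hF : ∀ i, P.map (X i) = F)
    {s M N : ℝ} (hs : 0 ≤ s) (hs2 : s ≤ 2)
    (hmom : ∫⁻ x, ENNReal.ofReal (|x| ^ s) ∂F ≤ ENNReal.ofReal M) (hN : 0 < N)
    (hNn : N ^ s = n) {δ : ℝ} (hδ : 0 < δ) :
    P {ω | N ^ 2 < ∑ i, X i ω ^ 2}
      ≤ ENNReal.ofReal (δ ^ (-s)) * ∫⁻ x in {x | δ * N < |x|}, ENNReal.ofReal (|x| ^ s) ∂F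
        + ENNReal.ofReal (δ ^ (2 - s) * M) := by
  have hm : Measurable fun x : ℝ => ENNReal.ofReal (|x| ^ s) := by fun_prop
  have hset : MeasurableSet {x : ℝ | δ * N < |x|} := measurableSet_lt measurable_const (by fun_prop)
  have hδN : 0 < δ * N := by positivity
  -- Some variable exceeds the truncation level `δ N`: a union bound and Markov's inequality
  -- restricted to the tail, where `N^s = n` cancels the number of variables.
  have h1 : P (⋃ i, X i ⁻¹' {x | δ * N < |x|})
      ≤ ENNReal.ofReal (δ ^ (-s)) * ∫⁻ x in {x | δ * N < |x|}, ENNReal.ofReal (|x| ^ s) ∂F := by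
    calc P (⋃ i, X i ⁻¹' {x | δ * N < |x|}) ≤ ∑ i, P (X i ⁻¹' {x | δ * N < |x|}) :=
          measure_iUnion_fintype_le _ _
      _ = ∑ _i : Fin n, F {x | δ * N < |x|} :=
          Finset.sum_congr rfl fun i _ => by rw [← hF i, Measure.map_apply (hX i) hset]
      _ = ENNReal.ofReal (δ ^ (-s)) * (ENNReal.ofReal ((δ * N) ^ s) * F {x | δ * N < |x|}) := by
          rw [← mul_assoc, ← ENNReal.ofReal_mul (by positivity), Real.mul_rpow hδ.le hN.le,
            ← mul_assoc, ← Real.rpow_add hδ, neg_add_cancel, Real.rpow_zero, one_mul, hNn]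
          simp
      _ ≤ _ := by
          gcongr
          rw [← setLIntegral_const]
          exact setLIntegral_mono hm fun x hx =>
            ENNReal.ofReal_le_ofReal (Real.rpow_le_rpow hδN.le (le_of_lt hx) hs)
  -- When all variables are at most `δ N`, each square is at most `(δ N)^(2-s) |x|^s`, and Markov's
  -- inequality for the sum leaves the factor `δ^(2-s)`.
  have h2 : P {ω | ENNReal.ofReal (N ^ 2)
      ≤ ∑ i, ENNReal.ofReal ((δ * N) ^ (2 - s) * |X i ω| ^ s)}
      ≤ ENNReal.ofReal (δ ^ (2 - s) * M) := by
    have hN2 : ENNReal.ofReal (N ^ 2) ≠ 0 := (ENNReal.ofReal_pos.2 (by positivity)).ne'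
    have hXm : ∀ i, Measurable fun ω => ENNReal.ofReal ((δ * N) ^ (2 - s) * |X i ω| ^ s) :=
      fun i => by have := hX i; fun_prop
    refine (meas_ge_le_lintegral_div (Finset.measurable_sum _ fun i _ => hXm i).aemeasurable hN2
      ENNReal.ofReal_ne_top).trans ?_
    rw [lintegral_finsetSum _ fun i _ => hXm i]
    have h3 : ∀ i, ∫⁻ ω, ENNReal.ofReal ((δ * N) ^ (2 - s) * |X i ω| ^ s) ∂P
        ≤ ENNReal.ofReal ((δ * N) ^ (2 - s) * M) := fun i => by
      have h4 : ∀ ω, ENNReal.ofReal ((δ * N) ^ (2 - s) * |X i ω| ^ s)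
          = ENNReal.ofReal ((δ * N) ^ (2 - s)) * ENNReal.ofReal (|X i ω| ^ s) := fun ω =>
        ENNReal.ofReal_mul (by positivity)
      simp only [h4]
      rw [lintegral_const_mul' _ _ ENNReal.ofReal_ne_top, ENNReal.ofReal_mul (by positivity)]
      gcongr
      rw [← hF i, lintegral_map hm (hX i)] at hmom
      exact hmom
    refine (ENNReal.div_le_div_right (Finset.sum_le_sum fun i _ => h3 i) _).trans (le_of_eq ?_)
    rw [Finset.sum_const, Finset.card_univ, Fintype.card_fin, nsmul_eq_mul,
      ← ENNReal.ofReal_natCast, ← ENNReal.ofReal_mul (by positivity),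
      ← ENNReal.ofReal_div_of_pos (by positivity)]
    congr 1
    rw [← hNn, Real.mul_rpow hδ.le hN.le]
    have h5 : N ^ s * N ^ (2 - s) = N ^ 2 := by
      rw [← Real.rpow_add hN, add_sub_cancel, ← Real.rpow_natCast]; norm_num
    rw [div_eq_iff (by positivity), ← h5]
    ring
  refine (measure_mono fun ω hω => ?_).trans ((measure_union_le _ _).trans (add_le_add h1 h2))
  by_cases hc : ∃ i, δ * N < |X i ω|
  · obtain ⟨i, hi⟩ := hc
    exact Or.inl (Set.mem_iUnion.2 ⟨i, hi⟩)
  · push Not at hc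
    refine Or.inr ?_
    have hω' : N ^ 2 < ∑ i, X i ω ^ 2 := hω
    change ENNReal.ofReal (N ^ 2) ≤ ∑ i, ENNReal.ofReal ((δ * N) ^ (2 - s) * |X i ω| ^ s)
    rw [← ENNReal.ofReal_sum_of_nonneg fun i _ => by positivity]
    refine ENNReal.ofReal_le_ofReal (hω'.le.trans (Finset.sum_le_sum fun i _ => ?_))
    rcases (abs_nonneg (X i ω)).eq_or_lt with h0 | h0
    · rw [← sq_abs, ← h0, zero_pow two_ne_zero]; positivity
    · have h6 : X i ω ^ 2 = |X i ω| ^ (2 - s) * |X i ω| ^ s := by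
        rw [← Real.rpow_add h0, sub_add_cancel, ← sq_abs, ← Real.rpow_natCast]; norm_num
      rw [h6]
      exact mul_le_mul_of_nonneg_right (Real.rpow_le_rpow h0.le (hc i) (by linarith))
        (by positivity)

/-- The tail sets decrease to the empty set, and the integrand has finite integral. -/
theorem tendsto_tail_lintegral {F : Measure ℝ} [IsFiniteMeasure F] {s M δ : ℝ}
    (hmom : ∫⁻ x, ENNReal.ofReal (|x| ^ s) ∂F ≤ ENNReal.ofReal M) (hδ : 0 < δ) {N : ℕ → ℝ}
    (hN : Tendsto N atTop atTop) :
    Tendsto (fun n => ∫⁻ x in {x | δ * N n < |x|}, ENNReal.ofReal (|x| ^ s) ∂F) atTop (𝓝 0) := by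
  refine tendsto_setLIntegral_zero (hmom.trans_lt ENNReal.ofReal_lt_top).ne ?_
  have hanti : Antitone fun r : ℝ => {x : ℝ | r < |x|} := fun r r' h x hx => lt_of_le_of_lt h hx
  have hmeas : ∀ r : ℝ, NullMeasurableSet {x : ℝ | r < |x|} F := fun r =>
    (measurableSet_lt measurable_const (by fun_prop)).nullMeasurableSet
  have h := tendsto_measure_iInter_atTop hmeas hanti ⟨0, measure_ne_top F _⟩
  have hempty : ⋂ r : ℝ, {x : ℝ | r < |x|} = ∅ := by
    ext x
    simp only [Set.mem_iInter, Set.mem_empty_iff_false, iff_false, not_forall]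
    exact ⟨|x|, lt_irrefl |x|⟩
  rw [hempty, measure_empty] at h
  exact h.comp (hN.const_mul_atTop hδ)

end Noise

/-! ### Asymptotic negligibility of the complement of the good event. -/

section GoodEvent

variable {γ μ q M : ℝ} {F : Measure ℝ}

theorem SelectionProblem.Assumptions.measure_goodEvent_compl_le {n : ℕ}
    {D : SelectionProblem.{u} n} (H : D.Assumptions γ μ q M F) (hn : 32 ≤ n)
    (hq : q ∈ Set.Ioo (0 : ℝ) 1) {δ : ℝ} (hδ : 0 < δ) :
    D.P (D.goodEvent q)ᶜ ≤ ENNReal.ofReal (opTailConst γ / n)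
      + (ENNReal.ofReal (δ ^ (-(1 + q))) * ∫⁻ x in {x | δ * (n : ℝ) ^ (1 / (1 + q)) < |x|},
            ENNReal.ofReal (|x| ^ (1 + q)) ∂F
          + ENNReal.ofReal (δ ^ (2 - (1 + q)) * M)) := by
  have := H.isProbabilityMeasure
  have hn0 : (0 : ℝ) < n := Nat.cast_pos.2 (by omega)
  have hq0 : 0 < 1 + q := by linarith [hq.1]
  have hw : Measurable (whitenDesign n D.S) := (whitenDesign n D.S).continuous.measurable
  unfold SelectionProblem.goodEvent
  rw [Set.compl_inter]
  refine (measure_union_le _ _).trans (add_le_add ?_ ?_)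
  · refine le_trans (le_of_eq ?_) (designGaussian_opNorm_tail_le (n := n) (p := D.p) hn H.dim_le)
    have hset : MeasurableSet {Z : Design n D.p | 2 * √n + √D.p < ‖designOp n D.p Z‖} :=
      measurableSet_lt measurable_const (designOp n D.p).continuous.norm.measurable
    have hm : Measurable fun ω => whitenDesign n D.S (D.X ω) := hw.comp H.measurable_X
    rw [← H.map_whitenDesign, Measure.map_apply hm hset]
    congr 1
    ext ω
    change ¬ opNorm (designMatrix (D.X ω) * (sqrtMat D.S)⁻¹) ≤ 2 * √(n : ℝ) + √(D.p : ℝ)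
      ↔ 2 * √(n : ℝ) + √(D.p : ℝ) < ‖designOp n D.p (whitenDesign n D.S (D.X ω))‖
    rw [not_le, opNorm_designMatrix_mul H.cov_posDef]
  · have hN : 0 < (n : ℝ) ^ (1 / (1 + q)) := Real.rpow_pos_of_pos hn0 _
    have hNs : ((n : ℝ) ^ (1 / (1 + q))) ^ (1 + q) = n := by
      rw [← Real.rpow_mul hn0.le, one_div, inv_mul_cancel₀ hq0.ne', Real.rpow_one]
    have hε : ∀ i, Measurable fun ω => D.ε ω i := fun i =>
      (EuclideanSpace.proj (𝕜 := ℝ) i).continuous.measurable.comp H.measurable_ε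
    refine le_trans (measure_mono fun ω hω => ?_) (measure_sum_sq_gt_le hε H.law_noise hq0.le
      (by linarith [hq.2]) H.noise_moment hN hNs hδ)
    have h1 : ¬ ‖D.ε ω‖ ^ 2 ≤ (n : ℝ) ^ (2 / (1 + q)) := hω
    change ((n : ℝ) ^ (1 / (1 + q))) ^ 2 < ∑ i, D.ε ω i ^ 2
    rw [← EuclideanSpace.real_norm_sq_eq, ← Real.rpow_natCast, ← Real.rpow_mul hn0.le]
    refine lt_of_eq_of_lt ?_ (not_le.1 h1)
    congr 1
    push_cast
    field_simp

/-- The complement of the good event is asymptotically negligible. -/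
theorem tendsto_measure_goodEvent_compl (hq : q ∈ Set.Ioo (0 : ℝ) 1)
    {D : ∀ n : ℕ, SelectionProblem.{u} n}
    (H : ∀ n : ℕ, 0 < n → (D n).Assumptions γ μ q M F) :
    Tendsto (fun n => (D n).P ((D n).goodEvent q)ᶜ) atTop (𝓝 0) := by
  have hF : IsProbabilityMeasure F := (H 1 one_pos).isProbabilityMeasure_noise one_pos
  have hq0 : 0 < 1 + q := by linarith [hq.1]
  have hN : Tendsto (fun n : ℕ => (n : ℝ) ^ (1 / (1 + q))) atTop atTop :=
    (tendsto_rpow_atTop (by positivity)).comp tendsto_natCast_atTop_atTop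
  have hop : Tendsto (fun n : ℕ => ENNReal.ofReal (opTailConst γ / n)) atTop (𝓝 0) := by
    rw [← ENNReal.ofReal_zero]
    exact ENNReal.tendsto_ofReal (tendsto_const_div_atTop_nhds_zero_nat _)
  have hδlim : Tendsto (fun δ : ℝ => ENNReal.ofReal (δ ^ (2 - (1 + q)) * M)) (𝓝[>] 0) (𝓝 0) := by
    rw [← ENNReal.ofReal_zero]
    refine ENNReal.tendsto_ofReal ?_
    have h0 : (0 : ℝ) < 2 - (1 + q) := by linarith [hq.2]
    have h1 : Tendsto (fun δ : ℝ => δ ^ (2 - (1 + q)) * M) (𝓝 0) (𝓝 (0 ^ (2 - (1 + q)) * M)) :=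
      ((Real.continuousAt_rpow_const 0 _ (Or.inr h0.le)).tendsto).mul_const M
    rw [Real.zero_rpow h0.ne', zero_mul] at h1
    exact h1.mono_left nhdsWithin_le_nhds
  rw [ENNReal.tendsto_nhds_zero]
  intro ε hε
  have hε2 : 0 < ε / 2 := ENNReal.half_pos hε.ne'
  -- The truncation parameter is fixed first, making `δ^(1-q) M` small, which needs `q < 1`. The
  -- other terms then tend to zero in `n` for this `δ`; the tail integral involves only the fixed
  -- law `F`.
  obtain ⟨δ, hδε, hδ⟩ := ((ENNReal.tendsto_nhds_zero.1 hδlim (ε / 2) hε2).and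
    self_mem_nhdsWithin).exists
  have hδ0 : (0 : ℝ) < δ := hδ
  have htail := ENNReal.Tendsto.const_mul (a := ENNReal.ofReal (δ ^ (-(1 + q))))
    (tendsto_tail_lintegral (H 1 one_pos).noise_moment hδ0 hN) (Or.inr ENNReal.ofReal_ne_top)
  rw [mul_zero] at htail
  have hsum := hop.add htail
  rw [add_zero] at hsum
  filter_upwards [ENNReal.tendsto_nhds_zero.1 hsum (ε / 2) hε2, eventually_ge_atTop 32]
    with n hn hn32
  refine ((H n (by omega)).measure_goodEvent_compl_le hn32 hq hδ0).trans ?_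
  rw [← add_assoc]
  exact (add_le_add hn hδε).trans (ENNReal.add_halves ε).le

end GoodEvent

end MEstimation

end

theorem mainTheorem6 (γ μ η q M : ℝ) (hγ : 0 < γ) (hμ : 0 < μ) (hη : 0 < η)
    (hq : q ∈ Set.Ioo (0 : ℝ) 1) (hM : 0 < M) :
    ∃ C : ℝ, 0 < C ∧
      (∀ (n : ℕ) (D : MEstimation.SelectionProblem.{u} n) (F : Measure ℝ), 0 < n →
        D.Assumptions γ μ q M F →
        ∀ A₁ A₂ : MEstimation.Vec n → MEstimation.Design n D.p →
            Matrix (Fin D.p) (Fin D.p) ℝ,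
          MEstimation.IsDerivMatrixChoice μ D.S D.ρ₁ D.g₁ A₁ →
          MEstimation.IsDerivMatrixChoice μ D.S D.ρ₂ D.g₂ A₂ →
          (∀ᵐ ω ∂D.P,
            MEstimation.IsDerivMatrix μ D.S D.ρ₁ D.g₁ (D.y ω) (D.X ω) (A₁ (D.y ω) (D.X ω)) ∧
            MEstimation.IsDerivMatrix μ D.S D.ρ₂ D.g₂ (D.y ω) (D.X ω) (A₂ (D.y ω) (D.X ω))) ∧
          D.P (D.wrongSelection η A₁ A₂) ≤
            ENNReal.ofReal (C * (n : ℝ) ^ (-(q / (1 + q)))) + D.P (D.goodEvent q)ᶜ) ∧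
      (∀ (F : Measure ℝ) (D : ∀ n : ℕ, MEstimation.SelectionProblem.{u} n),
        (∀ n : ℕ, 0 < n → (D n).Assumptions γ μ q M F) →
        Tendsto (fun n : ℕ => ENNReal.ofReal (C * (n : ℝ) ^ (-(q / (1 + q))))
            + (D n).P ((D n).goodEvent q)ᶜ) atTop (𝓝 0)) := by
  obtain ⟨C, hC, h⟩ := MEstimation.exists_wrongSelection_bound hγ hμ hη hq hM
  refine ⟨C, hC, h, fun F D H => ?_⟩
  have hrate : Tendsto (fun n : ℕ => ENNReal.ofReal (C * (n : ℝ) ^ (-(q / (1 + q))))) atTop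
      (𝓝 0) := by
    have h0 : 0 < q / (1 + q) := div_pos hq.1 (by linarith [hq.1])
    have h1 := ((tendsto_rpow_neg_atTop h0).comp tendsto_natCast_atTop_atTop).const_mul C
    rw [mul_zero] at h1
    rw [← ENNReal.ofReal_zero]
    exact ENNReal.tendsto_ofReal h1
  have hsum := hrate.add (MEstimation.tendsto_measure_goodEvent_compl hq H)
  rwa [add_zero] at hsum
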